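/- Let $n\ge 1$, $s\in(0,1)$ and $T>0$. For $f:\mathbb{R}^n\to\mathbb{R}$ with $\int_{\mathbb{R}^n}\frac{|f(x)|}{(1+|x|)^{n+2s}}\,dx<\infty$ define the fractional Laplacian, with its multiplicative constant normalized to one, by the principal value $$(-\Delta)^s f(x)=\lim_{\varepsilon\to0^+}\int_{|y-x|>\varepsilon}\frac{f(x)-f(y)}{|y-x|^{n+2s}}\,dy .$$ The limit is a real number if $f$ is $C^2$ near $x$, and exists in $[-\infty,\infty)$ at every $x$ if $f$ is semiconvex, that is, if $f+C|x|^2/2$ is convex for some $C\in\mathbb{R}$. Let $\psi,u_0:\mathbb{R}^n\to\mathbb{R}$ be globally Lipschitz and semiconvex, with $u_0\ge\psi$ and $\int_{\mathbb{R}^n}\frac{|\psi(x)|}{(1+|x|)^{n+2s}}\,dx<\infty$. Let $u:[0,T]\times\mathbb{R}^n\to\mathbb{R}$ be a continuous viscosity solution of the obstacle problem $$\min\{u_t+(-\Delta)^s u,\;u-\psi\}=0 ,\qquad u(0,\cdot)=u_0 .$$ This means: $u$ is continuous on $[0,T]\times\mathbb{R}^n$, $\int_{\mathbb{R}^n}\frac{|u(t,x)|}{(1+|x|)^{n+2s}}\,dx<\infty$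 for every $t\in[0,T]$, $u(0,\cdot)=u_0$, and whenever $(t_0,x_0)\in(0,T)\times\mathbb{R}^n$, $r>0$ and $\varphi\in C^2(\mathbb{R}\times\mathbb{R}^n)$ satisfies $\varphi(t_0,x_0)=u(t_0,x_0)$ and $u\le\varphi$ (respectively $u\ge\varphi$) at all $(t,x)$ with $t\in(0,T)$, $|t-t_0|<r$, $|x-x_0|<r$, then, with $v=\varphi(t_0,\cdot)$ in $B_r(x_0)$ and $v=u(t_0,\cdot)$ outside $B_r(x_0)$, $$\min\{\varphi_t(t_0,x_0)+(-\Delta)^s v(x_0),\;u(t_0,x_0)-\psi(x_0)\}\le 0\qquad(\text{respectively }\ge 0).$$ Then $$\|u_t\|_{L^\infty([0,T]\times\mathbb{R}^n)}+\|\nabla u\|_{L^\infty([0,T]\times\mathbb{R}^n)}\le\max\{\|\nabla u_0\|_{L^\infty(\mathbb{R}^n)},\|\nabla\psi\|_{L^\infty(\mathbb{R}^n)}\}+\|(-\Delta)^s u_0\|_{L^\infty(\mathbb{R}^n)},$$ where $\nabla$ is the gradient in $x$ and the right-hand side may be $+\infty$. If $\|(-\Delta)^s u_0\|_{L^\infty(\mathbb{R}^n)}<\infty$,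 then $u$ is Lipschitz in space-time, i.e. on $[0,T]\times\mathbb{R}^n$. -/

import Mathlib

open MeasureTheory Set Filter Topology

noncomputable section

/-- The weighted integrability `∫ |f(x)| / (1 + |x|)^(n + 2s) dx < ∞` under which the fractional
Laplacian of order `s` of `f` makes sense. -/
def WeightedIntegrable {n : ℕ} (s : ℝ) (f : EuclideanSpace ℝ (Fin n) → ℝ) : Prop :=
  Integrable (fun x => f x / (1 + ‖x‖) ^ ((n : ℝ) + 2 * s))

/-- `∫_{|y - x| > ε} (f(x) - f(y)) / |y - x|^(n + 2s) dy`. -/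
def truncFracLap {n : ℕ} (s : ℝ) (f : EuclideanSpace ℝ (Fin n) → ℝ)
    (x : EuclideanSpace ℝ (Fin n)) (ε : ℝ) : ℝ :=
  ∫ y in (Metric.closedBall x ε)ᶜ, (f x - f y) / ‖y - x‖ ^ ((n : ℝ) + 2 * s)

/-- The fractional Laplacian `(-Δ)^s f (x) = p.v. ∫ (f(x) - f(y)) / |y - x|^(n + 2s) dy`,
with the multiplicative constant normalized to one, as an extended real number.
The principal value is the limit of the truncated integrals as `ε → 0+`. For weighted integrable
`f` that limit exists as a real number if `f` is `C²` near `x`, and it exists in `[-∞, ∞)` at every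
`x` if `f` is semiconvex; `limsup` only serves to have a total operation. -/
def fracLap {n : ℕ} (s : ℝ) (f : EuclideanSpace ℝ (Fin n) → ℝ)
    (x : EuclideanSpace ℝ (Fin n)) : EReal :=
  limsup (fun ε : ℝ => ((truncFracLap s f x ε : ℝ) : EReal)) (𝓝[>] 0)

/-- The norm `‖(-Δ)^s f‖` in `L^∞(ℝⁿ)`, with values in `[0, ∞]`. -/
def fracLapNorm {n : ℕ} (s : ℝ) (f : EuclideanSpace ℝ (Fin n) → ℝ) : ENNReal :=
  essSup (fun x => (fracLap s f x).abs) volume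

/-- `f + C |x|² / 2` is convex for some real constant `C`. -/
def IsSemiconvex {n : ℕ} (f : EuclideanSpace ℝ (Fin n) → ℝ) : Prop :=
  ∃ C : ℝ, ConvexOn ℝ univ (fun x => f x + C * ‖x‖ ^ 2 / 2)

open Classical in
/-- The function equal to `g` in the open ball `B_r(x₀)` and to `f` outside of it. -/
def glue {n : ℕ} (x₀ : EuclideanSpace ℝ (Fin n)) (r : ℝ)
    (g f : EuclideanSpace ℝ (Fin n) → ℝ) : EuclideanSpace ℝ (Fin n) → ℝ :=
  fun y => if y ∈ Metric.ball x₀ r then g y else f y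

/-- The left-hand side `min {∂ₜφ + (-Δ)^s v, u - ψ}` of the obstacle equation at `(t₀, x₀)`,
evaluated on a test function `φ`; here `v` is `φ(t₀, ·)` in `B_r(x₀)` and `u(t₀, ·)` outside. -/
def obstacleOp {n : ℕ} (s : ℝ) (ψ : EuclideanSpace ℝ (Fin n) → ℝ)
    (u : ℝ → EuclideanSpace ℝ (Fin n) → ℝ) (φ : ℝ × EuclideanSpace ℝ (Fin n) → ℝ)
    (t₀ : ℝ) (x₀ : EuclideanSpace ℝ (Fin n)) (r : ℝ) : EReal :=
  min (((deriv (fun t => φ (t, x₀)) t₀ : ℝ) : EReal)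
        + fracLap s (glue x₀ r (fun y => φ (t₀, y)) (u t₀)) x₀)
    ((u t₀ x₀ - ψ x₀ : ℝ) : EReal)

/-- Viscosity subsolutions of `min {uₜ + (-Δ)^s u, u - ψ} = 0` in `(0, T) × ℝⁿ`: the `C²` test
functions touch `u` from above at `(t₀, x₀)`, in a cylinder around that point. -/
def IsViscositySubsolution {n : ℕ} (s T : ℝ) (ψ : EuclideanSpace ℝ (Fin n) → ℝ)
    (u : ℝ → EuclideanSpace ℝ (Fin n) → ℝ) : Prop :=
  ∀ φ : ℝ × EuclideanSpace ℝ (Fin n) → ℝ, ContDiff ℝ 2 φ →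
    ∀ t₀ ∈ Ioo 0 T, ∀ x₀ : EuclideanSpace ℝ (Fin n), ∀ r > 0,
      φ (t₀, x₀) = u t₀ x₀ →
      (∀ t ∈ Ioo 0 T, |t - t₀| < r → ∀ x ∈ Metric.ball x₀ r, u t x ≤ φ (t, x)) →
      obstacleOp s ψ u φ t₀ x₀ r ≤ 0

/-- Viscosity supersolutions of `min {uₜ + (-Δ)^s u, u - ψ} = 0` in `(0, T) × ℝⁿ`: the `C²` test
functions touch `u` from below at `(t₀, x₀)`, in a cylinder around that point. -/
def IsViscositySupersolution {n : ℕ} (s T : ℝ) (ψ : EuclideanSpace ℝ (Fin n) → ℝ)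
    (u : ℝ → EuclideanSpace ℝ (Fin n) → ℝ) : Prop :=
  ∀ φ : ℝ × EuclideanSpace ℝ (Fin n) → ℝ, ContDiff ℝ 2 φ →
    ∀ t₀ ∈ Ioo 0 T, ∀ x₀ : EuclideanSpace ℝ (Fin n), ∀ r > 0,
      φ (t₀, x₀) = u t₀ x₀ →
      (∀ t ∈ Ioo 0 T, |t - t₀| < r → ∀ x ∈ Metric.ball x₀ r, φ (t, x) ≤ u t x) →
      0 ≤ obstacleOp s ψ u φ t₀ x₀ r

/-- Continuous viscosity solutions `u : [0, T] × ℝⁿ → ℝ` of the obstacle problem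
`min {uₜ + (-Δ)^s u, u - ψ} = 0`, `u(0) = u₀`. The values of `u` at times outside `[0, T]`
play no role. -/
structure IsObstacleSolution {n : ℕ} (s T : ℝ) (ψ u₀ : EuclideanSpace ℝ (Fin n) → ℝ)
    (u : ℝ → EuclideanSpace ℝ (Fin n) → ℝ) : Prop where
  continuousOn : ContinuousOn (fun p : ℝ × EuclideanSpace ℝ (Fin n) => u p.1 p.2)
    (Icc 0 T ×ˢ univ)
  weightedIntegrable : ∀ t ∈ Icc 0 T, WeightedIntegrable s (u t)
  initial : u 0 = u₀
  subsolution : IsViscositySubsolution s T ψ u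
  supersolution : IsViscositySupersolution s T ψ u

end

/-!
The estimate follows from the comparison principle for the obstacle problem, applied to translates
of the solution and to barriers built from the initial datum.

*Space.* If `L` is a common Lipschitz constant of `u₀` and `ψ`, then `u(t, x + h) + L |h|` is a
supersolution above `ψ` that starts above `u₀`, hence it stays above `u`
(`IsObstacleSolution.lipschitzWith_space`). A Lipschitz function has its `L^∞` gradient bound as a
Lipschitz constant (`LipschitzWith.of_ae_norm_fderiv_le`), which gives the best `L`.

*Time.* Let `K = ‖(-Δ)^s u₀‖`. Since `u₀` is semiconvex, its truncated fractional Laplacians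
converge wherever the upper limit is finite, with a one-sided rate, so a mollification `W` of `u₀`
has `|(-Δ)^s W| ≤ K` everywhere (`eventually_abs_truncFracLap_moll_lt`). The functions
`W ± (L r + K t)`, with `r` the radius of mollification, are then barriers, and
`|u(t) - u₀| ≤ K t` (`IsObstacleSolution.abs_sub_initial_le`). Comparison of `u(t + δ)` with
`u(t) ± K δ` propagates this to all times (`IsObstacleSolution.abs_sub_le_time`).

The comparison principle on the whole space (`IsSub.le_isSuper`, by doubling of variables) needs a
coercive weight `χ` with `(-Δ)^s χ ≥ -C χ` such that the subsolution is at most `α χ + B(α)` for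
every `α > 0`. Here no growth of `u` is assumed beyond weighted integrability at each time, so that
such a weight has to be produced (`IsObstacleSolution.exists_weight`):

* from below, `u ≥ ψ`, and `|ψ|` is dominated by a weight `P`;
* supersolutions above `-P` cannot lose their mass too fast, so the weighted integrals of `u(t)`
  around any point are bounded by those of `u(T)` and `P`, uniformly in `t`. In
  `exists_mass_initial_le` the supersolution is compared with explicit Euler schemes for bounded
  profiles below the datum, which only uses lower bounds, and the scheme is tested against a
  smoothed weight;
* subsolutions above the obstacle are bounded at a point by their weighted integrals around it
  (`IsSub.exists_local_bound`), by a barrier that blows up at the boundary of a unit ball;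
* hence `u(t, x)` is bounded by the convolution of a fixed weighted integrable function `G` with
  `(1 + |x|)^-(n + 2s)`. A weighted integrable function `g` that dominates every multiple of `G` at
  infinity yields the weight, as the mollified convolution of `g`
  (`exists_isWeight_moll_wtConv`, `exists_coercive_weight`).

The viscosity inequalities are used through truncated operators (`IsSub`, `IsSuper`), which are
honest integrals, so that no principal value of a nonsmooth function has to be taken.
-/

noncomputable section

/-! ### The weight and the truncated kernel -/

/-- `ℝⁿ` with its Euclidean norm. -/
abbrev Euc (n : ℕ) : Type := EuclideanSpace ℝ (Fin n)

/-- The weight `(1 + |x|)^-(n + 2s)` of the integrability class of the fractional Laplacian. -/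
def wt {n : ℕ} (s : ℝ) (x : Euc n) : ℝ := ((1 + ‖x‖) ^ ((n : ℝ) + 2 * s))⁻¹

/-- The kernel `|z|^-(n + 2s)` cut off to `|z| > ε`. -/
def tk {n : ℕ} (s ε : ℝ) (z : Euc n) : ℝ :=
  indicator {z : Euc n | ε < ‖z‖} (fun z => (‖z‖ ^ ((n : ℝ) + 2 * s))⁻¹) z

section Basic

variable {n : ℕ} {s : ℝ}

lemma expo_pos (hs : 0 < s) : 0 < (n : ℝ) + 2 * s := by positivity

lemma wt_pos (x : Euc n) : 0 < wt s x := by unfold wt; positivity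

lemma wt_neg (x : Euc n) : wt s (-x) = wt s x := by simp [wt]

lemma continuous_wt : Continuous (wt s : Euc n → ℝ) := by
  unfold wt
  refine Continuous.inv₀ ?_ (fun x => by positivity)
  exact (continuous_const.add continuous_norm).rpow_const
    (fun x => Or.inl (add_pos_of_pos_of_nonneg one_pos (norm_nonneg x)).ne')

lemma wt_le_one (hs : 0 < s) (x : Euc n) : wt s x ≤ 1 := by
  unfold wt
  exact inv_le_one_of_one_le₀ (Real.one_le_rpow (by linarith [norm_nonneg x]) (expo_pos hs).le)

/-- Comparison of the weight at two points whose distances to the origin are comparable. -/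
lemma wt_le_mul_wt (hs : 0 < s) {c : ℝ} (hc : 0 < c) {x y : Euc n}
    (h : 1 + ‖y‖ ≤ c * (1 + ‖x‖)) : wt s x ≤ c ^ ((n : ℝ) + 2 * s) * wt s y := by
  unfold wt
  have h1 : (1 + ‖y‖) ^ ((n : ℝ) + 2 * s)
      ≤ c ^ ((n : ℝ) + 2 * s) * (1 + ‖x‖) ^ ((n : ℝ) + 2 * s) := by
    rw [← Real.mul_rpow hc.le (by positivity)]
    exact Real.rpow_le_rpow (by positivity) h (expo_pos hs).le
  rw [← div_eq_mul_inv, inv_le_comm₀ (by positivity) (by positivity), inv_div,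
    div_le_iff₀ (by positivity)]
  linarith

lemma wt_sub_le (hs : 0 < s) (x y : Euc n) :
    wt s (x - y) ≤ (1 + ‖x‖) ^ ((n : ℝ) + 2 * s) * wt s y := by
  refine wt_le_mul_wt hs (by positivity) ?_
  have : ‖y‖ ≤ ‖x‖ + ‖x - y‖ := by
    calc ‖y‖ = ‖x - (x - y)‖ := by simp
      _ ≤ _ := norm_sub_le _ _
  nlinarith [norm_nonneg x, norm_nonneg (x - y)]

lemma wt_le_of_norm_sub_le (hs : 0 < s) {x y : Euc n} {c : ℝ} (hc : 0 ≤ c) (h : ‖x - y‖ ≤ c) :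
    wt s x ≤ (1 + c) ^ ((n : ℝ) + 2 * s) * wt s y := by
  refine wt_le_mul_wt hs (by positivity) ?_
  have : ‖y‖ ≤ ‖x‖ + ‖x - y‖ := by
    calc ‖y‖ = ‖x - (x - y)‖ := by simp
      _ ≤ _ := norm_sub_le _ _
  nlinarith [norm_nonneg x]

lemma integrable_wt (hs : 0 < s) : Integrable (wt s : Euc n → ℝ) := by
  have := integrable_one_add_norm (E := Euc n) (μ := volume) (r := (n : ℝ) + 2 * s)
    (by simp; exact hs)
  refine this.congr (Eventually.of_forall fun x => ?_)
  simp only [wt]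
  rw [Real.rpow_neg (by positivity)]

lemma weightedIntegrable_iff (f : Euc n → ℝ) :
    WeightedIntegrable s f ↔ Integrable (fun x => f x * wt s x) := by
  simp only [WeightedIntegrable, wt, div_eq_mul_inv]

lemma tk_nonneg (ε : ℝ) (z : Euc n) : 0 ≤ tk s ε z :=
  indicator_nonneg (fun z _ => by positivity) z

lemma tk_neg (ε : ℝ) (z : Euc n) : tk s ε (-z) = tk s ε z := by
  simp [tk, indicator]

lemma tk_of_lt {ε : ℝ} {z : Euc n} (h : ε < ‖z‖) :
    tk s ε z = (‖z‖ ^ ((n : ℝ) + 2 * s))⁻¹ := by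
  simp [tk, indicator, h]

lemma tk_of_le {ε : ℝ} {z : Euc n} (h : ‖z‖ ≤ ε) : tk s ε z = 0 := by
  simp [tk, indicator, h]

lemma measurable_tk (ε : ℝ) : Measurable (tk s ε : Euc n → ℝ) := by
  unfold tk
  refine Measurable.indicator ?_ (measurableSet_lt measurable_const measurable_norm)
  fun_prop

lemma tk_le_wt (hs : 0 < s) {ε : ℝ} (hε : 0 < ε) (z : Euc n) :
    tk s ε z ≤ ((1 + ε) / ε) ^ ((n : ℝ) + 2 * s) * wt s z := by
  by_cases h : ε < ‖z‖
  · rw [tk_of_lt h]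
    unfold wt
    have hz : 0 < ‖z‖ := hε.trans h
    have h1 : (1 + ‖z‖) ^ ((n : ℝ) + 2 * s)
        ≤ ((1 + ε) / ε) ^ ((n : ℝ) + 2 * s) * ‖z‖ ^ ((n : ℝ) + 2 * s) := by
      rw [← Real.mul_rpow (by positivity) (by positivity)]
      refine Real.rpow_le_rpow (by positivity) ?_ (expo_pos hs).le
      rw [div_mul_eq_mul_div, le_div_iff₀ hε]
      nlinarith
    rw [← div_eq_mul_inv, inv_le_comm₀ (by positivity) (by positivity), inv_div,
      div_le_iff₀ (by positivity)]
    linarith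
  · rw [tk_of_le (not_lt.1 h)]
    have := wt_pos (s := s) z
    positivity

lemma integrable_tk (hs : 0 < s) {ε : ℝ} (hε : 0 < ε) : Integrable (tk s ε : Euc n → ℝ) := by
  refine ((integrable_wt hs).const_mul (((1 + ε) / ε) ^ ((n : ℝ) + 2 * s))).mono'
    (measurable_tk ε).aestronglyMeasurable (Eventually.of_forall fun z => ?_)
  rw [Real.norm_of_nonneg (tk_nonneg ε z)]
  exact tk_le_wt hs hε z

lemma tk_anti {ε η : ℝ} (h : ε ≤ η) (z : Euc n) : tk s η z ≤ tk s ε z := by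
  by_cases h1 : η < ‖z‖
  · rw [tk_of_lt h1, tk_of_lt (h.trans_lt h1)]
  · rw [tk_of_le (not_lt.1 h1)]
    exact tk_nonneg _ _

/-! ### Truncated fractional Laplacians -/

lemma truncFracLap_eq (f : Euc n → ℝ) (x : Euc n) (ε : ℝ) :
    truncFracLap s f x ε = ∫ z, (f x - f (x + z)) * tk s ε z := by
  have hm : MeasurableSet (Metric.closedBall x ε)ᶜ := Metric.isClosed_closedBall.measurableSet.compl
  rw [truncFracLap, ← integral_indicator hm,
    ← integral_add_left_eq_self (μ := volume) _ x]
  refine integral_congr_ae (Eventually.of_forall fun z => ?_)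
  by_cases h : ε < ‖z‖
  · simp [indicator, tk_of_lt h, h, div_eq_mul_inv]
  · simp [indicator, tk_of_le (not_lt.1 h), h]

lemma WeightedIntegrable.aestronglyMeasurable {f : Euc n → ℝ}
    (hf : WeightedIntegrable s f) : AEStronglyMeasurable f volume := by
  have h := (weightedIntegrable_iff f).1 hf
  have h2 : AEStronglyMeasurable (fun x : Euc n => (wt s x)⁻¹) volume :=
    (continuous_wt.inv₀ (fun x => (wt_pos x).ne')).aestronglyMeasurable
  refine (h.aestronglyMeasurable.mul h2).congr (Eventually.of_forall fun x => ?_)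
  have := (wt_pos (s := s) x).ne'
  simp [this]

lemma WeightedIntegrable.mono {f g : Euc n → ℝ} (hf : WeightedIntegrable s f)
    (hg : AEStronglyMeasurable g volume) (h : ∀ x, |g x| ≤ |f x|) : WeightedIntegrable s g := by
  rw [weightedIntegrable_iff] at hf ⊢
  refine hf.mono (hg.mul continuous_wt.aestronglyMeasurable) (Eventually.of_forall fun x => ?_)
  simp only [norm_mul, Real.norm_eq_abs]
  exact mul_le_mul_of_nonneg_right (h x) (abs_nonneg _)

lemma WeightedIntegrable.abs {f : Euc n → ℝ} (hf : WeightedIntegrable s f) :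
    WeightedIntegrable s (fun x => |f x|) :=
  hf.mono hf.aestronglyMeasurable.norm (fun x => by simp)

lemma WeightedIntegrable.add {f g : Euc n → ℝ} (hf : WeightedIntegrable s f)
    (hg : WeightedIntegrable s g) : WeightedIntegrable s (fun x => f x + g x) := by
  rw [weightedIntegrable_iff] at *
  simp only [add_mul]
  exact Integrable.add hf hg

lemma WeightedIntegrable.const_mul {f : Euc n → ℝ} (hf : WeightedIntegrable s f) (c : ℝ) :
    WeightedIntegrable s (fun x => c * f x) := by
  rw [weightedIntegrable_iff] at *
  simpa [mul_assoc] using Integrable.const_mul hf c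

lemma WeightedIntegrable.neg {f : Euc n → ℝ} (hf : WeightedIntegrable s f) :
    WeightedIntegrable s (fun x => - f x) := by
  simpa using hf.const_mul (-1)

lemma WeightedIntegrable.sub {f g : Euc n → ℝ} (hf : WeightedIntegrable s f)
    (hg : WeightedIntegrable s g) : WeightedIntegrable s (fun x => f x - g x) := by
  simpa [sub_eq_add_neg] using hf.add hg.neg

lemma weightedIntegrable_of_bound (hs : 0 < s) {f : Euc n → ℝ}
    (hf : AEStronglyMeasurable f volume) {B : ℝ} (h : ∀ x, |f x| ≤ B) :
    WeightedIntegrable s f := by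
  have : WeightedIntegrable s (fun _ : Euc n => B) := by
    rw [weightedIntegrable_iff]
    exact (integrable_wt hs).const_mul B
  exact this.mono hf (fun x => (h x).trans (le_abs_self B))

lemma weightedIntegrable_const (hs : 0 < s) (c : ℝ) :
    WeightedIntegrable s (fun _ : Euc n => c) :=
  weightedIntegrable_of_bound hs aestronglyMeasurable_const (fun _ => le_refl |c|)

lemma WeightedIntegrable.integrable_mul_wt_sub (hs : 0 < s) {f : Euc n → ℝ}
    (hf : WeightedIntegrable s f) (x : Euc n) : Integrable (fun y => f y * wt s (x - y)) := by
  have hm := hf.aestronglyMeasurable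
  rw [weightedIntegrable_iff] at hf
  refine (hf.norm.const_mul ((1 + ‖x‖) ^ ((n : ℝ) + 2 * s))).mono'
    (hm.mul (continuous_wt.comp (continuous_const.sub continuous_id)).aestronglyMeasurable)
    (Eventually.of_forall fun y => ?_)
  rw [norm_mul, norm_mul, Real.norm_of_nonneg (wt_pos y).le, Real.norm_of_nonneg (wt_pos _).le]
  have := mul_le_mul_of_nonneg_left (wt_sub_le hs x y) (norm_nonneg (f y))
  linarith

lemma WeightedIntegrable.comp_add (hs : 0 < s) {f : Euc n → ℝ}
    (hf : WeightedIntegrable s f) (x : Euc n) : WeightedIntegrable s (fun z => f (x + z)) := by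
  rw [weightedIntegrable_iff]
  have := (hf.integrable_mul_wt_sub hs x).comp_add_left x
  refine this.congr (Eventually.of_forall fun z => ?_)
  simp [wt_neg]

lemma WeightedIntegrable.integrable_mul_tk (hs : 0 < s) {f : Euc n → ℝ}
    (hf : WeightedIntegrable s f) {ε : ℝ} (hε : 0 < ε) :
    Integrable (fun z => f z * tk s ε z) := by
  have hm := hf.aestronglyMeasurable
  rw [weightedIntegrable_iff] at hf
  refine (hf.norm.const_mul (((1 + ε) / ε) ^ ((n : ℝ) + 2 * s))).mono'
    (hm.mul (measurable_tk ε).aestronglyMeasurable) (Eventually.of_forall fun z => ?_)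
  rw [norm_mul, norm_mul, Real.norm_of_nonneg (wt_pos z).le, Real.norm_of_nonneg (tk_nonneg _ _)]
  have := mul_le_mul_of_nonneg_left (tk_le_wt hs hε z) (norm_nonneg (f z))
  linarith

lemma WeightedIntegrable.integrable_trunc (hs : 0 < s) {f : Euc n → ℝ}
    (hf : WeightedIntegrable s f) (x : Euc n) {ε : ℝ} (hε : 0 < ε) :
    Integrable (fun z => (f x - f (x + z)) * tk s ε z) :=
  ((weightedIntegrable_const hs (f x)).sub (hf.comp_add hs x)).integrable_mul_tk hs hε

lemma truncFracLap_mono (hs : 0 < s) {f g : Euc n → ℝ}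
    (hf : WeightedIntegrable s f) (hg : WeightedIntegrable s g) {x : Euc n} (hx : f x = g x)
    (h : ∀ y, g y ≤ f y) {ε : ℝ} (hε : 0 < ε) : truncFracLap s f x ε ≤ truncFracLap s g x ε := by
  rw [truncFracLap_eq, truncFracLap_eq]
  refine integral_mono (hf.integrable_trunc hs x hε) (hg.integrable_trunc hs x hε) fun z => ?_
  exact mul_le_mul_of_nonneg_right (by linarith [h (x + z)]) (tk_nonneg _ _)

lemma truncFracLap_add (hs : 0 < s) {f g : Euc n → ℝ}
    (hf : WeightedIntegrable s f) (hg : WeightedIntegrable s g) (x : Euc n)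
    {ε : ℝ} (hε : 0 < ε) : truncFracLap s (fun y => f y + g y) x ε
      = truncFracLap s f x ε + truncFracLap s g x ε := by
  rw [truncFracLap_eq, truncFracLap_eq, truncFracLap_eq,
    ← integral_add (hf.integrable_trunc hs x hε) (hg.integrable_trunc hs x hε)]
  congr 1; ext z; ring

lemma truncFracLap_const_mul (f : Euc n → ℝ) (c : ℝ) (x : Euc n) (ε : ℝ) :
    truncFracLap s (fun y => c * f y) x ε = c * truncFracLap s f x ε := by
  rw [truncFracLap_eq, truncFracLap_eq, ← integral_const_mul]
  congr 1; ext z; ring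

lemma truncFracLap_add_const (f : Euc n → ℝ) (c : ℝ) (x : Euc n) (ε : ℝ) :
    truncFracLap s (fun y => f y + c) x ε = truncFracLap s f x ε := by
  rw [truncFracLap_eq, truncFracLap_eq]
  congr 1; ext z; ring

lemma truncFracLap_comp_add (f : Euc n → ℝ) (h x : Euc n) (ε : ℝ) :
    truncFracLap s (fun y => f (y + h)) x ε = truncFracLap s f (x + h) ε := by
  rw [truncFracLap_eq, truncFracLap_eq]
  congr 1; ext z; rw [add_right_comm]

/-- The function `|z|² |z|^-(n + 2s)`, which is integrable near the origin. -/
def sqKer {n : ℕ} (s : ℝ) (z : Euc n) : ℝ := ‖z‖ ^ 2 * (‖z‖ ^ ((n : ℝ) + 2 * s))⁻¹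

/-- The integral of `|z|^(2 - n - 2s)` over the ball of radius `r`. -/
def sqMass (n : ℕ) (s r : ℝ) : ℝ := ∫ z in Metric.closedBall (0 : Euc n) r, sqKer s z

lemma sqKer_nonneg (z : Euc n) : 0 ≤ sqKer s z := by unfold sqKer; positivity

lemma integrableOn_sqKer (hn : 0 < n) (hs : s ∈ Ioo (0 : ℝ) 1) (r : ℝ) :
    IntegrableOn (sqKer s : Euc n → ℝ) (Metric.closedBall 0 r) := by
  refine IntegrableOn.mono_set (t := Metric.ball 0 (r + 1)) ?_
    (Metric.closedBall_subset_ball (by linarith))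
  have : Nonempty (Fin n) := ⟨⟨0, hn⟩⟩
  have := (integrableOn_fun_norm_addHaar (E := Euc n) volume
    (f := fun t : ℝ => t ^ 2 * (t ^ ((n : ℝ) + 2 * s))⁻¹) (r := r + 1)).2 ?_
  · exact this
  · have h1 : IntegrableOn (fun t : ℝ => t ^ (1 - 2 * s)) (Ioo 0 (r + 1)) := by
      by_cases hr : 0 ≤ r + 1
      · have := (intervalIntegral.intervalIntegrable_rpow' (a := 0) (b := r + 1)
          (r := 1 - 2 * s) (by linarith [hs.2]))
        rw [intervalIntegrable_iff_integrableOn_Ioo_of_le hr] at this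
        exact this
      · rw [Ioo_eq_empty (by linarith)]; exact integrableOn_empty
    refine h1.congr_fun (fun t ht => ?_) measurableSet_Ioo
    have ht : 0 < t := ht.1
    simp only [finrank_euclideanSpace, Fintype.card_fin, smul_eq_mul]
    rw [← Real.rpow_neg ht.le, ← Real.rpow_natCast t (n - 1), ← Real.rpow_natCast t 2,
      ← Real.rpow_add ht, ← Real.rpow_add ht]
    congr 1
    rw [Nat.cast_sub (by omega)]
    push_cast; ring

lemma sqMass_nonneg (r : ℝ) : 0 ≤ sqMass n s r :=
  setIntegral_nonneg Metric.isClosed_closedBall.measurableSet (fun z _ => sqKer_nonneg z)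

lemma sqMass_mul (r : ℝ) (hr : 0 < r) :
    sqMass n s r = r ^ (2 - 2 * s) * sqMass n s 1 := by
  have h := Measure.setIntegral_comp_smul_of_pos volume (sqKer s : Euc n → ℝ)
    (Metric.closedBall (0 : Euc n) 1) hr
  rw [smul_unitClosedBall, Real.norm_of_nonneg hr.le] at h
  have h2 : ∀ z : Euc n, sqKer s (r • z) = r ^ (2 - ((n : ℝ) + 2 * s)) * sqKer s z := by
    intro z
    simp only [sqKer, norm_smul, Real.norm_of_nonneg hr.le]
    rw [Real.mul_rpow hr.le (norm_nonneg z), Real.rpow_sub hr, Real.rpow_two, mul_inv]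
    ring
  simp only [h2, integral_const_mul, finrank_euclideanSpace, Fintype.card_fin, smul_eq_mul] at h
  unfold sqMass
  have hn : (r ^ n : ℝ) ≠ 0 := by positivity
  have h3 : r ^ (2 - 2 * s) = r ^ n * r ^ (2 - ((n : ℝ) + 2 * s)) := by
    rw [← Real.rpow_natCast r n, ← Real.rpow_add hr]; congr 1; ring
  rw [h3, mul_assoc, h, ← mul_assoc, mul_inv_cancel₀ hn, one_mul]

lemma tendsto_sqMass (hs : s ∈ Ioo (0 : ℝ) 1) :
    Tendsto (sqMass n s) (𝓝[>] 0) (𝓝 0) := by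
  have h : Tendsto (fun r : ℝ => r ^ (2 - 2 * s) * sqMass n s 1) (𝓝[>] 0) (𝓝 0) := by
    have h0 : 0 < 2 - 2 * s := by linarith [hs.2]
    have := ((Real.continuousAt_rpow_const 0 (2 - 2 * s) (Or.inr h0.le)).tendsto.mul_const
      (sqMass n s 1))
    rw [Real.zero_rpow h0.ne', zero_mul] at this
    exact this.mono_left nhdsWithin_le_nhds
  refine h.congr' ?_
  filter_upwards [self_mem_nhdsWithin] with r hr
  rw [sqMass_mul r hr]

/-- An odd function has integral zero. -/
lemma integral_eq_zero_of_odd {f : Euc n → ℝ} (h : ∀ z, f (-z) = - f z) : ∫ z, f z = 0 := by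
  have h1 : ∫ z, f z = ∫ z, f (-z) := (integral_neg_eq_self f volume).symm
  simp only [h, integral_neg] at h1
  linarith

/-- If the second differences of `f` at `x` are at most `D |z|²` for `|z| ≤ η`, then shrinking the
truncation radius from `η` lowers the truncated fractional Laplacian by at most
`D / 2 * sqMass n s η`. The first order part of `f` cancels since the kernel is even. -/
lemma truncFracLap_ge_of_secondDiff_le (hn : 0 < n) (hs : s ∈ Ioo (0 : ℝ) 1) {f : Euc n → ℝ}
    (hf : WeightedIntegrable s f) {x : Euc n} {η D ε : ℝ} (hε : 0 < ε) (hεη : ε ≤ η) (hD : 0 ≤ D)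
    (h : ∀ z, ‖z‖ ≤ η → f (x + z) + f (x - z) - 2 * f x ≤ D * ‖z‖ ^ 2) :
    truncFracLap s f x η - D / 2 * sqMass n s η ≤ truncFracLap s f x ε := by
  have hη : 0 < η := hε.trans_le hεη
  have i1 := hf.integrable_trunc hs.1 x hε
  have i2 := hf.integrable_trunc hs.1 x hη
  set F : Euc n → ℝ := fun z => (f x - f (x + z)) * (tk s ε z - tk s η z) with hF
  have iF : Integrable F := by
    refine (i1.sub i2).congr (Eventually.of_forall fun z => ?_)
    simp only [hF, Pi.sub_apply]; ring
  have e1 : truncFracLap s f x ε - truncFracLap s f x η = ∫ z, F z := by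
    rw [truncFracLap_eq, truncFracLap_eq, ← integral_sub i1 i2]
    congr 1; ext z; simp only [hF]; ring
  have e2 : ∫ z, F z = ∫ z, F (-z) := (integral_neg_eq_self F volume).symm
  have iB : Integrable (fun z => (-D) * indicator (Metric.closedBall (0 : Euc n) η) (sqKer s) z) :=
    ((integrable_indicator_iff Metric.isClosed_closedBall.measurableSet).2
      (integrableOn_sqKer hn hs η)).const_mul _
  have key : ∫ z, (-D) * indicator (Metric.closedBall (0 : Euc n) η) (sqKer s) z
      ≤ ∫ z, (F z + F (-z)) := by
    refine integral_mono iB (iF.add iF.comp_neg) fun z => ?_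
    simp only [hF, tk_neg]
    by_cases hz : ‖z‖ ≤ η
    · have hz' : z ∈ Metric.closedBall (0 : Euc n) η := by simpa using hz
      rw [indicator_of_mem hz', tk_of_le hz]
      have h1 := h z hz
      by_cases hz2 : ε < ‖z‖
      · rw [tk_of_lt hz2]
        have h2 : (0 : ℝ) ≤ (‖z‖ ^ ((n : ℝ) + 2 * s))⁻¹ := by positivity
        have h3 := mul_le_mul_of_nonneg_right h1 h2
        simp only [sqKer, ← sub_eq_add_neg]
        linarith
      · rw [tk_of_le (not_lt.1 hz2)]
        have := mul_nonneg hD (sqKer_nonneg (s := s) z)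
        simp only [sub_zero, mul_zero, add_zero]
        linarith
    · have hz' : z ∉ Metric.closedBall (0 : Euc n) η := by simpa using hz
      rw [indicator_of_notMem hz', tk_of_lt (not_le.1 hz), tk_of_lt (hεη.trans_lt (not_le.1 hz))]
      simp
  rw [integral_add iF iF.comp_neg, ← e2, integral_const_mul,
    integral_indicator Metric.isClosed_closedBall.measurableSet, ← e1] at key
  unfold sqMass
  linarith

lemma truncFracLap_le_of_le_secondDiff (hn : 0 < n) (hs : s ∈ Ioo (0 : ℝ) 1) {f : Euc n → ℝ}
    (hf : WeightedIntegrable s f) {x : Euc n} {η D ε : ℝ} (hε : 0 < ε) (hεη : ε ≤ η) (hD : 0 ≤ D)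
    (h : ∀ z, ‖z‖ ≤ η → -(D * ‖z‖ ^ 2) ≤ f (x + z) + f (x - z) - 2 * f x) :
    truncFracLap s f x ε ≤ truncFracLap s f x η + D / 2 * sqMass n s η := by
  have h1 := truncFracLap_ge_of_secondDiff_le hn hs (hf.const_mul (-1)) hε hεη hD (x := x)
    (fun z hz => by linarith [h z hz])
  rw [truncFracLap_const_mul, truncFracLap_const_mul] at h1
  linarith

end Basic

/-! ### Viscosity inequalities in terms of truncated operators -/

/-- Viscosity subsolutions of `uₜ + (-Δ)^s u ≤ 0` where `u > ψ`, with the fractional Laplacian of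
the test function replaced by its truncations at small radii. The test cylinders lie in
`(0, T) × ℝⁿ`. -/
def IsSub {n : ℕ} (s T : ℝ) (ψ : Euc n → ℝ) (u : ℝ → Euc n → ℝ) : Prop :=
  ∀ φ : ℝ × Euc n → ℝ, ContDiff ℝ 2 φ → ∀ (t₀ : ℝ) (x₀ : Euc n) (r : ℝ), 0 < r → r ≤ t₀ →
    t₀ + r ≤ T → φ (t₀, x₀) = u t₀ x₀ →
    (∀ t, |t - t₀| < r → ∀ x ∈ Metric.ball x₀ r, u t x ≤ φ (t, x)) → ψ x₀ < u t₀ x₀ →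
    ∀ a > 0, ∀ᶠ ε in 𝓝[>] (0 : ℝ), deriv (fun t => φ (t, x₀)) t₀
      + truncFracLap s (glue x₀ r (fun y => φ (t₀, y)) (u t₀)) x₀ ε < a

/-- Viscosity supersolutions of `uₜ + (-Δ)^s u = 0`, in terms of truncated operators. Only
`limsup` is controlled, hence the quantifier `∃ᶠ`. -/
def IsSuper {n : ℕ} (s T : ℝ) (u : ℝ → Euc n → ℝ) : Prop :=
  ∀ φ : ℝ × Euc n → ℝ, ContDiff ℝ 2 φ → ∀ (t₀ : ℝ) (x₀ : Euc n) (r : ℝ), 0 < r → r ≤ t₀ →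
    t₀ + r ≤ T → φ (t₀, x₀) = u t₀ x₀ →
    (∀ t, |t - t₀| < r → ∀ x ∈ Metric.ball x₀ r, φ (t, x) ≤ u t x) →
    ∀ a > 0, ∃ᶠ ε in 𝓝[>] (0 : ℝ), -a < deriv (fun t => φ (t, x₀)) t₀
      + truncFracLap s (glue x₀ r (fun y => φ (t₀, y)) (u t₀)) x₀ ε

section Viscosity

variable {n : ℕ} {s T : ℝ} {ψ : Euc n → ℝ} {u v : ℝ → Euc n → ℝ}

lemma IsViscositySubsolution.isSub (h : IsViscositySubsolution s T ψ u) : IsSub s T ψ u := by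
  intro φ hφ t₀ x₀ r hr hr1 hr2 he ht hψ a ha
  rcases lt_or_ge 0 t₀ with ht0 | ht0
  swap
  · linarith
  have h1 := h φ hφ t₀ ⟨ht0, by linarith⟩ x₀ r hr he (fun t _ h2 => ht t h2)
  rw [obstacleOp, min_le_iff] at h1
  rcases h1 with h1 | h1
  · have h2 : fracLap s (glue x₀ r (fun y => φ (t₀, y)) (u t₀)) x₀
        < ((a - deriv (fun t => φ (t, x₀)) t₀ : ℝ) : EReal) := by
      generalize fracLap s (glue x₀ r (fun y => φ (t₀, y)) (u t₀)) x₀ = X at h1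
      induction X with
      | bot => exact EReal.bot_lt_coe _
      | top => simp at h1
      | coe X =>
        norm_cast at h1 ⊢
        linarith
    filter_upwards [eventually_lt_of_limsup_lt h2] with ε h3
    norm_cast at h3
    linarith
  · norm_cast at h1
    linarith

lemma IsViscositySupersolution.isSuper (h : IsViscositySupersolution s T ψ u) :
    IsSuper s T u := by
  intro φ hφ t₀ x₀ r hr hr1 hr2 he ht a ha
  have h1 := h φ hφ t₀ ⟨by linarith, by linarith⟩ x₀ r hr he (fun t _ h2 => ht t h2)
  rw [obstacleOp, le_min_iff] at h1
  have h1 := h1.1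
  have h2 : ((-a - deriv (fun t => φ (t, x₀)) t₀ : ℝ) : EReal)
      < fracLap s (glue x₀ r (fun y => φ (t₀, y)) (u t₀)) x₀ := by
    generalize fracLap s (glue x₀ r (fun y => φ (t₀, y)) (u t₀)) x₀ = X at h1
    induction X with
    | bot => simp at h1
    | top => exact EReal.coe_lt_top _
    | coe X =>
      norm_cast at h1 ⊢
      linarith
  refine (frequently_lt_of_lt_limsup (by isBoundedDefault) h2).mono fun ε h3 => ?_
  norm_cast at h3
  linarith

lemma IsSub.mono_time {T' : ℝ} (h : IsSub s T ψ u) (hT : T' ≤ T) : IsSub s T' ψ u :=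
  fun φ hφ t₀ x₀ r hr hr1 hr2 => h φ hφ t₀ x₀ r hr hr1 (hr2.trans hT)

lemma IsSuper.mono_time {T' : ℝ} (h : IsSuper s T u) (hT : T' ≤ T) : IsSuper s T' u :=
  fun φ hφ t₀ x₀ r hr hr1 hr2 => h φ hφ t₀ x₀ r hr hr1 (hr2.trans hT)

lemma glue_comp_add (x₀ h : Euc n) (r : ℝ) (g f : Euc n → ℝ) (y : Euc n) :
    glue x₀ r (fun y => g (y + h)) (fun y => f (y + h)) y = glue (x₀ + h) r g f (y + h) := by
  simp [glue, Metric.mem_ball, dist_add_right]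

/-- Space-time translates of supersolutions, shifted by constants, are supersolutions. -/
lemma IsSuper.shift (hu : IsSuper s T u) {δ : ℝ} (hδ : 0 ≤ δ) (h : Euc n) (c : ℝ) :
    IsSuper s (T - δ) (fun t x => u (t + δ) (x + h) + c) := by
  intro φ hφ t₀ x₀ r hr hr1 hr2 he ht a ha
  have := hu (fun p => φ (p.1 - δ, p.2 - h) - c) (by fun_prop) (t₀ + δ) (x₀ + h) r hr
    (by linarith) (by linarith) (by simp [he]) (fun t h1 x hx => by
      have := ht (t - δ) (by rwa [sub_sub, add_comm δ]) (x - h)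
        (by simpa [Metric.mem_ball, dist_eq_norm, sub_sub, add_comm] using hx)
      simp only [sub_add_cancel] at this
      linarith) a ha
  refine this.mono fun ε h1 => ?_
  have e1 : deriv (fun t => φ (t - δ, x₀ + h - h) - c) (t₀ + δ)
      = deriv (fun t => φ (t, x₀)) t₀ := by
    simp only [add_sub_cancel_right, deriv_sub_const_fun]
    rw [deriv_comp_sub_const (f := fun t => φ (t, x₀)), add_sub_cancel_right]
  rw [e1] at h1
  simp only [add_sub_cancel_right] at h1
  convert h1 using 2
  rw [← truncFracLap_comp_add, ← truncFracLap_add_const _ (-c)]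
  congr 1; ext y
  rw [← glue_comp_add]
  simp only [glue]
  split_ifs <;> simp [sub_eq_add_neg]

/-- Time translates of subsolutions are subsolutions. -/
lemma IsSub.shift (hu : IsSub s T ψ u) {δ : ℝ} (hδ : 0 ≤ δ) :
    IsSub s (T - δ) ψ (fun t x => u (t + δ) x) := by
  intro φ hφ t₀ x₀ r hr hr1 hr2 he ht hψ a ha
  have := hu (fun p => φ (p.1 - δ, p.2)) (by fun_prop) (t₀ + δ) x₀ r hr
    (by linarith) (by linarith) (by simp [he]) (fun t h1 x hx => by
      have := ht (t - δ) (by rwa [sub_sub, add_comm δ]) x hx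
      simpa only [sub_add_cancel] using this) hψ a ha
  have e1 : deriv (fun t => φ (t - δ, x₀)) (t₀ + δ) = deriv (fun t => φ (t, x₀)) t₀ := by
    rw [deriv_comp_sub_const (f := fun t => φ (t, x₀)), add_sub_cancel_right]
  rw [e1] at this
  simpa only [add_sub_cancel_right] using this

open Classical in
lemma aestronglyMeasurable_glue {x₀ : Euc n} {r : ℝ} {g f : Euc n → ℝ} (hg : Continuous g)
    (hf : AEStronglyMeasurable f volume) : AEStronglyMeasurable (glue x₀ r g f) volume := by
  have : glue x₀ r g f = (Metric.ball x₀ r).piecewise g f := by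
    ext y; simp [glue, Set.piecewise]
  rw [this]
  exact AEStronglyMeasurable.piecewise Metric.isOpen_ball.measurableSet
    hg.aestronglyMeasurable.restrict hf.restrict

lemma weightedIntegrable_glue (hs : 0 < s) {x₀ : Euc n} {r : ℝ} {g f : Euc n → ℝ}
    (hg : Continuous g) (hf : WeightedIntegrable s f) : WeightedIntegrable s (glue x₀ r g f) := by
  obtain ⟨B, hB⟩ := (isCompact_closedBall x₀ r).exists_bound_of_continuousOn hg.continuousOn
  refine WeightedIntegrable.mono (f := fun y => |B| + |f y|)
    ((weightedIntegrable_const hs |B|).add hf.abs)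
    (aestronglyMeasurable_glue hg hf.aestronglyMeasurable) fun y => ?_
  rw [abs_of_nonneg (by positivity : 0 ≤ |B| + |f y|)]
  unfold glue
  split_ifs with h
  · have := hB y (Metric.ball_subset_closedBall h)
    rw [Real.norm_eq_abs] at this
    linarith [le_abs_self B, abs_nonneg (f y)]
  · linarith [abs_nonneg B]

lemma glue_self {x₀ : Euc n} {r : ℝ} (hr : 0 < r) (g f : Euc n → ℝ) :
    glue x₀ r g f x₀ = g x₀ := by
  simp [glue, hr]

lemma glue_of_lt {x₀ z : Euc n} {r : ℝ} (h : ‖z‖ < r) (g f : Euc n → ℝ) :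
    glue x₀ r g f (x₀ + z) = g (x₀ + z) := by
  simp [glue, h]

lemma glue_of_le {x₀ z : Euc n} {r : ℝ} (h : r ≤ ‖z‖) (g f : Euc n → ℝ) :
    glue x₀ r g f (x₀ + z) = f (x₀ + z) := by
  simp [glue, h.not_gt]

/-- Functions differentiable in time that satisfy the truncated inequalities pointwise are
subsolutions; no regularity in space is needed. -/
lemma isSub_of_forall (hs : 0 < s) (hW : ∀ t ∈ Ioo 0 T, WeightedIntegrable s (u t))
    (hd : ∀ t ∈ Ioo 0 T, ∀ x, DifferentiableAt ℝ (fun t => u t x) t)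
    (h : ∀ t ∈ Ioo 0 T, ∀ x, ∀ a > 0, ∀ᶠ ε in 𝓝[>] (0 : ℝ),
      deriv (fun t => u t x) t + truncFracLap s (u t) x ε < a) : IsSub s T ψ u := by
  intro φ hφ t₀ x₀ r hr hr1 hr2 he ht _ a ha
  have ht0 : t₀ ∈ Ioo 0 T := ⟨by linarith, by linarith⟩
  have hφd : DifferentiableAt ℝ (fun t => φ (t, x₀)) t₀ := by
    have : ContDiff ℝ 2 (fun t => φ (t, x₀)) := by fun_prop
    exact (this.differentiable (by norm_num)) t₀
  have hmin : IsLocalMin (fun t => φ (t, x₀) - u t x₀) t₀ := by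
    filter_upwards [Metric.ball_mem_nhds t₀ hr] with t h1
    have := ht t (by simpa [Real.dist_eq] using h1) x₀ (Metric.mem_ball_self hr)
    simp only [he]; linarith
  have hder : deriv (fun t => φ (t, x₀)) t₀ = deriv (fun t => u t x₀) t₀ := by
    have h1 := hmin.deriv_eq_zero
    rw [deriv_fun_sub hφd (hd t₀ ht0 x₀)] at h1
    linarith
  filter_upwards [h t₀ ht0 x₀ a ha, self_mem_nhdsWithin] with ε h1 hε
  rw [hder]
  have hc : Continuous (fun y => φ (t₀, y)) := by fun_prop
  refine lt_of_le_of_lt ?_ h1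
  gcongr
  refine truncFracLap_mono hs (weightedIntegrable_glue hs hc (hW t₀ ht0)) (hW t₀ ht0) ?_ ?_ hε
  · rw [glue_self hr, he]
  · intro y
    unfold glue
    split_ifs with hy
    · exact ht t₀ (by simpa using hr) y hy
    · exact le_rfl

lemma isSuper_of_forall (hs : 0 < s) (hW : ∀ t ∈ Ioo 0 T, WeightedIntegrable s (u t))
    (hd : ∀ t ∈ Ioo 0 T, ∀ x, DifferentiableAt ℝ (fun t => u t x) t)
    (h : ∀ t ∈ Ioo 0 T, ∀ x, ∀ a > 0, ∀ᶠ ε in 𝓝[>] (0 : ℝ),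
      -a < deriv (fun t => u t x) t + truncFracLap s (u t) x ε) : IsSuper s T u := by
  intro φ hφ t₀ x₀ r hr hr1 hr2 he ht a ha
  have ht0 : t₀ ∈ Ioo 0 T := ⟨by linarith, by linarith⟩
  have hφd : DifferentiableAt ℝ (fun t => φ (t, x₀)) t₀ := by
    have : ContDiff ℝ 2 (fun t => φ (t, x₀)) := by fun_prop
    exact (this.differentiable (by norm_num)) t₀
  have hmax : IsLocalMax (fun t => φ (t, x₀) - u t x₀) t₀ := by
    filter_upwards [Metric.ball_mem_nhds t₀ hr] with t h1
    have := ht t (by simpa [Real.dist_eq] using h1) x₀ (Metric.mem_ball_self hr)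
    simp only [he]; linarith
  have hder : deriv (fun t => φ (t, x₀)) t₀ = deriv (fun t => u t x₀) t₀ := by
    have h1 := hmax.deriv_eq_zero
    rw [deriv_fun_sub hφd (hd t₀ ht0 x₀)] at h1
    linarith
  refine Eventually.frequently ?_
  filter_upwards [h t₀ ht0 x₀ a ha, self_mem_nhdsWithin] with ε h1 hε
  rw [hder]
  have hc : Continuous (fun y => φ (t₀, y)) := by fun_prop
  refine lt_of_lt_of_le h1 ?_
  gcongr
  refine truncFracLap_mono hs (hW t₀ ht0) (weightedIntegrable_glue hs hc (hW t₀ ht0)) ?_ ?_ hε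
  · rw [glue_self hr, he]
  · intro y
    unfold glue
    split_ifs with hy
    · exact ht t₀ (by simpa using hr) y hy
    · exact le_rfl

end Viscosity

/-! ### The comparison principle -/

/-- A nonnegative `C²` weight `χ` whose truncated fractional Laplacians are at least `-C χ`, so that
`exp (C t) * χ` is a supersolution. -/
structure IsWeight {n : ℕ} (s C : ℝ) (χ : Euc n → ℝ) : Prop where
  contDiff : ContDiff ℝ 2 χ
  nonneg : ∀ x, 0 ≤ χ x
  weightedIntegrable : WeightedIntegrable s χ
  trunc : ∀ x, ∀ ε ∈ Ioc (0 : ℝ) 1, -(C * χ x) ≤ truncFracLap s χ x ε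

section Comparison

variable {n : ℕ} {s T : ℝ} {ψ : Euc n → ℝ} {u v : ℝ → Euc n → ℝ}

/-- After doubling the variables, a maximum of the penalized difference of a subsolution and a
supersolution cannot be attained at interior times above the obstacle: the truncated operators at
the two points are compared increment by increment with the same shift `z`. -/
lemma no_interior_doubled_max (hn : 0 < n) (hs : s ∈ Ioo (0 : ℝ) 1) {C : ℝ} {χ : Euc n → ℝ}
    (hχ : IsWeight s C χ)
    (hui : ∀ t ∈ Ioo 0 T, WeightedIntegrable s (u t))
    (hvi : ∀ t ∈ Ioo 0 T, WeightedIntegrable s (v t))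
    (hu : IsSub s T ψ u) (hv : IsSuper s T v)
    {h : ℝ → ℝ} (hh : ContDiff ℝ 2 h) (hh' : ∀ t, 0 < deriv h t) {α k T₁ : ℝ} (hα : 0 ≤ α)
    (hk : 0 ≤ k) (hT₁ : T₁ ≤ T) {t₀ τ₀ : ℝ} {x₀ y₀ : Euc n} (ht₀ : t₀ ∈ Ioo 0 T₁)
    (hτ₀ : τ₀ ∈ Ioo 0 T₁)
    (hmax : ∀ t ∈ Icc 0 T₁, ∀ τ ∈ Icc 0 T₁, ∀ x y,
      u t x - v τ y - k * ((t - τ) ^ 2 + ‖x - y‖ ^ 2)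
        - (α * Real.exp (C * t) * χ x + h t) - (α * Real.exp (C * τ) * χ y + h τ)
      ≤ u t₀ x₀ - v τ₀ y₀ - k * ((t₀ - τ₀) ^ 2 + ‖x₀ - y₀‖ ^ 2)
        - (α * Real.exp (C * t₀) * χ x₀ + h t₀) - (α * Real.exp (C * τ₀) * χ y₀ + h τ₀))
    (hψ : ψ x₀ < u t₀ x₀) : False := by
  have hχc := hχ.contDiff
  set m : ℝ := deriv h t₀ + deriv h τ₀ with hm
  have hm0 : 0 < m := add_pos (hh' _) (hh' _)
  -- a radius on which the quadratic penalization contributes less than `m / 4`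
  have hsm : ∀ᶠ r in 𝓝[>] (0 : ℝ), 2 * k * sqMass n s r < m / 4 := by
    have := (tendsto_sqMass (n := n) hs).const_mul (2 * k)
    rw [mul_zero] at this
    exact this.eventually_lt_const (by linarith)
  have hr0 : ∀ᶠ r in 𝓝[>] (0 : ℝ), r < min (min t₀ (T₁ - t₀)) (min τ₀ (T₁ - τ₀)) :=
    (eventually_lt_nhds (by simp [ht₀.1, ht₀.2, hτ₀.1, hτ₀.2])).filter_mono nhdsWithin_le_nhds
  obtain ⟨r, ⟨hr1, hr2⟩, hr⟩ := ((hsm.and hr0).and self_mem_nhdsWithin).exists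
  replace hr : 0 < r := hr
  simp only [lt_min_iff] at hr2
  obtain ⟨⟨hr3, hr4⟩, hr5, hr6⟩ := hr2
  set φ : ℝ × Euc n → ℝ := fun p => u t₀ x₀ + (k * ((p.1 - τ₀) ^ 2 + ‖p.2 - y₀‖ ^ 2)
      - k * ((t₀ - τ₀) ^ 2 + ‖x₀ - y₀‖ ^ 2)) + ((α * Real.exp (C * p.1) * χ p.2 + h p.1)
      - (α * Real.exp (C * t₀) * χ x₀ + h t₀)) with hφ
  set θ : ℝ × Euc n → ℝ := fun p => v τ₀ y₀ - (k * ((t₀ - p.1) ^ 2 + ‖x₀ - p.2‖ ^ 2)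
      - k * ((t₀ - τ₀) ^ 2 + ‖x₀ - y₀‖ ^ 2)) - ((α * Real.exp (C * p.1) * χ p.2 + h p.1)
      - (α * Real.exp (C * τ₀) * χ y₀ + h τ₀)) with hθ
  have cφ : ContDiff ℝ 2 φ := by
    have h1 : ContDiff ℝ 2 (fun p : ℝ × Euc n => ‖p.2 - y₀‖ ^ 2) :=
      (contDiff_snd.sub contDiff_const).norm_sq ℝ
    have h2 : ContDiff ℝ 2 (fun p : ℝ × Euc n => Real.exp (C * p.1)) := by fun_prop
    simp only [hφ]; fun_prop
  have cθ : ContDiff ℝ 2 θ := by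
    have h1 : ContDiff ℝ 2 (fun p : ℝ × Euc n => ‖x₀ - p.2‖ ^ 2) :=
      (contDiff_const.sub contDiff_snd).norm_sq ℝ
    have h2 : ContDiff ℝ 2 (fun p : ℝ × Euc n => Real.exp (C * p.1)) := by fun_prop
    simp only [hθ]; fun_prop
  have hder : ∀ t, HasDerivAt h (deriv h t) t := fun t =>
    (hh.differentiable (by norm_num) t).hasDerivAt
  have hexp : ∀ t, HasDerivAt (fun t => Real.exp (C * t)) (Real.exp (C * t) * (C * 1)) t :=
    fun t => ((hasDerivAt_id t).const_mul C).exp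
  have dφ : deriv (fun t => φ (t, x₀)) t₀
      = 2 * k * (t₀ - τ₀) + α * Real.exp (C * t₀) * (C * χ x₀) + deriv h t₀ := by
    have h1 : HasDerivAt (fun t => φ (t, x₀)) _ t₀ :=
      ((((((((hasDerivAt_id t₀).sub_const τ₀).pow 2).add_const (‖x₀ - y₀‖ ^ 2)).const_mul
        k).sub_const (k * ((t₀ - τ₀) ^ 2 + ‖x₀ - y₀‖ ^ 2))).const_add (u t₀ x₀)).add
        ((((((hexp t₀).const_mul α).mul_const (χ x₀)).add (hder t₀)).sub_const
          (α * Real.exp (C * t₀) * χ x₀ + h t₀))))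
    rw [h1.deriv]; simp; ring
  have dθ : deriv (fun t => θ (t, y₀)) τ₀
      = 2 * k * (t₀ - τ₀) - α * Real.exp (C * τ₀) * (C * χ y₀) - deriv h τ₀ := by
    have h1 : HasDerivAt (fun t => θ (t, y₀)) _ τ₀ :=
      ((((((((hasDerivAt_id τ₀).const_sub t₀).pow 2).add_const (‖x₀ - y₀‖ ^ 2)).const_mul
        k).sub_const (k * ((t₀ - τ₀) ^ 2 + ‖x₀ - y₀‖ ^ 2))).const_sub (v τ₀ y₀)).sub
        ((((((hexp τ₀).const_mul α).mul_const (χ y₀)).add (hder τ₀)).sub_const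
          (α * Real.exp (C * τ₀) * χ y₀ + h τ₀))))
    rw [h1.deriv]; simp; ring
  have hmem : ∀ {a t : ℝ}, |t - a| < r → r < a → r < T₁ - a → t ∈ Icc 0 T₁ := by
    intro a t h1 h2 h3
    rw [abs_lt] at h1
    exact ⟨by linarith, by linarith⟩
  have hU := hu φ cφ t₀ x₀ r hr hr3.le (by linarith) (by simp [hφ]) (fun t h1 x _ => by
    have := hmax t (hmem h1 hr3 hr4) τ₀ (Ioo_subset_Icc_self hτ₀) x y₀
    simp only [hφ]; linarith) hψ (m / 4) (by linarith)
  have hV := hv θ cθ τ₀ y₀ r hr hr5.le (by linarith) (by simp [hθ]) (fun t h1 x _ => by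
    have := hmax t₀ (Ioo_subset_Icc_self ht₀) t (hmem h1 hr5 hr6) x₀ x
    simp only [hθ]; linarith) (m / 4) (by linarith)
  have hsmall : ∀ᶠ ε in 𝓝[>] (0 : ℝ), ε ∈ Ioc (0 : ℝ) 1 :=
    Ioc_mem_nhdsGT one_pos
  obtain ⟨ε, hε2, hε1, hε⟩ := (hV.and_eventually (hU.and hsmall)).exists
  have ht₀' : t₀ ∈ Ioo 0 T := ⟨ht₀.1, ht₀.2.trans_le hT₁⟩
  have hτ₀' : τ₀ ∈ Ioo 0 T := ⟨hτ₀.1, hτ₀.2.trans_le hT₁⟩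
  have kc : Continuous (fun y => φ (t₀, y)) := by
    have := cφ.continuous
    fun_prop
  have kc' : Continuous (fun y => θ (τ₀, y)) := by
    have := cθ.continuous
    fun_prop
  have iU := (weightedIntegrable_glue (x₀ := x₀) (r := r) hs.1 kc (hui t₀ ht₀')).integrable_trunc
    hs.1 x₀ hε.1
  have iV := (weightedIntegrable_glue (x₀ := y₀) (r := r) hs.1 kc' (hvi τ₀ hτ₀')).integrable_trunc
    hs.1 y₀ hε.1
  have iX := (hχ.weightedIntegrable.integrable_trunc hs.1 x₀ hε.1).const_mul
    (α * Real.exp (C * t₀))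
  have iY := (hχ.weightedIntegrable.integrable_trunc hs.1 y₀ hε.1).const_mul
    (α * Real.exp (C * τ₀))
  have iQ : Integrable (fun z => (2 * k) *
      indicator (Metric.closedBall (0 : Euc n) r) (sqKer s) z) :=
    ((integrable_indicator_iff Metric.isClosed_closedBall.measurableSet).2
      (integrableOn_sqKer hn hs r)).const_mul _
  have key := integral_mono ((iX.add iY).sub iQ) (iU.sub iV) (fun z => by
    simp only [Pi.sub_apply, Pi.add_apply, glue_self hr]
    by_cases hz : ‖z‖ < r
    · have hz' : z ∈ Metric.closedBall (0 : Euc n) r := by simpa using hz.le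
      rw [indicator_of_mem hz', glue_of_lt hz, glue_of_lt hz]
      by_cases hz2 : ε < ‖z‖
      · rw [tk_of_lt hz2]
        simp only [hφ, hθ, sqKer]
        have h1 : ‖x₀ + z - y₀‖ ^ 2 + ‖x₀ - (y₀ + z)‖ ^ 2 = 2 * ‖x₀ - y₀‖ ^ 2 + 2 * ‖z‖ ^ 2 := by
          have e1 : x₀ + z - y₀ = (x₀ - y₀) + z := by abel
          have e2 : x₀ - (y₀ + z) = (x₀ - y₀) - z := by abel
          rw [e1, e2]
          generalize x₀ - y₀ = d
          rw [norm_add_sq_real, norm_sub_sq_real]; ring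
        apply le_of_eq
        linear_combination (k * (‖z‖ ^ ((n : ℝ) + 2 * s))⁻¹) * h1
      · rw [tk_of_le (not_lt.1 hz2)]
        have := mul_nonneg (mul_nonneg zero_le_two hk) (sqKer_nonneg (s := s) z)
        simp only [mul_zero, add_zero, sub_zero]
        linarith
    · have hz := not_lt.1 hz
      rw [glue_of_le hz, glue_of_le hz]
      have h1 := hmax t₀ (Ioo_subset_Icc_self ht₀) τ₀ (Ioo_subset_Icc_self hτ₀) (x₀ + z) (y₀ + z)
      rw [add_sub_add_right_eq_sub] at h1
      have h2 : (0 : ℝ) ≤ indicator (Metric.closedBall (0 : Euc n) r) (sqKer s) z :=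
        indicator_nonneg (fun z _ => sqKer_nonneg z) z
      have h3 := mul_nonneg (mul_nonneg zero_le_two hk) h2
      have e1 : φ (t₀, x₀) = u t₀ x₀ := by simp [hφ]
      have e2 : θ (τ₀, y₀) = v τ₀ y₀ := by simp [hθ]
      rw [e1, e2]
      have h4 := mul_le_mul_of_nonneg_right (sub_nonneg.2 h1) (tk_nonneg (s := s) ε z)
      rw [zero_mul] at h4
      linarith)
  rw [integral_sub' (iX.add iY) iQ, integral_sub' iU iV, integral_add' iX iY,
    integral_const_mul, integral_const_mul, integral_const_mul,
    integral_indicator Metric.isClosed_closedBall.measurableSet, ← truncFracLap_eq,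
    ← truncFracLap_eq, ← truncFracLap_eq, ← truncFracLap_eq] at key
  change _ - 2 * k * sqMass n s r ≤ _ at key
  rw [dφ] at hε1
  rw [dθ] at hε2
  have w1 := mul_le_mul_of_nonneg_left (hχ.trunc x₀ ε hε)
    (mul_nonneg hα (Real.exp_pos (C * t₀)).le)
  have w2 := mul_le_mul_of_nonneg_left (hχ.trunc y₀ ε hε)
    (mul_nonneg hα (Real.exp_pos (C * τ₀)).le)
  linarith

/-- A smooth increasing time penalty that is negligible at `t₁` and equals `B` at `T₁`. -/
lemma exists_time_penalty {t₁ T₁ B δ : ℝ} (ht : t₁ < T₁) (hB : 0 < B) (hδ : 0 < δ) :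
    ∃ h : ℝ → ℝ, ContDiff ℝ 2 h ∧ (∀ t, 0 < deriv h t) ∧ (∀ t, 0 ≤ h t) ∧ h T₁ = B ∧
      h t₁ ≤ δ := by
  have h1 : Tendsto (fun Λ : ℝ => B * Real.exp (Λ * (t₁ - T₁))) atTop (𝓝 0) := by
    have h2 : Tendsto (fun Λ : ℝ => Λ * (t₁ - T₁)) atTop atBot :=
      tendsto_id.atTop_mul_const_of_neg (by linarith)
    simpa using (Real.tendsto_exp_atBot.comp h2).const_mul B
  obtain ⟨Λ, h3, h4⟩ := ((h1.eventually_lt_const hδ).and (eventually_gt_atTop 0)).exists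
  refine ⟨fun t => B * Real.exp (Λ * (t - T₁)), by fun_prop, fun t => ?_, fun t => by positivity,
    by simp, h3.le⟩
  have : HasDerivAt (fun t => B * Real.exp (Λ * (t - T₁))) _ t :=
    ((((hasDerivAt_id t).sub_const T₁).const_mul Λ).exp).const_mul B
  rw [this.deriv]; positivity

lemma continuousOn_time (hw : ContinuousOn (fun p : ℝ × Euc n => u p.1 p.2) (Icc 0 T ×ˢ univ))
    (x : Euc n) : ContinuousOn (fun t => u t x) (Icc 0 T) :=
  hw.comp (f := fun t => (t, x)) (by fun_prop) (fun _ ht => ⟨ht, mem_univ _⟩)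

lemma le_of_forall_Ioo_le
    (huc : ContinuousOn (fun p : ℝ × Euc n => u p.1 p.2) (Icc 0 T ×ˢ univ))
    (hvc : ContinuousOn (fun p : ℝ × Euc n => v p.1 p.2) (Icc 0 T ×ˢ univ))
    (h0 : ∀ x, u 0 x ≤ v 0 x) (H : ∀ t ∈ Ioo 0 T, ∀ x, u t x ≤ v t x)
    {t : ℝ} (ht : t ∈ Icc 0 T) (x : Euc n) : u t x ≤ v t x := by
  rcases eq_or_lt_of_le ht.1 with h1 | h1
  · rw [← h1]; exact h0 x
  rcases eq_or_lt_of_le ht.2 with h2 | h2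
  swap
  · exact H t ⟨h1, h2⟩ x
  have hcl : t ∈ closure (Ioo 0 T) := by
    rw [closure_Ioo (by linarith)]; exact ht
  have hsub : Ioo 0 T ⊆ Icc 0 T := Ioo_subset_Icc_self
  have : (𝓝[Ioo 0 T] t).NeBot := mem_closure_iff_nhdsWithin_neBot.1 hcl
  refine le_of_tendsto_of_tendsto
    ((continuousOn_time huc x t ht).mono_left (nhdsWithin_mono _ hsub))
    ((continuousOn_time hvc x t ht).mono_left (nhdsWithin_mono _ hsub)) ?_
  filter_upwards [self_mem_nhdsWithin] with t' ht'
  exact H t' ht' x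

lemma exists_radius_of_tendsto {χ : Euc n → ℝ} (hχt : Tendsto χ (cocompact (Euc n)) atTop)
    (B : ℝ) : ∃ R, ∀ x, R < ‖x‖ → B < χ x := by
  have h1 := hχt.eventually_gt_atTop B
  rw [← Metric.cobounded_eq_cocompact, ← comap_norm_atTop] at h1
  obtain ⟨S, hS, hS'⟩ := mem_comap.1 h1
  obtain ⟨R, hR⟩ := mem_atTop_sets.1 hS
  exact ⟨R, fun x hx => hS' (hR _ hx.le : ‖x‖ ∈ S)⟩

/-- Comparison principle: a subsolution lies below a supersolution above the obstacle if it does so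
initially and if, on one side each, both are dominated by any multiple of one coercive weight. -/
theorem IsSub.le_isSuper (hn : 0 < n) (hs : s ∈ Ioo (0 : ℝ) 1) {C : ℝ} (hC : 0 ≤ C)
    {χ : Euc n → ℝ} (hχ : IsWeight s C χ) (hχt : Tendsto χ (cocompact (Euc n)) atTop)
    (huc : ContinuousOn (fun p : ℝ × Euc n => u p.1 p.2) (Icc 0 T ×ˢ univ))
    (hvc : ContinuousOn (fun p : ℝ × Euc n => v p.1 p.2) (Icc 0 T ×ˢ univ))
    (hψ : Continuous ψ)
    (hui : ∀ t ∈ Ioo 0 T, WeightedIntegrable s (u t))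
    (hvi : ∀ t ∈ Ioo 0 T, WeightedIntegrable s (v t))
    (hu : IsSub s T ψ u) (hv : IsSuper s T v)
    (hvψ : ∀ t ∈ Icc 0 T, ∀ x, ψ x ≤ v t x) (h0 : ∀ x, u 0 x ≤ v 0 x)
    (hub : ∀ α > 0, ∃ B, ∀ t ∈ Icc 0 T, ∀ x, u t x ≤ α * χ x + B)
    (hvb : ∀ α > 0, ∃ B, ∀ t ∈ Icc 0 T, ∀ x, -(α * χ x + B) ≤ v t x)
    {t : ℝ} (ht : t ∈ Icc 0 T) (x : Euc n) : u t x ≤ v t x := by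
  suffices H : ∀ t ∈ Ioo 0 T, ∀ x, u t x ≤ v t x from
    le_of_forall_Ioo_le huc hvc h0 H ht x
  clear ht x t
  intro t₁ ht₁ x₁
  by_contra hcon
  rw [not_le] at hcon
  obtain ⟨δ, hδ0, hδ⟩ : ∃ δ > 0, 3 * δ ≤ u t₁ x₁ - v t₁ x₁ :=
    ⟨(u t₁ x₁ - v t₁ x₁) / 3, by linarith, by linarith⟩
  set α : ℝ := δ / (2 * Real.exp (C * t₁) * χ x₁ + 1) with hα
  have hχ1 := hχ.nonneg x₁
  have hα0 : 0 < α := by positivity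
  have hαδ : 2 * (α * Real.exp (C * t₁) * χ x₁) ≤ δ := by
    have : α * (2 * Real.exp (C * t₁) * χ x₁ + 1) = δ := by
      rw [hα]; field_simp
    linarith only [this, hα0]
  obtain ⟨B₁, hB₁⟩ := hub (α / 2) (by positivity)
  obtain ⟨B₂, hB₂⟩ := hvb (α / 2) (by positivity)
  set B : ℝ := max 0 (B₁ + B₂) with hB
  have hB0 : 0 ≤ B := le_max_left _ _
  have hBB : B₁ + B₂ ≤ B := le_max_right _ _
  set T₁ : ℝ := (t₁ + T) / 2 with hT₁
  have hT₁T : T₁ < T := by have := ht₁.2; rw [hT₁]; linarith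
  have htT₁ : t₁ < T₁ := by have := ht₁.2; rw [hT₁]; linarith
  -- a time penalty that is negligible at `t₁` and prohibitive at `T₁`
  obtain ⟨h, hhc, hh', hh0, hhT, hht⟩ := exists_time_penalty htT₁ (by linarith : 0 < B + 1)
    (half_pos hδ0)
  have hg : ∀ t ∈ Icc 0 T, ∀ x, α * χ x ≤ α * Real.exp (C * t) * χ x := by
    intro t ht x
    have h1 : 1 ≤ Real.exp (C * t) := Real.one_le_exp (mul_nonneg hC ht.1)
    have := mul_le_mul_of_nonneg_left h1 (mul_nonneg hα0.le (hχ.nonneg x))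
    linarith
  have hIcc : Icc 0 T₁ ⊆ Icc 0 T := Icc_subset_Icc_right hT₁T.le
  -- a ball outside of which the penalized difference is negative
  obtain ⟨R, hR⟩ : ∃ R, ∀ x, R < ‖x‖ → 2 * B < α * χ x := by
    obtain ⟨R, hR⟩ := exists_radius_of_tendsto hχt (2 * B / α)
    refine ⟨R, fun x hx => ?_⟩
    have := hR x hx
    rw [div_lt_iff₀ hα0] at this
    linarith only [this]
  have hK : IsCompact (Icc 0 T ×ˢ Metric.closedBall (0 : Euc n) (max R ‖x₁‖)) :=
    isCompact_Icc.prod (isCompact_closedBall _ _)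
  set K := Icc 0 T ×ˢ Metric.closedBall (0 : Euc n) (max R ‖x₁‖) with hKdef
  have hKsub : K ⊆ Icc 0 T ×ˢ univ := prod_mono_right (subset_univ _)
  obtain ⟨η₁, hη₁, hη₁'⟩ := Metric.uniformContinuousOn_iff.1
    (hK.uniformContinuousOn_of_continuous (huc.mono hKsub)) δ hδ0
  obtain ⟨η₂, hη₂, hη₂'⟩ := Metric.uniformContinuousOn_iff.1
    (hK.uniformContinuousOn_of_continuous (hvc.mono hKsub)) δ hδ0
  obtain ⟨η₃, hη₃, hη₃'⟩ := Metric.uniformContinuousOn_iff.1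
    ((isCompact_closedBall (0 : Euc n) (max R ‖x₁‖)).uniformContinuousOn_of_continuous
      hψ.continuousOn) δ hδ0
  set η := min η₁ (min η₂ η₃) with hη
  have hη0 : 0 < η := by positivity
  set k : ℝ := (B + 1) / η ^ 2 with hk
  have hk0 : 0 < k := by positivity
  set Φ : (ℝ × Euc n) × (ℝ × Euc n) → ℝ := fun P =>
    u P.1.1 P.1.2 - v P.2.1 P.2.2 - k * ((P.1.1 - P.2.1) ^ 2 + ‖P.1.2 - P.2.2‖ ^ 2)
      - (α * Real.exp (C * P.1.1) * χ P.1.2 + h P.1.1)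
      - (α * Real.exp (C * P.2.1) * χ P.2.2 + h P.2.1) with hΦ
  set K₁ := Icc 0 T₁ ×ˢ Metric.closedBall (0 : Euc n) (max R ‖x₁‖) with hK₁
  have hK₁K : K₁ ⊆ K := prod_mono_left hIcc
  have hK₁c : IsCompact K₁ := isCompact_Icc.prod (isCompact_closedBall _ _)
  have hΦc : ContinuousOn Φ (K₁ ×ˢ K₁) := by
    have c1 : ContinuousOn (fun P : (ℝ × Euc n) × (ℝ × Euc n) => u P.1.1 P.1.2) (K₁ ×ˢ K₁) :=
      huc.comp (f := fun P : (ℝ × Euc n) × (ℝ × Euc n) => P.1) (by fun_prop)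
        (fun P hP => hKsub (hK₁K hP.1))
    have c2 : ContinuousOn (fun P : (ℝ × Euc n) × (ℝ × Euc n) => v P.2.1 P.2.2) (K₁ ×ˢ K₁) :=
      hvc.comp (f := fun P : (ℝ × Euc n) × (ℝ × Euc n) => P.2) (by fun_prop)
        (fun P hP => hKsub (hK₁K hP.2))
    have c3 := hχ.contDiff.continuous
    have c4 := hhc.continuous
    refine (((c1.sub c2).sub ?_).sub ?_).sub ?_ <;> refine Continuous.continuousOn ?_ <;> fun_prop
  have hp₁ : (t₁, x₁) ∈ K₁ := ⟨⟨ht₁.1.le, htT₁.le⟩, by simp⟩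
  obtain ⟨⟨⟨t₀, x₀⟩, τ₀, y₀⟩, hP, hPmax⟩ := (hK₁c.prod hK₁c).exists_isMaxOn
    ⟨((t₁, x₁), (t₁, x₁)), hp₁, hp₁⟩ hΦc
  have hval : δ ≤ Φ ((t₀, x₀), (τ₀, y₀)) := by
    have h1 : Φ ((t₁, x₁), (t₁, x₁)) ≤ Φ ((t₀, x₀), (τ₀, y₀)) := hPmax ⟨hp₁, hp₁⟩
    have h2 : δ ≤ Φ ((t₁, x₁), (t₁, x₁)) := by
      simp only [hΦ, sub_self, norm_zero]
      have h3 : 2 * h t₁ ≤ δ := by linarith only [hht]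
      linarith only [h3, hαδ, hδ]
    linarith only [h1, h2]
  have hup : ∀ t ∈ Icc 0 T₁, ∀ τ ∈ Icc 0 T₁, ∀ x y, Φ ((t, x), (τ, y))
      ≤ B - k * ((t - τ) ^ 2 + ‖x - y‖ ^ 2) - α / 2 * χ x - α / 2 * χ y - h t - h τ := by
    intro t ht τ hτ x y
    have h1 := hB₁ t (hIcc ht) x
    have h2 := hB₂ τ (hIcc hτ) y
    have h3 := hg t (hIcc ht) x
    have h4 := hg τ (hIcc hτ) y
    simp only [hΦ]; linarith only [h1, h2, h3, h4, hBB]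
  have hmax : ∀ t ∈ Icc 0 T₁, ∀ τ ∈ Icc 0 T₁, ∀ x y,
      Φ ((t, x), (τ, y)) ≤ Φ ((t₀, x₀), (τ₀, y₀)) := by
    intro t ht τ hτ x y
    have h1 := hup t ht τ hτ x y
    have h2 : 0 ≤ k * ((t - τ) ^ 2 + ‖x - y‖ ^ 2) := by positivity
    have h3 := mul_nonneg hα0.le (hχ.nonneg x)
    have h4 := mul_nonneg hα0.le (hχ.nonneg y)
    have h5 := hh0 t
    have h6 := hh0 τ
    by_cases hx : R < ‖x‖
    · have := hR x hx; linarith only [h1, h2, h4, h5, h6, this, hval, hδ0, hB0]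
    by_cases hy : R < ‖y‖
    · have := hR y hy; linarith only [h1, h2, h3, h5, h6, this, hval, hδ0, hB0]
    rw [not_lt] at hx hy
    exact hPmax (show ((t, x), (τ, y)) ∈ K₁ ×ˢ K₁ from
      ⟨⟨ht, by simpa using Or.inl hx⟩, hτ, by simpa using Or.inl hy⟩)
  obtain ⟨⟨ht₀, hx₀⟩, hτ₀, hy₀⟩ := hP
  replace ht₀ : t₀ ∈ Icc 0 T₁ := ht₀
  replace hτ₀ : τ₀ ∈ Icc 0 T₁ := hτ₀
  have hup0 := hup t₀ ht₀ τ₀ hτ₀ x₀ y₀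
  have hχx := mul_nonneg hα0.le (hχ.nonneg x₀)
  have hχy := mul_nonneg hα0.le (hχ.nonneg y₀)
  have hquad : k * ((t₀ - τ₀) ^ 2 + ‖x₀ - y₀‖ ^ 2) < k * η ^ 2 := by
    have h1 : k * η ^ 2 = B + 1 := by rw [hk]; field_simp
    have h5 := hh0 t₀
    have h6 := hh0 τ₀
    rw [h1]; linarith only [hup0, hval, hδ0, hχx, hχy, h5, h6]
  have hquad' := lt_of_mul_lt_mul_left hquad hk0.le
  have hdt : |t₀ - τ₀| < η := by
    refine abs_lt_of_sq_lt_sq ?_ hη0.le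
    linarith only [hquad', sq_nonneg ‖x₀ - y₀‖]
  have hdx : ‖x₀ - y₀‖ < η := by
    refine lt_of_pow_lt_pow_left₀ 2 hη0.le ?_
    linarith only [hquad', sq_nonneg (t₀ - τ₀)]
  have hdist : dist ((t₀, x₀) : ℝ × Euc n) (τ₀, y₀) < η := by
    rw [Prod.dist_eq, max_lt_iff, Real.dist_eq, dist_eq_norm]
    exact ⟨hdt, hdx⟩
  have hpK : ((t₀, x₀) : ℝ × Euc n) ∈ K := hK₁K ⟨ht₀, hx₀⟩
  have hqK : ((τ₀, y₀) : ℝ × Euc n) ∈ K := hK₁K ⟨hτ₀, hy₀⟩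
  have hdiff : δ ≤ u t₀ x₀ - v τ₀ y₀ := by
    have h2 : 0 ≤ k * ((t₀ - τ₀) ^ 2 + ‖x₀ - y₀‖ ^ 2) := by positivity
    have h3 := hg t₀ (hIcc ht₀) x₀
    have h4 := hg τ₀ (hIcc hτ₀) y₀
    have h5 := hh0 t₀
    have h6 := hh0 τ₀
    simp only [hΦ] at hval
    linarith only [hval, h2, h3, h4, h5, h6, hχx, hχy]
  have hvdiff := hη₂' _ hpK _ hqK (hdist.trans_le ((min_le_right _ _).trans (min_le_left _ _)))
  have hudiff := hη₁' _ hpK _ hqK (hdist.trans_le (min_le_left _ _))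
  have hψdiff := hη₃' x₀ hx₀ y₀ hy₀ (by
    rw [dist_eq_norm]
    exact hdx.trans_le ((min_le_right _ _).trans (min_le_right _ _)))
  rw [Real.dist_eq, abs_lt] at hvdiff hudiff hψdiff
  simp only at hvdiff hudiff
  have hnn : 0 ≤ k * ((t₀ - τ₀) ^ 2 + ‖x₀ - y₀‖ ^ 2) := by positivity
  have ht₀pos : 0 < t₀ := by
    rcases eq_or_lt_of_le ht₀.1 with h1 | h1
    · rw [← h1] at hvdiff hdiff
      have := h0 x₀
      linarith only [this, hvdiff.1, hvdiff.2, hdiff]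
    · exact h1
  have hτ₀pos : 0 < τ₀ := by
    rcases eq_or_lt_of_le hτ₀.1 with h1 | h1
    · rw [← h1] at hudiff hdiff
      have := h0 y₀
      linarith only [this, hudiff.1, hudiff.2, hdiff]
    · exact h1
  have ht₀lt : t₀ < T₁ := by
    rcases eq_or_lt_of_le ht₀.2 with h1 | h1
    · rw [h1, hhT] at hup0
      have h6 := hh0 τ₀
      rw [h1] at hnn hval
      linarith only [hup0, hnn, hval, h6, hχx, hχy, hδ0]
    · exact h1
  have hτ₀lt : τ₀ < T₁ := by
    rcases eq_or_lt_of_le hτ₀.2 with h1 | h1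
    · rw [h1, hhT] at hup0
      have h6 := hh0 t₀
      rw [h1] at hnn hval
      linarith only [hup0, hnn, hval, h6, hχx, hχy, hδ0]
    · exact h1
  refine no_interior_doubled_max hn hs hχ hui hvi hu hv hhc hh' hα0.le hk0.le hT₁T.le
    ⟨ht₀pos, ht₀lt⟩ ⟨hτ₀pos, hτ₀lt⟩ hmax ?_
  have := hvψ τ₀ (hIcc hτ₀) y₀
  linarith only [this, hψdiff.1, hψdiff.2, hdiff]

end Comparison

/-! ### Local boundedness of subsolutions -/

section LocalBound

variable {n : ℕ} {s T : ℝ} {ψ : Euc n → ℝ} {u : ℝ → Euc n → ℝ}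

/-- The integral of the kernel over the annulus `1 < |z| ≤ 2`. -/
def annMass (n : ℕ) (s : ℝ) : ℝ := ∫ z : Euc n, (tk s 1 z - tk s 2 z)

lemma annMass_pos (hn : 0 < n) (hs : 0 < s) : 0 < annMass n s := by
  have : Nonempty (Fin n) := ⟨⟨0, hn⟩⟩
  have h0 : 0 ≤ fun z : Euc n => tk s 1 z - tk s 2 z :=
    fun z => sub_nonneg.2 (tk_anti one_le_two z)
  have hi : Integrable (fun z : Euc n => tk s 1 z - tk s 2 z) :=
    (integrable_tk hs one_pos).sub (integrable_tk hs two_pos)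
  rw [annMass, integral_pos_iff_support_of_nonneg h0 hi]
  have hopen : IsOpen {z : Euc n | 1 < ‖z‖ ∧ ‖z‖ < 2} :=
    (isOpen_lt continuous_const continuous_norm).inter (isOpen_lt continuous_norm continuous_const)
  refine (hopen.measure_pos volume ?_).trans_le (measure_mono ?_)
  · refine ⟨EuclideanSpace.single ⟨0, hn⟩ (3 / 2 : ℝ), ?_⟩
    simp only [mem_ofPred_eq, PiLp.norm_single]
    norm_num
  · rintro z ⟨h1, h2⟩
    rw [Function.mem_support, tk_of_lt h1, tk_of_le h2.le, sub_zero]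
    have : 0 < ‖z‖ := by linarith
    positivity

lemma integral_annulus {ρ : ℝ} (hρ : 0 < ρ) :
    ∫ z : Euc n, (tk s ρ z - tk s (2 * ρ) z) = ρ ^ (-(2 * s)) * annMass n s := by
  have hk : ∀ a, ∀ z : Euc n, tk s (a * ρ) (ρ • z) = ρ ^ (-((n : ℝ) + 2 * s)) * tk s a z := by
    intro a z
    have hnorm : ‖ρ • z‖ = ρ * ‖z‖ := by rw [norm_smul, Real.norm_of_nonneg hρ.le]
    by_cases h : a < ‖z‖
    · rw [tk_of_lt h, tk_of_lt (by rw [hnorm, mul_comm a]; exact mul_lt_mul_of_pos_left h hρ),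
        hnorm, Real.mul_rpow hρ.le (norm_nonneg z), mul_inv, Real.rpow_neg hρ.le]
    · rw [not_lt] at h
      rw [tk_of_le h, tk_of_le (by rw [hnorm, mul_comm a]; exact mul_le_mul_of_nonneg_left h hρ.le),
        mul_zero]
  have h := Measure.integral_comp_smul_of_nonneg (μ := volume)
    (fun z : Euc n => tk s ρ z - tk s (2 * ρ) z) ρ (hR := hρ.le)
  have h1 : ∀ z : Euc n, tk s ρ (ρ • z) - tk s (2 * ρ) (ρ • z)
      = ρ ^ (-((n : ℝ) + 2 * s)) * (tk s 1 z - tk s 2 z) := by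
    intro z
    have := hk 1 z
    rw [one_mul] at this
    rw [hk 2, this]; ring
  simp only [h1, integral_const_mul, finrank_euclideanSpace, Fintype.card_fin, smul_eq_mul] at h
  have hne : (ρ ^ n : ℝ) ≠ 0 := by positivity
  have h3 : ρ ^ (-(2 * s)) = ρ ^ n * ρ ^ (-((n : ℝ) + 2 * s)) := by
    rw [← Real.rpow_natCast ρ n, ← Real.rpow_add hρ]; congr 1; ring
  unfold annMass
  rw [h3, mul_assoc, h, ← mul_assoc, mul_inv_cancel₀ hne, one_mul]

/-- If `f` lies below a paraboloid near its value at `x₀`, and if it is of size less than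
`f x₀` in an averaged sense on the annulus `ρ < |z| ≤ 2 ρ`, then the gain on the annulus bounds the
truncated fractional Laplacians of `f` at `x₀` from below. -/
lemma truncFracLap_ge_of_annulus (hn : 0 < n) (hs : s ∈ Ioo (0 : ℝ) 1) {f : Euc n → ℝ}
    (hf : WeightedIntegrable s f) {x₀ p : Euc n} {ρ c U ε m : ℝ} (hε : 0 < ε) (hερ : ε < ρ)
    (hc : 0 ≤ c) (hU : 0 ≤ U)
    (h1 : ∀ z, ‖z‖ ≤ ρ → -inner ℝ p z - c * ‖z‖ ^ 2 ≤ f x₀ - f (x₀ + z))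
    (h2 : ∀ z, ρ < ‖z‖ → U - |f (x₀ + z)| ≤ f x₀ - f (x₀ + z))
    (h3 : ‖p‖ * (2 * ρ) ≤ U / 2) (h4 : ∫ z, |f (x₀ + z)| * tk s ρ z ≤ m) :
    -(c * sqMass n s ρ) + U / 2 * (ρ ^ (-(2 * s)) * annMass n s) - m
      ≤ truncFracLap s f x₀ ε := by
  have hρ : 0 < ρ := hε.trans hερ
  have i0 : Integrable (fun z : Euc n => inner ℝ p z * (tk s ε z - tk s (2 * ρ) z)) := by
    refine ((integrable_tk hs.1 hε).const_mul (‖p‖ * (2 * ρ))).mono'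
      (((continuous_const.inner continuous_id).measurable.mul
        ((measurable_tk _).sub (measurable_tk _))).aestronglyMeasurable)
      (Eventually.of_forall fun z => ?_)
    rw [norm_mul, Real.norm_of_nonneg (sub_nonneg.2 (tk_anti (by linarith) z))]
    by_cases hz : ‖z‖ ≤ 2 * ρ
    · have h5 : ‖(inner ℝ p z : ℝ)‖ ≤ ‖p‖ * (2 * ρ) :=
        (norm_inner_le_norm p z).trans (mul_le_mul_of_nonneg_left hz (norm_nonneg _))
      refine mul_le_mul h5 ?_ (sub_nonneg.2 (tk_anti (by linarith) z)) (by positivity)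
      linarith [tk_nonneg (s := s) (2 * ρ) z]
    · rw [not_le] at hz
      rw [tk_of_lt hz, tk_of_lt (by linarith)]
      simp only [sub_self, mul_zero]
      positivity
  have iS : Integrable (fun z => c * indicator (Metric.closedBall (0 : Euc n) ρ) (sqKer s) z) :=
    ((integrable_indicator_iff Metric.isClosed_closedBall.measurableSet).2
      (integrableOn_sqKer hn hs ρ)).const_mul _
  have iA : Integrable (fun z : Euc n => U / 2 * (tk s ρ z - tk s (2 * ρ) z)) :=
    ((integrable_tk hs.1 hρ).sub (integrable_tk hs.1 (by linarith))).const_mul _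
  have iF : Integrable (fun z => |f (x₀ + z)| * tk s ρ z) :=
    ((hf.comp_add hs.1 x₀).abs).integrable_mul_tk hs.1 hρ
  have key := integral_mono (((iA.sub iS).sub i0).sub iF) (hf.integrable_trunc hs.1 x₀ hε)
    (fun z => by
      simp only [Pi.sub_apply]
      by_cases hz1 : ‖z‖ ≤ ρ
      · have hz' : z ∈ Metric.closedBall (0 : Euc n) ρ := by simpa using hz1
        rw [indicator_of_mem hz', tk_of_le hz1, tk_of_le (by linarith : ‖z‖ ≤ 2 * ρ)]
        by_cases hz2 : ε < ‖z‖
        · rw [tk_of_lt hz2]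
          have := mul_le_mul_of_nonneg_right (h1 z hz1)
            (by positivity : (0 : ℝ) ≤ (‖z‖ ^ ((n : ℝ) + 2 * s))⁻¹)
          simp only [sqKer]
          linarith
        · rw [tk_of_le (not_lt.1 hz2)]
          have := mul_nonneg hc (sqKer_nonneg (s := s) z)
          simp only [sub_self, mul_zero, sub_zero, zero_sub]
          linarith
      · rw [not_le] at hz1
        have hz' : z ∉ Metric.closedBall (0 : Euc n) ρ := by simpa using hz1
        have h5 := h2 z hz1
        rw [indicator_of_notMem hz', tk_of_lt hz1, tk_of_lt (hερ.trans hz1)]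
        have hk : (0 : ℝ) ≤ (‖z‖ ^ ((n : ℝ) + 2 * s))⁻¹ := by positivity
        have h6 := mul_le_mul_of_nonneg_right h5 hk
        by_cases hz2 : ‖z‖ ≤ 2 * ρ
        · rw [tk_of_le hz2]
          have h7 : -(U / 2) ≤ inner ℝ p z := by
            have h8 := abs_le.1 (abs_real_inner_le_norm p z)
            have := mul_le_mul_of_nonneg_left hz2 (norm_nonneg p)
            linarith
          have h9 := mul_le_mul_of_nonneg_right h7 hk
          linarith
        · rw [tk_of_lt (not_le.1 hz2)]
          have := mul_nonneg hU hk
          linarith)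
  have hodd : ∫ z : Euc n, inner ℝ p z * (tk s ε z - tk s (2 * ρ) z) = 0 :=
    integral_eq_zero_of_odd fun z => by simp [tk_neg, inner_neg_right]
  rw [integral_sub' ((iA.sub iS).sub i0) iF, integral_sub' (iA.sub iS) i0, integral_sub' iA iS,
    hodd, integral_const_mul, integral_const_mul, integral_annulus hρ,
    integral_indicator Metric.isClosed_closedBall.measurableSet, ← truncFracLap_eq] at key
  unfold sqMass
  linarith

lemma exists_inv_one_sub_pow_le (n : ℕ) :
    ∃ C : ℝ, 0 ≤ C ∧ ∀ w : ℝ, |w| ≤ 1 / 2 → ((1 - w)⁻¹) ^ n ≤ 1 + n * w + C * w ^ 2 := by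
  induction n with
  | zero => exact ⟨0, le_rfl, fun w _ => by simp⟩
  | succ n ih =>
    obtain ⟨C, hC, h⟩ := ih
    refine ⟨2 + n + C + (2 * n + C) / 2 + C / 2, by positivity, fun w hw => ?_⟩
    obtain ⟨h1, h2⟩ := abs_le.1 hw
    have h3 : (1 - w)⁻¹ ≤ 1 + w + 2 * w ^ 2 := by
      rw [inv_le_iff_one_le_mul₀ (by linarith)]
      nlinarith [sq_nonneg w, mul_nonneg (sq_nonneg w) (by linarith : 0 ≤ 1 - 2 * w)]
    have h4 : (0 : ℝ) ≤ (1 - w)⁻¹ := inv_nonneg.2 (by linarith)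
    have h5 : 0 ≤ 1 + w + 2 * w ^ 2 := by nlinarith [sq_nonneg w]
    rw [pow_succ]
    calc ((1 - w)⁻¹) ^ n * (1 - w)⁻¹ ≤ (1 + n * w + C * w ^ 2) * (1 + w + 2 * w ^ 2) :=
          mul_le_mul (h w hw) h3 h4 ((pow_nonneg h4 n).trans (h w hw))
      _ ≤ _ := by
          have e1 : 0 ≤ w ^ 2 * (1 / 2 - w) := mul_nonneg (sq_nonneg w) (by linarith)
          have e2 : 0 ≤ w ^ 2 * (1 / 4 - w ^ 2) := mul_nonneg (sq_nonneg w) (by nlinarith)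
          have hn : (0 : ℝ) ≤ n := by positivity
          push_cast
          nlinarith [mul_nonneg (by positivity : (0 : ℝ) ≤ 2 * n + C) e1, mul_nonneg hC e2]

end LocalBound

section LocalBound

variable {n : ℕ} {s : ℝ}

lemma integral_abs_mul_tk_le (hs : 0 < s) {f g : Euc n → ℝ} (hf : WeightedIntegrable s f)
    (hg : WeightedIntegrable s g) {x₀ xb : Euc n} (hx : ‖x₀ - xb‖ ≤ 1) {ρ M : ℝ} (hρ0 : 0 < ρ)
    (hρ1 : ρ ≤ 1) (hfg : ∀ z, ρ < ‖z‖ → f (x₀ + z) = g (x₀ + z))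
    (hM : ∫ y, |g y| * wt s (xb - y) ≤ M) :
    ∫ z, |f (x₀ + z)| * tk s ρ z ≤ (3 / ρ) ^ ((n : ℝ) + 2 * s) * M := by
  have i1 : Integrable (fun y => |g y| * wt s (xb - y)) := hg.abs.integrable_mul_wt_sub hs xb
  have i2 := i1.comp_add_left x₀
  have e1 : ∫ z, |g (x₀ + z)| * wt s (xb - (x₀ + z)) ≤ M := by
    rw [integral_add_left_eq_self (fun y => |g y| * wt s (xb - y)) x₀]; exact hM
  refine le_trans ?_ (mul_le_mul_of_nonneg_left e1 (by positivity))
  rw [← integral_const_mul]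
  refine integral_mono (((hf.comp_add hs x₀).abs).integrable_mul_tk hs hρ0)
    (i2.const_mul _) fun z => ?_
  simp only
  rcases le_or_gt ‖z‖ ρ with hz | hz
  · rw [tk_of_le hz, mul_zero]
    have := wt_pos (s := s) (xb - (x₀ + z))
    positivity
  · rw [hfg z hz, ← mul_assoc, mul_comm ((3 / ρ) ^ _), mul_assoc]
    refine mul_le_mul_of_nonneg_left ?_ (abs_nonneg _)
    rw [tk_of_lt hz]
    unfold wt
    have hz0 : 0 < ‖z‖ := hρ0.trans hz
    have h2 : (1 + ‖xb - (x₀ + z)‖) ≤ 3 / ρ * ‖z‖ := by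
      have h3 : ‖xb - (x₀ + z)‖ ≤ ‖x₀ - xb‖ + ‖z‖ := by
        have : xb - (x₀ + z) = -((x₀ - xb) + z) := by abel
        rw [this, norm_neg]; exact norm_add_le _ _
      rw [div_mul_eq_mul_div, le_div_iff₀ hρ0]
      nlinarith [norm_nonneg (xb - (x₀ + z))]
    have h4 : (1 + ‖xb - (x₀ + z)‖) ^ ((n : ℝ) + 2 * s)
        ≤ (3 / ρ) ^ ((n : ℝ) + 2 * s) * ‖z‖ ^ ((n : ℝ) + 2 * s) := by
      rw [← Real.mul_rpow (by positivity) hz0.le]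
      exact Real.rpow_le_rpow (by positivity) h2 (expo_pos hs).le
    rw [← div_eq_mul_inv, inv_le_comm₀ (by positivity) (by positivity), inv_div,
      div_le_iff₀ (by positivity)]
    linarith

/-- The relative decrease of the barrier `1 - |x - x̄|²`, of value `q` at `x₀`, at `x₀ + z`. -/
def relDrop {n : ℕ} (e : Euc n) (q : ℝ) (z : Euc n) : ℝ := (2 * inner ℝ e z + ‖z‖ ^ 2) / q

lemma abs_relDrop_le {e z : Euc n} {q : ℝ} (hq : 0 < q) (he : ‖e‖ ≤ 1) (hz : ‖z‖ ≤ 1) :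
    |relDrop e q z| ≤ 3 * ‖z‖ / q := by
  rw [relDrop, abs_div, abs_of_pos hq]
  gcongr
  have h1 := (abs_real_inner_le_norm e z).trans (mul_le_of_le_one_left (norm_nonneg z) he)
  have h2 : ‖z‖ ^ 2 ≤ ‖z‖ := by nlinarith [norm_nonneg z]
  calc |2 * inner ℝ e z + ‖z‖ ^ 2| ≤ |2 * inner ℝ e z| + |‖z‖ ^ 2| := abs_add_le _ _
    _ ≤ 2 * ‖z‖ + ‖z‖ := by
        rw [abs_mul, abs_two, abs_of_nonneg (sq_nonneg ‖z‖)]; linarith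
    _ = _ := by ring

/-- At a point where `f` is touched from above by the blow-up barrier of height `U`, the truncated
fractional Laplacians of `f` are nonnegative as soon as `U` dominates the weighted mass of `f`. -/
lemma truncFracLap_nonneg_of_contact (hn : 0 < n) (hs : s ∈ Ioo (0 : ℝ) 1) {C θ M U q ε : ℝ}
    (hC : 0 ≤ C) (hθ0 : 0 < θ) (hθ1 : 8 * (n : ℝ) * θ ≤ 1)
    (hθ2 : (n + 9 * C) * θ ^ 2 * sqMass n s 1 ≤ annMass n s / 4)
    (hUq : 4 * 3 ^ ((n : ℝ) + 2 * s) / (annMass n s * θ ^ n) * M ≤ U * q ^ n)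
    (hU0 : 0 < U) (hq0 : 0 < q) (hq1 : q ≤ 1) {f : Euc n → ℝ} (hf : WeightedIntegrable s f)
    {x₀ e : Euc n} (he : ‖e‖ ≤ 1) (hε : 0 < ε) (hερ : ε < θ * q)
    (h1 : ∀ z, ‖z‖ ≤ θ * q →
      f (x₀ + z) ≤ f x₀ + U * (n * relDrop e q z + C * relDrop e q z ^ 2))
    (h2 : U ≤ f x₀)
    (h3 : ∫ z, |f (x₀ + z)| * tk s (θ * q) z ≤ (3 / (θ * q)) ^ ((n : ℝ) + 2 * s) * M) :
    0 ≤ truncFracLap s f x₀ ε := by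
  set N : ℝ := (n : ℝ) + 2 * s with hN
  set a : ℝ := annMass n s with ha
  have ha0 : 0 < a := annMass_pos hn hs.1
  have hnR : (1 : ℝ) ≤ n := by exact_mod_cast hn
  have hθ8 : θ ≤ 1 / 8 := by nlinarith only [hθ1, hθ0, hnR]
  set ρ : ℝ := θ * q with hρ
  have hρ0 : 0 < ρ := by positivity
  have hρ1 : ρ ≤ 1 := by nlinarith only [hρ, hθ8, hq1, hθ0, hq0]
  have hmain := truncFracLap_ge_of_annulus hn hs hf (x₀ := x₀) (p := (2 * n * U / q) • e)
    (ρ := ρ) (c := U * (n + 9 * C) / q ^ 2) (U := U) (m := (3 / ρ) ^ N * M) hε hερ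
    (by positivity) hU0.le ?_ ?_ ?_ h3
  · have e1 : sqMass n s ρ = ρ ^ (2 : ℝ) * ρ ^ (-(2 * s)) * sqMass n s 1 := by
      rw [sqMass_mul ρ hρ0, ← Real.rpow_add hρ0]; rfl
    have e2 : (3 / ρ) ^ N = 3 ^ N * (ρ ^ (-(2 * s)) / ρ ^ n) := by
      rw [Real.div_rpow (by norm_num) hρ0.le, hN, Real.rpow_add hρ0, Real.rpow_natCast,
        Real.rpow_neg hρ0.le]
      field_simp
    rw [e1, e2, Real.rpow_two] at hmain
    have hx : 0 < ρ ^ (-(2 * s)) := Real.rpow_pos_of_pos hρ0 _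
    set X := ρ ^ (-(2 * s)) with hX
    have f1 : U * (n + 9 * C) / q ^ 2 * (ρ ^ 2 * X * sqMass n s 1)
        = U * X * ((n + 9 * C) * θ ^ 2 * sqMass n s 1) := by
      rw [hρ]; field_simp
    have f2 : U * X * ((n + 9 * C) * θ ^ 2 * sqMass n s 1) ≤ U * X * (a / 4) :=
      mul_le_mul_of_nonneg_left hθ2 (by positivity)
    have f3 : 3 ^ N * (X / ρ ^ n) * M ≤ U * X * (a / 4) := by
      rw [div_mul_eq_mul_div, div_le_iff₀ (by positivity)] at hUq
      rw [mul_div_assoc', div_mul_eq_mul_div, div_le_iff₀ (by positivity), hρ, mul_pow]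
      linarith only [mul_le_mul_of_nonneg_left hUq hx.le]
    rw [f1] at hmain
    linarith only [hmain, f2, f3]
  · intro z hz
    have h4 := h1 z hz
    have h5 : relDrop e q z ^ 2 ≤ (3 * ‖z‖ / q) ^ 2 := by
      rw [← sq_abs (relDrop e q z)]
      exact pow_le_pow_left₀ (abs_nonneg _) (abs_relDrop_le hq0 he (hz.trans hρ1)) 2
    have h6 := mul_le_mul_of_nonneg_left h5 (mul_nonneg hU0.le hC)
    have h7 : U * n * ‖z‖ ^ 2 / q ≤ U * n * ‖z‖ ^ 2 / q ^ 2 := by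
      apply div_le_div_of_nonneg_left (by positivity) (by positivity)
      nlinarith only [hq0, hq1]
    have h8 : U * (n * relDrop e q z)
        = inner ℝ ((2 * n * U / q) • e) z + U * n * ‖z‖ ^ 2 / q := by
      rw [relDrop, inner_smul_left]
      simp only [conj_trivial]
      field_simp
    have h9 : U * (n + 9 * C) / q ^ 2 * ‖z‖ ^ 2
        = U * n * ‖z‖ ^ 2 / q ^ 2 + U * C * (3 * ‖z‖ / q) ^ 2 := by
      field_simp; ring
    rw [h9]
    linarith only [h4, h6, h7, h8]
  · intro z hz
    linarith only [le_abs_self (f (x₀ + z)), h2]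
  · rw [norm_smul, Real.norm_of_nonneg (by positivity)]
    have h4 : 2 * n * U / q * ‖e‖ * (2 * ρ) ≤ 2 * n * U / q * 1 * (2 * ρ) := by gcongr
    have h5 : 2 * n * U / q * 1 * (2 * ρ) = U * (4 * n * θ) := by rw [hρ]; field_simp; ring
    nlinarith only [h4, h5, hθ1, hU0]

/-- Subsolutions above the obstacle are locally bounded by their weighted integrals: `u - h(t)` is
compared with multiples of the barrier `(1 - |x - x̄|²)^-n`, which blows up at the boundary of
the unit ball. At the scale of the distance to the boundary, `|u|` is small on average on an annulus
around the contact point, which forces the fractional Laplacian there to be nonnegative. -/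
theorem IsSub.exists_local_bound (hn : 0 < n) (hs : s ∈ Ioo (0 : ℝ) 1) :
    ∃ A : ℝ, 1 ≤ A ∧ ∀ (T : ℝ) (ψ : Euc n → ℝ) (u : ℝ → Euc n → ℝ) (xb : Euc n) (M : ℝ), 0 < M →
      ContinuousOn (fun p : ℝ × Euc n => u p.1 p.2) (Icc 0 T ×ˢ univ) →
      (∀ t ∈ Ioo 0 T, WeightedIntegrable s (u t)) → IsSub s T ψ u →
      (∀ t ∈ Ioo 0 T, ∫ y, |u t y| * wt s (xb - y) ≤ M) →
      (∀ x ∈ Metric.closedBall xb 1, u 0 x ≤ M) → (∀ x ∈ Metric.closedBall xb 1, ψ x ≤ M) →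
      ∀ t ∈ Ioo 0 T, u t xb ≤ A * M := by
  obtain ⟨C, hC, hCw⟩ := exists_inv_one_sub_pow_le n
  set N : ℝ := (n : ℝ) + 2 * s with hN
  set a : ℝ := annMass n s with ha
  have ha0 : 0 < a := annMass_pos hn hs.1
  have hnR : (1 : ℝ) ≤ n := by exact_mod_cast hn
  -- the ratio `θ` of the annulus to the distance to the boundary
  obtain ⟨θ, hθ0, hθ1, hθ2⟩ : ∃ θ : ℝ, 0 < θ ∧ 8 * (n : ℝ) * θ ≤ 1 ∧
      (n + 9 * C) * θ ^ 2 * sqMass n s 1 ≤ a / 4 := by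
    have h1 : Tendsto (fun θ : ℝ => 8 * (n : ℝ) * θ) (𝓝[>] 0) (𝓝 0) := by
      have : Continuous fun θ : ℝ => 8 * (n : ℝ) * θ := by fun_prop
      simpa using (this.tendsto 0).mono_left nhdsWithin_le_nhds
    have h2 : Tendsto (fun θ : ℝ => (n + 9 * C) * θ ^ 2 * sqMass n s 1) (𝓝[>] 0) (𝓝 0) := by
      have : Continuous fun θ : ℝ => (n + 9 * C) * θ ^ 2 * sqMass n s 1 := by fun_prop
      simpa using (this.tendsto 0).mono_left nhdsWithin_le_nhds
    obtain ⟨θ, ⟨h3, h4⟩, h5⟩ := (((h1.eventually_lt_const one_pos).and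
      (h2.eventually_lt_const (by positivity : 0 < a / 4))).and self_mem_nhdsWithin).exists
    exact ⟨θ, h5, h3.le, h4.le⟩
  have hθ8 : θ ≤ 1 / 8 := by nlinarith only [hθ1, hθ0, hnR]
  set A₀ : ℝ := 4 * 3 ^ N / (a * θ ^ n) with hA₀
  have hA₀0 : 0 < A₀ := by positivity
  refine ⟨max 1 A₀, le_max_left _ _, ?_⟩
  intro T ψ u xb M hM huc hui hu hmass hu0 hψ t₁ ht₁
  set A : ℝ := max 1 A₀ with hA
  have hA1 : 1 ≤ A := le_max_left _ _
  have hAM : M ≤ A * M := le_mul_of_one_le_left hM.le hA1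
  by_contra hcon
  rw [not_le] at hcon
  set T₁ : ℝ := (t₁ + T) / 2 with hT₁
  have hT₁T : T₁ < T := by have := ht₁.2; rw [hT₁]; linarith
  have htT₁ : t₁ < T₁ := by have := ht₁.2; rw [hT₁]; linarith
  have hT₁0 : 0 < T₁ := ht₁.1.trans htT₁
  set K := Icc 0 T₁ ×ˢ Metric.closedBall xb 1 with hK
  have hKc : IsCompact K := isCompact_Icc.prod (isCompact_closedBall _ _)
  have hucK : ContinuousOn (fun p : ℝ × Euc n => u p.1 p.2) K :=
    huc.mono (prod_mono (Icc_subset_Icc_right hT₁T.le) (subset_univ _))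
  obtain ⟨B, hB⟩ := hKc.exists_bound_of_continuousOn hucK
  obtain ⟨h, hhc, hh', hh0, hhT, hht⟩ := exists_time_penalty htT₁
    (by positivity : 0 < |B| + 1) (sub_pos.2 hcon)
  -- `u - h` is touched from above by a multiple of `Q ^ (-n)` where `(u - h) * Q ^ n` is maximal
  set Q : Euc n → ℝ := fun x => 1 - ‖x - xb‖ ^ 2 with hQ
  have hQ1 : ∀ x, Q x ≤ 1 := fun x => by simp only [hQ]; nlinarith [sq_nonneg ‖x - xb‖]
  have hQ0 : ∀ x ∈ Metric.closedBall xb 1, 0 ≤ Q x := by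
    intro x hx
    rw [mem_closedBall_iff_norm] at hx
    simp only [hQ]; nlinarith [norm_nonneg (x - xb)]
  set F : ℝ × Euc n → ℝ := fun p => (u p.1 p.2 - h p.1) * Q p.2 ^ n with hF
  have hFc : ContinuousOn F K := by
    have c1 := hhc.continuous
    have c2 : Continuous Q := by simp only [hQ]; fun_prop
    exact (hucK.sub (by fun_prop)).mul (by fun_prop)
  have hp₁ : ((t₁, xb) : ℝ × Euc n) ∈ K := ⟨⟨ht₁.1.le, htT₁.le⟩, by simp⟩
  obtain ⟨⟨t₀, x₀⟩, ⟨ht₀, hx₀⟩, hmax⟩ := hKc.exists_isMaxOn ⟨_, hp₁⟩ hFc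
  replace ht₀ : t₀ ∈ Icc 0 T₁ := ht₀
  replace hx₀ : x₀ ∈ Metric.closedBall xb 1 := hx₀
  have hFmax : ∀ t ∈ Icc 0 T₁, ∀ x ∈ Metric.closedBall xb 1,
      (u t x - h t) * Q x ^ n ≤ (u t₀ x₀ - h t₀) * Q x₀ ^ n := fun t ht x hx =>
    hmax (show (t, x) ∈ K from ⟨ht, hx⟩)
  set U : ℝ := u t₀ x₀ - h t₀ with hU
  set q : ℝ := Q x₀ with hq
  have hq0' : 0 ≤ q := hQ0 x₀ hx₀
  have hq1 : q ≤ 1 := hQ1 x₀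
  have hUq : A * M ≤ U * q ^ n := by
    have h1 := hFmax t₁ ⟨ht₁.1.le, htT₁.le⟩ xb (by simp)
    have h2 : Q xb = 1 := by simp [hQ]
    rw [h2, one_pow, mul_one] at h1
    linarith
  have hUq0 : 0 < U * q ^ n := by linarith
  have hq0 : 0 < q := by
    rcases eq_or_lt_of_le hq0' with h1 | h1
    · rw [← h1, zero_pow hn.ne', mul_zero] at hUq0
      exact absurd hUq0 (lt_irrefl 0)
    · exact h1
  have hqn : 0 < q ^ n := by positivity
  have hU0 : 0 < U := by
    by_contra hcc
    have := mul_nonpos_of_nonpos_of_nonneg (not_lt.1 hcc) hqn.le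
    linarith
  have hUAM : A * M ≤ U := hUq.trans (mul_le_of_le_one_right hU0.le (pow_le_one₀ hq0' hq1))
  have hxlt : ‖x₀ - xb‖ ^ 2 = 1 - q := by simp only [hq, hQ]; ring
  have hxle : ‖x₀ - xb‖ ≤ 1 := by rwa [mem_closedBall_iff_norm] at hx₀
  have hBu : ∀ x ∈ Metric.closedBall xb 1, ∀ t ∈ Icc 0 T₁, u t x ≤ |B| := fun x hx t ht =>
    (le_abs_self _).trans ((hB (t, x) ⟨ht, hx⟩).trans (le_abs_self B))
  have ht₀lt : t₀ < T₁ := by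
    rcases eq_or_lt_of_le ht₀.2 with h1 | h1
    · have h2 := hBu x₀ hx₀ t₀ ht₀
      rw [h1, hhT] at hU
      rw [h1] at h2
      linarith only [hU, h2, hU0]
    · exact h1
  have ht₀pos : 0 < t₀ := by
    rcases eq_or_lt_of_le ht₀.1 with h1 | h1
    · have h2 := hu0 x₀ hx₀
      have h3 := hh0 t₀
      have h4 := hh' 0
      -- the penalty `h` does not vanish at time zero since it is nonnegative and increasing
      have h5 : U ≤ M := by rw [hU, ← h1]; rw [← h1] at h3; linarith
      have h6 : U = M := le_antisymm h5 (hAM.trans hUAM)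
      have h7 : h 0 = 0 := by rw [← h1] at hU h3; linarith
      have h8 : IsLocalMin h 0 := Eventually.of_forall fun t => by rw [h7]; exact hh0 t
      exact absurd h8.deriv_eq_zero h4.ne'
    · exact h1
  have hψU : ψ x₀ < u t₀ x₀ := by
    have h2 := hψ x₀ hx₀
    have h3 : 0 < h t₀ := by
      rcases eq_or_lt_of_le (hh0 t₀) with h7 | h7
      · have h8 : IsLocalMin h t₀ := Eventually.of_forall fun t => by rw [← h7]; exact hh0 t
        exact absurd h8.deriv_eq_zero (hh' t₀).ne'
      · exact h7
    linarith
  set ρ : ℝ := θ * q with hρ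
  have hρ0 : 0 < ρ := by positivity
  have hρ1 : ρ ≤ 1 / 8 := by nlinarith only [hρ, hθ8, hq1, hθ0, hq0]
  set r : ℝ := min ρ (min t₀ (T₁ - t₀)) with hr
  have hr0 : 0 < r := by
    simp only [hr, lt_min_iff]; exact ⟨hρ0, ht₀pos, by linarith⟩
  have hrρ : r ≤ ρ := min_le_left _ _
  have hrt : r ≤ t₀ := (min_le_right _ _).trans (min_le_left _ _)
  have hrT : r ≤ T₁ - t₀ := (min_le_right _ _).trans (min_le_right _ _)
  set w : Euc n → ℝ := fun x => (q - Q x) / q with hw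
  have hwz : ∀ z, w (x₀ + z) = relDrop (x₀ - xb) q z := by
    intro z
    simp only [hw, hQ, relDrop]
    have e1 : x₀ + z - xb = (x₀ - xb) + z := by abel
    rw [e1, norm_add_sq_real, hxlt]
    congr 1; ring
  have hwhalf : ∀ z, ‖z‖ ≤ ρ → |w (x₀ + z)| ≤ 1 / 2 := by
    intro z hz
    rw [hwz]
    refine (abs_relDrop_le hq0 hxle (by linarith only [hz, hρ1])).trans ?_
    rw [div_le_iff₀ hq0]
    nlinarith only [hz, hρ, hθ8, hq0]
  -- a quadratic upper bound of the barrier `h + U * (1 - w) ^ (-n)`, smooth everywhere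
  set φ : ℝ × Euc n → ℝ := fun p => h p.1 + U * (1 + n * w p.2 + C * w p.2 ^ 2) with hφ
  have cw : ContDiff ℝ 2 w := by
    have : ContDiff ℝ 2 (fun x : Euc n => ‖x - xb‖ ^ 2) :=
      (contDiff_id.sub contDiff_const).norm_sq ℝ
    simp only [hw, hQ]; fun_prop
  have cφ : ContDiff ℝ 2 φ := by simp only [hφ]; fun_prop
  have hw0 : w x₀ = 0 := by simp [hw, hq]
  have hφ0 : φ (t₀, x₀) = u t₀ x₀ := by simp [hφ, hw0, hU]
  have hder : deriv (fun t => φ (t, x₀)) t₀ = deriv h t₀ := by simp [hφ]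
  have htouch : ∀ t ∈ Icc 0 T₁, ∀ z, ‖z‖ ≤ ρ → u t (x₀ + z) ≤ φ (t, x₀ + z) := by
    intro t ht z hz
    have h1 := hwhalf z hz
    have h2 := (abs_le.1 h1).2
    have hQw : Q (x₀ + z) = q * (1 - w (x₀ + z)) := by
      simp only [hw]; field_simp; ring
    have hQpos : 0 < Q (x₀ + z) := by rw [hQw]; exact mul_pos hq0 (by linarith)
    have hmem : x₀ + z ∈ Metric.closedBall xb 1 := by
      rw [mem_closedBall_iff_norm]
      have : ‖x₀ + z - xb‖ ^ 2 < 1 := by simp only [hQ] at hQpos; linarith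
      nlinarith only [this, norm_nonneg (x₀ + z - xb)]
    have h3 := hFmax t ht _ hmem
    have h4 : u t (x₀ + z) - h t ≤ U * ((1 - w (x₀ + z))⁻¹) ^ n := by
      have h5 : U * ((1 - w (x₀ + z))⁻¹) ^ n = U * q ^ n / Q (x₀ + z) ^ n := by
        rw [hQw, mul_pow, inv_pow]
        field_simp
      rw [h5, le_div_iff₀ (by positivity)]
      exact h3
    have h5 := mul_le_mul_of_nonneg_left (hCw _ h1) hU0.le
    simp only [hφ]; linarith
  have hmemt : ∀ t, |t - t₀| < r → t ∈ Icc 0 T₁ := by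
    intro t ht
    rw [abs_lt] at ht
    exact ⟨by linarith, by linarith⟩
  have hev := hu φ cφ t₀ x₀ r hr0 hrt (by linarith) hφ0 (fun t ht x hx => by
    have h1 := htouch t (hmemt t ht) (x - x₀) (by
      rw [mem_ball_iff_norm] at hx; linarith)
    simpa using h1) hψU (deriv h t₀) (hh' t₀)
  rw [hder] at hev
  obtain ⟨ε, hε1, hε⟩ := (hev.and (Ioo_mem_nhdsGT hρ0)).exists
  have ht₀' : t₀ ∈ Ioo 0 T := ⟨ht₀pos, ht₀lt.trans hT₁T⟩
  have kc : Continuous (fun y => φ (t₀, y)) := by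
    have := cφ.continuous
    fun_prop
  set f := glue x₀ r (fun y => φ (t₀, y)) (u t₀) with hf
  have hfW : WeightedIntegrable s f := weightedIntegrable_glue hs.1 kc (hui t₀ ht₀')
  have hf0 : f x₀ = u t₀ x₀ := by rw [hf, glue_self hr0, hφ0]
  have hfle : ∀ z, ‖z‖ ≤ ρ → f (x₀ + z) ≤ φ (t₀, x₀ + z) := by
    intro z hz
    rcases lt_or_ge ‖z‖ r with h1 | h1
    · rw [hf, glue_of_lt h1]
    · rw [hf, glue_of_le h1]; exact htouch t₀ ht₀ z hz
  have hffar : ∀ z, ρ < ‖z‖ → f (x₀ + z) = u t₀ (x₀ + z) := fun z hz => by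
    rw [hf, glue_of_le (hrρ.trans hz.le)]
  have hmain := truncFracLap_nonneg_of_contact hn hs hC hθ0 hθ1 hθ2
    ((mul_le_mul_of_nonneg_right (le_max_right _ _) hM.le).trans hUq) hU0 hq0 hq1 hfW
    (x₀ := x₀) hxle hε.1 hε.2 (fun z hz => by
      have h1 := hfle z hz
      rw [hf0, ← hwz]
      simp only [hφ] at h1
      linarith only [h1, hU]) (by rw [hf0]; linarith only [hh0 t₀, hU])
    (integral_abs_mul_tk_le hs.1 hfW (hui t₀ ht₀') hxle hρ0 (by linarith only [hρ1]) hffar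
      (hmass t₀ ht₀'))
  linarith only [hmain, hε1]

end LocalBound

/-! ### Mollification -/

/-- The mollification of `f` by the normalized bump function `φ`. -/
def moll {n : ℕ} (φ : ContDiffBump (0 : Euc n)) (f : Euc n → ℝ) (x : Euc n) : ℝ :=
  ∫ y, φ.normed volume y * f (x - y)

/-- The bump function of outer radius one. -/
def stdBump (n : ℕ) : ContDiffBump (0 : Euc n) := ⟨1 / 2, 1, by norm_num, by norm_num⟩

section Mollification

variable {n : ℕ} {s : ℝ} (φ : ContDiffBump (0 : Euc n))

lemma moll_eq_convolution (f : Euc n → ℝ) :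
    moll φ f = convolution (φ.normed volume) f (ContinuousLinearMap.lsmul ℝ ℝ) volume := by
  ext x; simp [moll, convolution]

lemma moll_eq' (f : Euc n → ℝ) (x : Euc n) :
    moll φ f x = ∫ y, φ.normed volume (x - y) * f y := by
  rw [moll, ← integral_sub_left_eq_self _ volume x]
  simp

lemma contDiff_moll {f : Euc n → ℝ} (hf : LocallyIntegrable f volume) {k : ℕ∞} :
    ContDiff ℝ k (moll φ f) := by
  rw [moll_eq_convolution]
  exact φ.hasCompactSupport_normed.contDiff_convolution_left _ φ.contDiff_normed hf

lemma normed_eq_zero {y : Euc n} (hy : φ.rOut ≤ ‖y‖) : φ.normed volume y = 0 := by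
  have h : y ∉ Function.support (φ.normed volume) := by
    rw [φ.support_normed_eq]; simpa using hy
  simpa using h

lemma integrable_moll_integrand {f : Euc n → ℝ} (hf : LocallyIntegrable f volume) (x : Euc n) :
    Integrable (fun y => φ.normed volume (x - y) * f y) := by
  have h1 : Continuous (fun y => φ.normed volume (x - y)) := by
    have := φ.continuous_normed (μ := volume); fun_prop
  have h2 : HasCompactSupport (fun y => φ.normed volume (x - y)) :=
    (φ.hasCompactSupport_normed (μ := volume)).comp_homeomorph (Homeomorph.subLeft x)
  simpa using hf.integrable_smul_left_of_hasCompactSupport h1 h2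

lemma integrable_moll_integrand' {f : Euc n → ℝ} (hf : LocallyIntegrable f volume) (x : Euc n) :
    Integrable (fun y => φ.normed volume y * f (x - y)) := by
  have := (integrable_moll_integrand φ hf x).comp_sub_left x
  simpa using this

lemma moll_mono {f g : Euc n → ℝ} (hf : LocallyIntegrable f volume)
    (hg : LocallyIntegrable g volume) {x : Euc n} (h : ∀ y, ‖x - y‖ ≤ φ.rOut → f y ≤ g y) :
    moll φ f x ≤ moll φ g x := by
  refine integral_mono (integrable_moll_integrand' φ hf x) (integrable_moll_integrand' φ hg x)
    fun y => ?_
  rcases le_or_gt φ.rOut ‖y‖ with hy | hy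
  · simp [normed_eq_zero φ hy]
  · exact mul_le_mul_of_nonneg_left (h _ (by simpa using hy.le)) (φ.nonneg_normed y)

lemma moll_const (c : ℝ) (x : Euc n) : moll φ (fun _ => c) x = c := by
  rw [moll, integral_mul_const, φ.integral_normed, one_mul]

lemma moll_le {f : Euc n → ℝ} (hf : LocallyIntegrable f volume) {x : Euc n} {c : ℝ}
    (h : ∀ y, ‖x - y‖ ≤ φ.rOut → f y ≤ c) : moll φ f x ≤ c := by
  have := moll_mono φ hf (locallyIntegrable_const c) h
  rwa [moll_const] at this

lemma le_moll {f : Euc n → ℝ} (hf : LocallyIntegrable f volume) {x : Euc n} {c : ℝ}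
    (h : ∀ y, ‖x - y‖ ≤ φ.rOut → c ≤ f y) : c ≤ moll φ f x := by
  have := moll_mono φ (locallyIntegrable_const c) hf h
  rwa [moll_const] at this

/-- The second differences of a `C²` function with compact support are `O(|z|²)`. -/
lemma exists_secondDiff_le {f : Euc n → ℝ} (hf : ContDiff ℝ 2 f) (hc : HasCompactSupport f) :
    ∃ K : ℝ, 0 ≤ K ∧ ∀ x z, |f (x + z) + f (x - z) - 2 * f x| ≤ K * ‖z‖ ^ 2 := by
  have h1 : ContDiff ℝ 1 (fderiv ℝ f) := hf.fderiv_right (by norm_num)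
  obtain ⟨K, hK⟩ := h1.lipschitzWith_of_hasCompactSupport (hc.fderiv ℝ) (by norm_num)
  refine ⟨2 * K, by positivity, fun x z => ?_⟩
  set g : ℝ → ℝ := fun t => f (x + t • z) + f (x - t • z) with hg
  have hd : ∀ t, HasDerivAt g (fderiv ℝ f (x + t • z) z - fderiv ℝ f (x - t • z) z) t := by
    intro t
    have hfd := hf.differentiable (by norm_num)
    have e1 : HasDerivAt (fun t : ℝ => x + t • z) z t := by
      simpa using ((hasDerivAt_id t).smul_const z).const_add x
    have e2 : HasDerivAt (fun t : ℝ => x - t • z) (-z) t := by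
      simpa using ((hasDerivAt_id t).smul_const z).const_sub x
    have e3 := ((hfd (x + t • z)).hasFDerivAt.comp_hasDerivAt t e1).add
      ((hfd (x - t • z)).hasFDerivAt.comp_hasDerivAt t e2)
    simp only [map_neg] at e3
    exact e3
  have hb : ∀ t ∈ Icc (0 : ℝ) 1,
      ‖fderiv ℝ f (x + t • z) z - fderiv ℝ f (x - t • z) z‖ ≤ 2 * K * ‖z‖ ^ 2 := by
    intro t ht
    rw [← sub_apply]
    refine (ContinuousLinearMap.le_opNorm _ _).trans ?_
    have h2 := hK.dist_le_mul (x + t • z) (x - t • z)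
    rw [dist_eq_norm, dist_eq_norm] at h2
    have h3 : ‖x + t • z - (x - t • z)‖ ≤ 2 * ‖z‖ := by
      have : x + t • z - (x - t • z) = (2 * t) • z := by module
      rw [this, norm_smul, Real.norm_of_nonneg (by linarith [ht.1])]
      nlinarith [ht.2, norm_nonneg z]
    have h4 := h2.trans (mul_le_mul_of_nonneg_left h3 K.2)
    calc _ ≤ K * (2 * ‖z‖) * ‖z‖ := mul_le_mul_of_nonneg_right h4 (norm_nonneg z)
      _ = _ := by ring
  have := (convex_Icc (0 : ℝ) 1).norm_image_sub_le_of_norm_hasDerivWithin_le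
    (fun t _ => (hd t).hasDerivWithinAt) hb (left_mem_Icc.2 zero_le_one)
    (right_mem_Icc.2 zero_le_one)
  simp only [hg, one_smul, zero_smul, add_zero, sub_zero, norm_one, mul_one,
    Real.norm_eq_abs] at this
  rwa [← two_mul] at this

/-- Mollification turns a function satisfying a Harnack inequality into one whose second
differences are controlled by the function itself. -/
lemma exists_secondDiff_moll_le (n : ℕ) : ∃ D : ℝ, 0 ≤ D ∧ ∀ (F : Euc n → ℝ) (H : ℝ),
    Continuous F → (∀ x, 0 ≤ F x) → (∀ x y, ‖x - y‖ ≤ 2 → F x ≤ H * F y) → ∀ x z, ‖z‖ ≤ 1 →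
      |moll (stdBump n) F (x + z) + moll (stdBump n) F (x - z) - 2 * moll (stdBump n) F x|
        ≤ D * H * F x * ‖z‖ ^ 2 := by
  set φ := stdBump n with hφ
  obtain ⟨K, hK0, hK⟩ := exists_secondDiff_le (φ.contDiff_normed (μ := volume) (n := 2))
    (φ.hasCompactSupport_normed (μ := volume))
  set V : ℝ := volume.real (Metric.closedBall (0 : Euc n) 2) with hV
  refine ⟨K * V, by positivity, fun F H hF hF0 hH x z hz => ?_⟩
  have hl := hF.locallyIntegrable (μ := volume)
  have i1 := integrable_moll_integrand φ hl (x + z)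
  have i2 := integrable_moll_integrand φ hl (x - z)
  have i3 := (integrable_moll_integrand φ hl x).const_mul 2
  rw [moll_eq', moll_eq', moll_eq', ← integral_const_mul, ← integral_add i1 i2,
    ← integral_sub (by exact i1.add i2) i3]
  set B := Metric.closedBall x 2 with hB
  have hBm : MeasurableSet B := Metric.isClosed_closedBall.measurableSet
  have iB : Integrable (indicator B fun _ => K * ‖z‖ ^ 2 * (H * F x)) := by
    rw [integrable_indicator_iff hBm]
    exact integrableOn_const measure_closedBall_lt_top.ne enorm_ne_top
  have hb : ‖∫ a, (φ.normed volume (x + z - a) * F a + φ.normed volume (x - z - a) * F a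
      - 2 * (φ.normed volume (x - a) * F a))‖ ≤ ∫ a, indicator B
        (fun _ => K * ‖z‖ ^ 2 * (H * F x)) a := by
    refine norm_integral_le_of_norm_le iB (Eventually.of_forall fun a => ?_)
    have e1 : φ.normed volume (x + z - a) * F a + φ.normed volume (x - z - a) * F a
        - 2 * (φ.normed volume (x - a) * F a) = (φ.normed volume (x - a + z)
          + φ.normed volume (x - a - z) - 2 * φ.normed volume (x - a)) * F a := by
      rw [show x + z - a = x - a + z by abel, show x - z - a = x - a - z by abel]; ring
    rw [e1]
    by_cases ha : a ∈ B
    · rw [indicator_of_mem ha, norm_mul, Real.norm_of_nonneg (hF0 a)]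
      refine mul_le_mul (hK _ _) (hH a x ?_) (hF0 a) (by positivity)
      rwa [hB, mem_closedBall_iff_norm] at ha
    · rw [indicator_of_notMem ha]
      have ha' : 2 < ‖x - a‖ := by
        rw [hB, mem_closedBall_iff_norm, not_le] at ha
        rwa [norm_sub_rev]
      have h1 : (1 : ℝ) ≤ ‖x - a + z‖ := by
        have := norm_sub_norm_le (x - a) (-z)
        rw [sub_neg_eq_add, norm_neg] at this; linarith
      have h2 : (1 : ℝ) ≤ ‖x - a - z‖ := by
        have := norm_sub_norm_le (x - a) z
        linarith
      rw [normed_eq_zero φ h1, normed_eq_zero φ h2,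
        normed_eq_zero φ (show (1 : ℝ) ≤ ‖x - a‖ by linarith)]
      simp
  rw [integral_indicator hBm, setIntegral_const, smul_eq_mul] at hb
  have e2 : volume.real B = V := by
    rw [hB, hV, measureReal_def, measureReal_def, Measure.addHaar_closedBall_center]
  rw [e2] at hb
  rw [Real.norm_eq_abs] at hb
  calc _ ≤ _ := hb
    _ = _ := by ring

end Mollification

/-! ### Weights built by convolution -/

/-- The convolution of `g` with the weight `wt s`. -/
def wtConv {n : ℕ} (s : ℝ) (g : Euc n → ℝ) (x : Euc n) : ℝ := ∫ y, g y * wt s (x - y)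

section Weights

variable {n : ℕ} {s : ℝ}

lemma wtConv_nonneg {g : Euc n → ℝ} (hg : ∀ x, 0 ≤ g x) (x : Euc n) : 0 ≤ wtConv s g x :=
  integral_nonneg fun y => mul_nonneg (hg y) (wt_pos _).le

lemma wtConv_mono (hs : 0 < s) {f g : Euc n → ℝ} (hf : WeightedIntegrable s f)
    (hg : WeightedIntegrable s g) (h : ∀ x, f x ≤ g x) (x : Euc n) :
    wtConv s f x ≤ wtConv s g x :=
  integral_mono (hf.integrable_mul_wt_sub hs x) (hg.integrable_mul_wt_sub hs x)
    fun y => mul_le_mul_of_nonneg_right (h y) (wt_pos _).le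

lemma wtConv_add (hs : 0 < s) {f g : Euc n → ℝ} (hf : WeightedIntegrable s f)
    (hg : WeightedIntegrable s g) (x : Euc n) :
    wtConv s (fun y => f y + g y) x = wtConv s f x + wtConv s g x := by
  unfold wtConv
  rw [← integral_add (hf.integrable_mul_wt_sub hs x) (hg.integrable_mul_wt_sub hs x)]
  congr 1; ext y; ring

lemma wtConv_const_mul (f : Euc n → ℝ) (c : ℝ) (x : Euc n) :
    wtConv s (fun y => c * f y) x = c * wtConv s f x := by
  unfold wtConv
  rw [← integral_const_mul]
  congr 1; ext y; ring

lemma wtConv_le_of_norm_sub_le (hs : 0 < s) {g : Euc n → ℝ} (hg : WeightedIntegrable s g)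
    (hg0 : ∀ x, 0 ≤ g x) {x y : Euc n} {c : ℝ} (hc : 0 ≤ c) (h : ‖x - y‖ ≤ c) :
    wtConv s g x ≤ (1 + c) ^ ((n : ℝ) + 2 * s) * wtConv s g y := by
  unfold wtConv
  rw [← integral_const_mul]
  refine integral_mono (hg.integrable_mul_wt_sub hs x)
    ((hg.integrable_mul_wt_sub hs y).const_mul _) fun z => ?_
  have := mul_le_mul_of_nonneg_left (wt_le_of_norm_sub_le hs (x := x - z) (y := y - z) hc
    (by simpa using h)) (hg0 z)
  simp only
  linarith

lemma continuous_wtConv (hs : 0 < s) {g : Euc n → ℝ} (hg : WeightedIntegrable s g) :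
    Continuous (wtConv s g) := by
  rw [continuous_iff_continuousAt]
  intro x₀
  refine continuousAt_of_dominated (bound := fun y =>
    2 ^ ((n : ℝ) + 2 * s) * (|g y| * wt s (x₀ - y))) ?_ ?_ ?_ ?_
  · exact Eventually.of_forall fun x => (hg.integrable_mul_wt_sub hs x).aestronglyMeasurable
  · filter_upwards [Metric.closedBall_mem_nhds x₀ one_pos] with x hx
    refine Eventually.of_forall fun y => ?_
    rw [norm_mul, Real.norm_of_nonneg (wt_pos _).le, Real.norm_eq_abs]
    have := mul_le_mul_of_nonneg_left (wt_le_of_norm_sub_le hs (x := x - y) (y := x₀ - y)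
      zero_le_one (by simpa [dist_eq_norm] using hx)) (abs_nonneg (g y))
    norm_num at this
    linarith
  · exact (hg.abs.integrable_mul_wt_sub hs x₀).const_mul _
  · refine Eventually.of_forall fun y => ?_
    have := continuous_wt (n := n) (s := s)
    fun_prop

/-- One of `a - b` and `b` has at least half the size of `a`. -/
lemma wt_mul_wt_le (hs : 0 < s) (a b : Euc n) :
    wt s a * wt s b ≤ 2 ^ ((n : ℝ) + 2 * s) * (wt s (a - b) * (wt s a + wt s b)) := by
  have ha := wt_pos (s := s) a
  have hb := wt_pos (s := s) b
  have hab : ‖a - b‖ ≤ ‖a‖ + ‖b‖ := norm_sub_le a b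
  have hp : (0 : ℝ) < 2 ^ ((n : ℝ) + 2 * s) := by positivity
  have hc := wt_pos (s := s) (a - b)
  rcases le_total ‖a‖ ‖b‖ with h | h
  · have h1 := wt_le_mul_wt hs two_pos (x := b) (y := a - b) (by linarith)
    have h2 := mul_le_mul_of_nonneg_left h1 ha.le
    have : 0 ≤ 2 ^ ((n : ℝ) + 2 * s) * (wt s (a - b) * wt s b) := by positivity
    linarith
  · have h1 := wt_le_mul_wt hs two_pos (x := a) (y := a - b) (by linarith)
    have h2 := mul_le_mul_of_nonneg_right h1 hb.le
    have : 0 ≤ 2 ^ ((n : ℝ) + 2 * s) * (wt s (a - b) * wt s a) := by positivity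
    linarith

/-- The weight is stable under convolution with itself, `wt * wt ≤ C wt`; here in the form that
`wtConv s g` is again integrable against the weight centered at any point. -/
lemma wtConv_wtConv_le (hs : 0 < s) {g : Euc n → ℝ} (hg : WeightedIntegrable s g)
    (hg0 : ∀ x, 0 ≤ g x) (x : Euc n) :
    Integrable (fun z => wtConv s g (x + z) * wt s z) ∧
    ∫ z, wtConv s g (x + z) * wt s z
      ≤ 2 ^ ((n : ℝ) + 2 * s) * (2 * ∫ z : Euc n, wt s z) * wtConv s g x := by
  set W : ℝ := ∫ z : Euc n, wt s z with hW
  have iw := integrable_wt (n := n) hs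
  have ig := hg.integrable_mul_wt_sub hs x
  set G : Euc n × Euc n → ℝ := fun p =>
    2 ^ ((n : ℝ) + 2 * s) * ((g p.2 * wt s (x - p.2)) * wt s (p.1 - p.2 + x)
      + (g p.2 * wt s (x - p.2)) * wt s p.1) with hG
  have iG1 : Integrable (fun p : Euc n × Euc n =>
      (g p.2 * wt s (x - p.2)) * wt s (p.1 - p.2 + x)) (volume.prod volume) :=
    ig.convolution_integrand (ContinuousLinearMap.mul ℝ ℝ) (iw.comp_add_right x)
  have iG2 : Integrable (fun p : Euc n × Euc n =>
      (g p.2 * wt s (x - p.2)) * wt s p.1) (volume.prod volume) := by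
    have := iw.mul_prod ig
    exact this.congr (Eventually.of_forall fun p => by ring)
  have iG : Integrable G (volume.prod volume) := (iG1.add iG2).const_mul _
  set F : Euc n × Euc n → ℝ := fun p => g p.2 * wt s (x + p.1 - p.2) * wt s p.1 with hF
  have hF0 : ∀ p, 0 ≤ F p := fun p =>
    mul_nonneg (mul_nonneg (hg0 _) (wt_pos _).le) (wt_pos _).le
  have hFG : ∀ p, F p ≤ G p := by
    intro p
    have h1 := mul_le_mul_of_nonneg_left (wt_mul_wt_le hs (x + p.1 - p.2) p.1) (hg0 p.2)
    rw [show x + p.1 - p.2 - p.1 = x - p.2 by abel] at h1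
    simp only [hF, hG]
    rw [show p.1 - p.2 + x = x + p.1 - p.2 by abel]
    linarith
  have mF : AEStronglyMeasurable F (volume.prod volume) := by
    have h1 : AEStronglyMeasurable (fun p : Euc n × Euc n => g p.2) (volume.prod volume) :=
      hg.aestronglyMeasurable.comp_snd
    have h2 := continuous_wt (n := n) (s := s)
    exact (h1.mul (by fun_prop : Continuous fun p : Euc n × Euc n =>
      wt s (x + p.1 - p.2)).aestronglyMeasurable).mul
      (by fun_prop : Continuous fun p : Euc n × Euc n => wt s p.1).aestronglyMeasurable
  have iF : Integrable F (volume.prod volume) :=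
    iG.mono' mF (Eventually.of_forall fun p => by
      rw [Real.norm_of_nonneg (hF0 p)]; exact hFG p)
  have e1 : ∀ z, wtConv s g (x + z) * wt s z = ∫ y, F (z, y) := by
    intro z
    rw [wtConv, ← integral_mul_const]
  simp only [e1]
  refine ⟨iF.integral_prod_left, ?_⟩
  rw [← integral_prod F iF]
  refine (integral_mono iF iG hFG).trans (le_of_eq ?_)
  have e2 : ∫ p, G p ∂(volume.prod volume)
      = 2 ^ ((n : ℝ) + 2 * s) * ((∫ p, (g p.2 * wt s (x - p.2)) * wt s (p.1 - p.2 + x)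
        ∂((volume : Measure (Euc n)).prod volume))
        + ∫ p, (g p.2 * wt s (x - p.2)) * wt s p.1 ∂((volume : Measure (Euc n)).prod volume)) := by
    rw [← integral_add iG1 iG2, ← integral_const_mul]
  have e3 : ∫ p, (g p.2 * wt s (x - p.2)) * wt s (p.1 - p.2 + x)
      ∂((volume : Measure (Euc n)).prod volume) = wtConv s g x * W := by
    rw [integral_prod_symm _ iG1]
    have : ∀ y : Euc n, ∫ z, g y * wt s (x - y) * wt s (z - y + x) = g y * wt s (x - y) * W := by
      intro y
      rw [integral_const_mul]
      congr 1
      have := integral_add_right_eq_self (μ := volume) (fun z : Euc n => wt s z) (x - y)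
      rw [hW, ← this]
      congr 1; ext z; congr 1; abel
    simp only [this]
    rw [integral_mul_const, wtConv]
  have e4 : ∫ p, (g p.2 * wt s (x - p.2)) * wt s p.1
      ∂((volume : Measure (Euc n)).prod volume) = wtConv s g x * W := by
    rw [integral_prod_symm _ iG2]
    simp only [integral_const_mul]
    rw [integral_mul_const, wtConv]
  rw [e2, e3, e4]; ring

lemma weightedIntegrable_wtConv (hs : 0 < s) {g : Euc n → ℝ} (hg : WeightedIntegrable s g)
    (hg0 : ∀ x, 0 ≤ g x) : WeightedIntegrable s (wtConv s g) := by
  rw [weightedIntegrable_iff]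
  simpa using (wtConv_wtConv_le hs hg hg0 0).1

/-- Values of `g` that persist on a unit ball are seen by `wtConv s g`. -/
lemma exists_le_wtConv (n : ℕ) (hs : 0 < s) :
    ∃ c : ℝ, 0 < c ∧ ∀ (g : Euc n → ℝ) (x : Euc n) (b : ℝ), WeightedIntegrable s g →
      (∀ x, 0 ≤ g x) → 0 ≤ b → (∀ y, ‖x - y‖ ≤ 1 → b ≤ g y) → c * b ≤ wtConv s g x := by
  set V : ℝ := volume.real (Metric.closedBall (0 : Euc n) 1) with hV
  have hV0 : 0 < V := by
    rw [hV, measureReal_def]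
    exact ENNReal.toReal_pos (Metric.measure_closedBall_pos _ _ one_pos).ne'
      measure_closedBall_lt_top.ne
  refine ⟨(2 ^ ((n : ℝ) + 2 * s))⁻¹ * V, by positivity, fun g x b hg hg0 hb h => ?_⟩
  have hBm : MeasurableSet (Metric.closedBall x 1) := Metric.isClosed_closedBall.measurableSet
  have iB : Integrable (indicator (Metric.closedBall x 1)
      fun _ => b * (2 ^ ((n : ℝ) + 2 * s))⁻¹) := by
    rw [integrable_indicator_iff hBm]
    exact integrableOn_const measure_closedBall_lt_top.ne enorm_ne_top
  have key := integral_mono iB (hg.integrable_mul_wt_sub hs x) (fun y => by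
    by_cases hy : y ∈ Metric.closedBall x 1
    · rw [indicator_of_mem hy]
      rw [mem_closedBall_iff_norm, norm_sub_rev] at hy
      refine mul_le_mul (h y hy) ?_ (by positivity) (hg0 y)
      unfold wt
      refine inv_anti₀ (by positivity) (Real.rpow_le_rpow (by positivity) (by linarith)
        (expo_pos hs).le)
    · rw [indicator_of_notMem hy]
      exact mul_nonneg (hg0 y) (wt_pos _).le)
  rw [integral_indicator hBm, setIntegral_const, smul_eq_mul, measureReal_def,
    Measure.addHaar_closedBall_center, ← measureReal_def, ← hV] at key
  unfold wtConv
  linarith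

lemma wtHarnack_wtConv (hs : 0 < s) {g : Euc n → ℝ} (hg : WeightedIntegrable s g)
    (hg0 : ∀ x, 0 ≤ g x) (x y : Euc n) (h : ‖x - y‖ ≤ 2) :
    wtConv s g x ≤ 3 ^ ((n : ℝ) + 2 * s) * wtConv s g y := by
  have := wtConv_le_of_norm_sub_le hs hg hg0 zero_le_two h
  norm_num at this
  exact this

/-- A nonnegative continuous function with a Harnack inequality is comparable to its
mollification. -/
lemma moll_comparable {F : Euc n → ℝ} {H : ℝ} (hF : Continuous F)
    (hH : ∀ x y, ‖x - y‖ ≤ 2 → F x ≤ H * F y) (x : Euc n) :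
    moll (stdBump n) F x ≤ H * F x ∧ F x ≤ H * moll (stdBump n) F x := by
  have hl := hF.locallyIntegrable (μ := volume)
  have h1 : (stdBump n).rOut = 1 := rfl
  refine ⟨moll_le _ hl fun y hy => hH y x ?_, ?_⟩
  · rw [norm_sub_rev]; linarith
  · have h2 : H * moll (stdBump n) F x = moll (stdBump n) (fun y => H * F y) x := by
      simp only [moll]
      rw [← integral_const_mul]
      congr 1; ext y; ring
    rw [h2]
    exact le_moll _ (hF.const_smul H |>.locallyIntegrable) fun y hy => hH x y (by linarith)

/-- The mollified convolutions `moll (wtConv s g)` of nonnegative weighted integrable functions are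
weights, with one constant for all `g`. -/
lemma exists_isWeight_moll_wtConv (hn : 0 < n) (hs : s ∈ Ioo (0 : ℝ) 1) :
    ∃ C : ℝ, 0 ≤ C ∧ ∀ g : Euc n → ℝ, WeightedIntegrable s g → (∀ x, 0 ≤ g x) →
      IsWeight s C (moll (stdBump n) (wtConv s g)) := by
  obtain ⟨D, hD0, hD⟩ := exists_secondDiff_moll_le n
  set H : ℝ := 3 ^ ((n : ℝ) + 2 * s) with hHdef
  have hH0 : 0 < H := by positivity
  set W : ℝ := ∫ z : Euc n, wt s z with hW
  have hW0 : 0 ≤ W := integral_nonneg fun z => (wt_pos z).le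
  set E : ℝ := 2 ^ ((n : ℝ) + 2 * s) with hE
  have hE0 : 0 < E := by positivity
  set S := sqMass n s 1 with hS
  have hS0 : 0 ≤ S := sqMass_nonneg 1
  refine ⟨(H * E * (E * (2 * W)) + D * H / 2 * S) * H, by positivity, fun g hg hg0 => ?_⟩
  set F := wtConv s g with hF
  have cF : Continuous F := continuous_wtConv hs.1 hg
  have hF0 : ∀ x, 0 ≤ F x := wtConv_nonneg hg0
  have hH : ∀ x y, ‖x - y‖ ≤ 2 → F x ≤ H * F y := wtHarnack_wtConv hs.1 hg hg0
  have hl := cF.locallyIntegrable (μ := volume)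
  set χ := moll (stdBump n) F with hχ
  have hcomp := moll_comparable cF hH
  have hχc : ContDiff ℝ 2 χ := contDiff_moll (stdBump n) hl (k := 2)
  have hχ0 : ∀ x, 0 ≤ χ x := fun x => le_moll _ hl fun y _ => hF0 y
  have hχW : WeightedIntegrable s χ := by
    refine ((weightedIntegrable_wtConv hs.1 hg hg0).const_mul H).mono
      hχc.continuous.aestronglyMeasurable fun x => ?_
    rw [abs_of_nonneg (hχ0 x)]
    exact (hcomp x).1.trans (le_abs_self _)
  refine ⟨hχc, hχ0, hχW, fun x ε hε => ?_⟩
  have h1 := truncFracLap_ge_of_secondDiff_le hn hs hχW hε.1 hε.2 (x := x) (D := D * H * F x)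
    (by have := hF0 x; positivity) (fun z hz => (le_abs_self _).trans (hD F H cF hF0 hH x z hz))
  have h2 : -(H * E * (E * (2 * W)) * F x) ≤ truncFracLap s χ x 1 := by
    obtain ⟨i1, h3⟩ := wtConv_wtConv_le hs.1 hg hg0 x
    rw [truncFracLap_eq]
    have h4 : ∫ z, -(H * E * (F (x + z) * wt s z)) ≤ ∫ z, (χ x - χ (x + z)) * tk s 1 z := by
      refine integral_mono (i1.const_mul _).neg (hχW.integrable_trunc hs.1 x one_pos) fun z => ?_
      have h5 := tk_le_wt hs.1 one_pos z
      norm_num at h5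
      have h6 := (hcomp (x + z)).1
      have h7 := mul_le_mul h6 h5 (tk_nonneg _ _) (mul_nonneg hH0.le (hF0 _))
      have h8 := mul_nonneg (hχ0 x) (tk_nonneg (s := s) 1 z)
      simp only
      linarith
    rw [integral_neg, integral_const_mul] at h4
    have h5 := mul_le_mul_of_nonneg_left h3 (mul_nonneg hH0.le hE0.le)
    linarith
  have h3 := mul_le_mul_of_nonneg_left (hcomp x).2
    (by positivity : 0 ≤ H * E * (E * (2 * W)) + D * H / 2 * S)
  linarith

/-- The truncated operators of the mollified weight centered at a point are bounded above by the
weight; for the adjoint of the Euler scheme this bounds the loss of mass. -/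
lemma exists_truncFracLap_moll_wt_le (hn : 0 < n) (hs : s ∈ Ioo (0 : ℝ) 1) :
    ∃ C : ℝ, 0 ≤ C ∧ ∀ xb x : Euc n, ∀ ε ∈ Ioc (0 : ℝ) 1,
      truncFracLap s (moll (stdBump n) fun y => wt s (xb - y)) x ε
        ≤ C * moll (stdBump n) (fun y => wt s (xb - y)) x := by
  obtain ⟨D, hD0, hD⟩ := exists_secondDiff_moll_le n
  set H : ℝ := 3 ^ ((n : ℝ) + 2 * s) with hHdef
  have hH0 : 0 < H := by positivity
  set S := sqMass n s 1 with hS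
  have hS0 : 0 ≤ S := sqMass_nonneg 1
  set K : ℝ := ∫ z : Euc n, tk s 1 z with hK
  have hK0 : 0 ≤ K := integral_nonneg fun z => tk_nonneg _ z
  refine ⟨K + D * H / 2 * S * H, by positivity, fun xb x ε hε => ?_⟩
  set F : Euc n → ℝ := fun y => wt s (xb - y) with hF
  have cF : Continuous F := by
    have := continuous_wt (n := n) (s := s)
    fun_prop
  have hF0 : ∀ x, 0 ≤ F x := fun x => (wt_pos _).le
  have hH : ∀ x y, ‖x - y‖ ≤ 2 → F x ≤ H * F y := by
    intro x y h
    have := wt_le_of_norm_sub_le hs.1 (x := xb - x) (y := xb - y) zero_le_two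
      (by rw [show xb - x - (xb - y) = -(x - y) by abel, norm_neg]; exact h)
    norm_num at this
    exact this
  have hl := cF.locallyIntegrable (μ := volume)
  set χ := moll (stdBump n) F with hχ
  have hcomp := moll_comparable cF hH
  have hχc : ContDiff ℝ 2 χ := contDiff_moll (stdBump n) hl (k := 2)
  have hχ0 : ∀ x, 0 ≤ χ x := fun x => le_moll _ hl fun y _ => hF0 y
  have hχ1 : ∀ x, χ x ≤ 1 := fun x => moll_le _ hl fun y _ => wt_le_one hs.1 _
  have hχW : WeightedIntegrable s χ :=
    weightedIntegrable_of_bound hs.1 hχc.continuous.aestronglyMeasurable (B := 1) fun x => by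
      rw [abs_of_nonneg (hχ0 x)]; exact hχ1 x
  have h1 := truncFracLap_le_of_le_secondDiff hn hs hχW hε.1 hε.2 (x := x) (D := D * H * F x)
    (by have := hF0 x; positivity)
    (fun z hz => (abs_le.1 (hD F H cF hF0 hH x z hz)).1)
  have h2 : truncFracLap s χ x 1 ≤ K * χ x := by
    rw [truncFracLap_eq, hK, ← integral_mul_const]
    refine integral_mono (hχW.integrable_trunc hs.1 x one_pos)
      ((integrable_tk hs.1 one_pos).mul_const _) fun z => ?_
    have := mul_nonneg (hχ0 (x + z)) (tk_nonneg (s := s) 1 z)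
    simp only
    linarith
  have h3 := mul_le_mul_of_nonneg_left (hcomp x).2 (by positivity : 0 ≤ D * H / 2 * S)
  linarith

end Weights

/-! ### Propagation of mass by supersolutions -/

/-- Bounded continuous profiles `0 ≤ f ≤ b` whose second differences are at least `-D |z|²`. -/
structure IsProfile {n : ℕ} (D b : ℝ) (f : Euc n → ℝ) : Prop where
  continuous : Continuous f
  nonneg : ∀ x, 0 ≤ f x
  le : ∀ x, f x ≤ b
  secondDiff : ∀ x z, -(D * ‖z‖ ^ 2) ≤ f (x + z) + f (x - z) - 2 * f x

/-- One explicit Euler step of length `τ` for the equation with truncated operator. -/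
def eulerStep {n : ℕ} (s η τ : ℝ) (f : Euc n → ℝ) (x : Euc n) : ℝ :=
  f x - τ * truncFracLap s f x η

section Mass

variable {n : ℕ} {s : ℝ}

lemma WeightedIntegrable.truncFracLap_eq_sub (hs : 0 < s) {f : Euc n → ℝ}
    (hf : WeightedIntegrable s f) (x : Euc n) {ε : ℝ} (hε : 0 < ε) :
    truncFracLap s f x ε = f x * (∫ z : Euc n, tk s ε z) - ∫ z, f (x + z) * tk s ε z := by
  rw [truncFracLap_eq, ← integral_const_mul, ← integral_sub ((integrable_tk hs hε).const_mul _)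
    ((hf.comp_add hs x).integrable_mul_tk hs hε)]
  congr 1; ext z; ring

lemma IsProfile.weightedIntegrable (hs : 0 < s) {D b : ℝ} {f : Euc n → ℝ}
    (hf : IsProfile D b f) : WeightedIntegrable s f :=
  weightedIntegrable_of_bound hs hf.continuous.aestronglyMeasurable (B := b) fun x => by
    rw [abs_of_nonneg (hf.nonneg x)]; exact hf.le x

lemma continuous_truncFracLap (hs : 0 < s) {f : Euc n → ℝ} (hf : Continuous f) {b : ℝ}
    (hb : ∀ x, |f x| ≤ b) {ε : ℝ} (hε : 0 < ε) : Continuous fun x => truncFracLap s f x ε := by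
  have hW := weightedIntegrable_of_bound hs hf.aestronglyMeasurable hb
  simp only [fun x => hW.truncFracLap_eq_sub hs x hε]
  refine (hf.mul continuous_const).sub (continuous_of_dominated
    (bound := fun z => b * tk s ε z) (fun x => ?_) (fun x => ?_) ?_ ?_)
  · exact ((hW.comp_add hs x).integrable_mul_tk hs hε).aestronglyMeasurable
  · refine Eventually.of_forall fun z => ?_
    rw [norm_mul, Real.norm_of_nonneg (tk_nonneg _ _)]
    exact mul_le_mul_of_nonneg_right (hb _) (tk_nonneg _ _)
  · exact (integrable_tk hs hε).const_mul _
  · exact Eventually.of_forall fun z => by fun_prop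

lemma abs_truncFracLap_le (hs : 0 < s) {f : Euc n → ℝ} {b : ℝ} (hb : ∀ x y, |f x - f y| ≤ b)
    {ε : ℝ} (hε : 0 < ε) (x : Euc n) :
    |truncFracLap s f x ε| ≤ b * ∫ z : Euc n, tk s ε z := by
  rw [truncFracLap_eq, ← integral_const_mul, ← Real.norm_eq_abs]
  refine norm_integral_le_of_norm_le ((integrable_tk hs hε).const_mul _)
    (Eventually.of_forall fun z => ?_)
  rw [norm_mul, Real.norm_of_nonneg (tk_nonneg _ _)]
  exact mul_le_mul_of_nonneg_right (hb _ _) (tk_nonneg _ _)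

/-- Under the stability condition on the step length, an Euler step is a positive average of
translates, so it preserves profiles. -/
lemma IsProfile.eulerStep (hs : 0 < s) {D b η τ : ℝ} {f : Euc n → ℝ} (hf : IsProfile D b f)
    (hη : 0 < η) (hτ : 0 ≤ τ) (hτη : τ * (∫ z : Euc n, tk s η z) ≤ 1) :
    IsProfile D b (eulerStep s η τ f) := by
  have hW := hf.weightedIntegrable hs
  set Λ : ℝ := ∫ z : Euc n, tk s η z with hΛ
  have hk := integrable_tk (n := n) hs hη
  have hform : ∀ x, _root_.eulerStep s η τ f x
      = (1 - τ * Λ) * f x + τ * ∫ z, f (x + z) * tk s η z := by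
    intro x
    rw [_root_.eulerStep, hW.truncFracLap_eq_sub hs x hη]; ring
  have hi : ∀ x, Integrable fun z => f (x + z) * tk s η z := fun x =>
    (hW.comp_add hs x).integrable_mul_tk hs hη
  have h1 : 0 ≤ 1 - τ * Λ := by linarith
  refine ⟨?_, fun x => ?_, fun x => ?_, fun x y => ?_⟩
  · exact hf.continuous.sub (continuous_const.mul (continuous_truncFracLap hs hf.continuous
      (fun x => by rw [abs_of_nonneg (hf.nonneg x)]; exact hf.le x) hη))
  · rw [hform]
    have h2 : 0 ≤ ∫ z, f (x + z) * tk s η z :=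
      integral_nonneg fun z => mul_nonneg (hf.nonneg _) (tk_nonneg _ _)
    have := hf.nonneg x
    positivity
  · rw [hform]
    have h2 : ∫ z, f (x + z) * tk s η z ≤ b * Λ := by
      rw [hΛ, ← integral_const_mul]
      exact integral_mono (hi x) (hk.const_mul _) fun z =>
        mul_le_mul_of_nonneg_right (hf.le _) (tk_nonneg _ _)
    have h3 := mul_le_mul_of_nonneg_left h2 hτ
    have h4 := mul_le_mul_of_nonneg_left (hf.le x) h1
    linarith
  · rw [hform, hform, hform]
    have h2 : -(D * ‖y‖ ^ 2) * Λ ≤ (∫ z, f (x + y + z) * tk s η z)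
        + (∫ z, f (x - y + z) * tk s η z) - 2 * ∫ z, f (x + z) * tk s η z := by
      rw [hΛ, ← integral_const_mul, ← integral_const_mul, ← integral_add (hi _) (hi _),
        ← integral_sub (by exact (hi _).add (hi _)) ((hi x).const_mul 2)]
      refine integral_mono (hk.const_mul _)
        (((hi _).add (hi _)).sub ((hi x).const_mul 2)) fun z => ?_
      have h3 := mul_le_mul_of_nonneg_right (hf.secondDiff (x + z) y) (tk_nonneg (s := s) η z)
      rw [show x + z + y = x + y + z by abel, show x + z - y = x - y + z by abel] at h3
      linarith
    have h3 := mul_le_mul_of_nonneg_left h2 hτ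
    have h4 := mul_le_mul_of_nonneg_left (hf.secondDiff x y) h1
    linarith

/-- A supersolution dominates, up to a small error, the Euler step of any profile that it dominates
at the initial time; `P` is a weight that makes up for the sign of the supersolution. -/
lemma IsSuper.eulerStep_le (hn : 0 < n) (hs : s ∈ Ioo (0 : ℝ) 1) {C Cχ : ℝ} {P χ ψ : Euc n → ℝ}
    {v : ℝ → Euc n → ℝ} {τ η D b c e : ℝ}
    (hP : IsWeight s C P) (hCχ : 0 ≤ Cχ) (hχ : IsWeight s Cχ χ)
    (hχt : Tendsto χ (cocompact (Euc n)) atTop)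
    (hvc : ContinuousOn (fun p : ℝ × Euc n => v p.1 p.2) (Icc 0 τ ×ˢ univ))
    (hψ : Continuous ψ) (hvi : ∀ t ∈ Ioo 0 τ, WeightedIntegrable s (v t))
    (hv : IsSuper s τ v) (hvψ : ∀ t ∈ Icc 0 τ, ∀ x, ψ x ≤ v t x)
    (hvb : ∀ α > 0, ∃ B, ∀ t ∈ Icc 0 τ, ∀ x, -(α * χ x + B) ≤ v t x)
    {f : Euc n → ℝ} (hf : IsProfile D b f) (hτ : 0 ≤ τ) (hη : 0 < η) (hD : 0 ≤ D) (hc : 0 ≤ c)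
    (he : 0 ≤ e) (hτη : τ * (∫ z : Euc n, tk s η z) ≤ 1)
    (h0 : ∀ x, f x - c * P x - e ≤ v 0 x) (x : Euc n) :
    eulerStep s η τ f x - c * Real.exp (C * τ) * P x
      - (e + τ * (D / 2 * sqMass n s η + 2 * τ * (∫ z : Euc n, tk s η z) ^ 2 * b)) ≤ v τ x := by
  set Λ : ℝ := ∫ z : Euc n, tk s η z with hΛ
  have hΛ0 : 0 ≤ Λ := integral_nonneg fun z => tk_nonneg _ z
  have hb0 : 0 ≤ b := (hf.nonneg 0).trans (hf.le 0)
  set err : ℝ := D / 2 * sqMass n s η + 2 * τ * Λ ^ 2 * b with herr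
  have herr0 : 0 ≤ err := by
    have := sqMass_nonneg (n := n) (s := s) η
    positivity
  have hfW := hf.weightedIntegrable hs.1
  have hprof : ∀ t ∈ Icc 0 τ, IsProfile D b (eulerStep s η t f) := fun t ht =>
    hf.eulerStep hs.1 hη ht.1 ((mul_le_mul_of_nonneg_right ht.2 hΛ0).trans hτη)
  set tr : Euc n → ℝ := fun x => truncFracLap s f x η with htr
  have hosc : ∀ x y, |f x - f y| ≤ b := fun x y => by
    rw [abs_le]
    exact ⟨by linarith [hf.nonneg x, hf.le y], by linarith [hf.nonneg y, hf.le x]⟩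
  have htrb : ∀ x, |tr x| ≤ b * Λ := abs_truncFracLap_le hs.1 hosc hη
  have htrc : Continuous tr := continuous_truncFracLap hs.1 hf.continuous
    (fun x => by rw [abs_of_nonneg (hf.nonneg x)]; exact hf.le x) hη
  have htrW : WeightedIntegrable s tr :=
    weightedIntegrable_of_bound hs.1 htrc.aestronglyMeasurable htrb
  -- the Euler step as a function of its length, lowered by `P` and by a linear error
  set Y : ℝ → Euc n → ℝ := fun t x =>
    (eulerStep s η t f x + (-(c * Real.exp (C * t))) * P x) + -(e + t * err) with hY
  have hYW : ∀ t ∈ Ioo 0 τ, WeightedIntegrable s (Y t) := fun t ht =>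
    (((hprof t (Ioo_subset_Icc_self ht)).weightedIntegrable hs.1).add
      (hP.weightedIntegrable.const_mul _)).add (weightedIntegrable_const hs.1 _)
  have hYd : ∀ t x, HasDerivAt (fun t => Y t x)
      (-(tr x) + -(c * (Real.exp (C * t) * (C * 1))) * P x + -err) t := by
    intro t x
    have h1 : HasDerivAt (fun t : ℝ => f x - t * tr x) (-(tr x)) t := by
      simpa using ((hasDerivAt_id t).mul_const (tr x)).const_sub (f x)
    have h2 : HasDerivAt (fun t : ℝ => -(c * Real.exp (C * t)) * P x)
        (-(c * (Real.exp (C * t) * (C * 1))) * P x) t :=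
      (((((hasDerivAt_id t).const_mul C).exp).const_mul c).neg).mul_const _
    have h3 : HasDerivAt (fun t : ℝ => -(e + t * err)) (-err) t := by
      have := (((hasDerivAt_id t).mul_const err).const_add e).neg
      rwa [one_mul] at this
    exact (h1.add h2).add h3
  have hYsub : IsSub s τ ψ Y := by
    refine isSub_of_forall hs.1 hYW (fun t _ x => (hYd t x).differentiableAt) ?_
    intro t ht x a ha
    rw [(hYd t x).deriv]
    filter_upwards [Ioc_mem_nhdsGT (lt_min hη one_pos)] with ε hε
    have hε0 : 0 < ε := hε.1
    have hpt := hprof t (Ioo_subset_Icc_self ht)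
    have hptW := hpt.weightedIntegrable hs.1
    have e1 : truncFracLap s (Y t) x ε = truncFracLap s (eulerStep s η t f) x ε
        + -(c * Real.exp (C * t)) * truncFracLap s P x ε := by
      simp only [hY]
      rw [truncFracLap_add_const, truncFracLap_add hs.1 hptW (hP.weightedIntegrable.const_mul _) x
        hε0, truncFracLap_const_mul]
    have e2 := truncFracLap_le_of_le_secondDiff hn hs hptW (x := x) hε0
      (hε.2.trans (min_le_left _ _)) hD (fun z _ => hpt.secondDiff x z)
    have e3 : truncFracLap s (eulerStep s η t f) x η = tr x + (-t) * truncFracLap s tr x η := by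
      have : eulerStep s η t f = fun y => f y + (-t) * tr y := by
        ext y; simp only [eulerStep, htr]; ring
      rw [this, truncFracLap_add hs.1 hfW (htrW.const_mul _) x hη, truncFracLap_const_mul]
    have e4 : |truncFracLap s tr x η| ≤ 2 * (b * Λ) * Λ :=
      abs_truncFracLap_le hs.1 (fun y z => by
        have h1 := abs_le.1 (htrb y)
        have h2 := abs_le.1 (htrb z)
        rw [abs_le]; exact ⟨by linarith, by linarith⟩) hη x
    have e5 : (-t) * truncFracLap s tr x η ≤ 2 * τ * Λ ^ 2 * b := by
      have h1 := (abs_le.1 e4).1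
      have h2 : t * (2 * (b * Λ) * Λ) ≤ τ * (2 * (b * Λ) * Λ) :=
        mul_le_mul_of_nonneg_right ht.2.le (by positivity)
      have h3 := mul_le_mul_of_nonneg_left h1 ht.1.le
      linarith
    have e6 := mul_le_mul_of_nonneg_left (hP.trunc x ε ⟨hε0, hε.2.trans (min_le_right _ _)⟩)
      (mul_nonneg hc (Real.exp_pos (C * t)).le)
    rw [e1]
    linarith
  have hYc : ContinuousOn (fun p : ℝ × Euc n => Y p.1 p.2) (Icc 0 τ ×ˢ univ) := by
    have c1 := hf.continuous
    have c2 := hP.contDiff.continuous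
    have : Continuous fun p : ℝ × Euc n => ((f p.2 - p.1 * tr p.2)
      + (-(c * Real.exp (C * p.1))) * P p.2) + -(e + p.1 * err) := by fun_prop
    exact this.continuousOn
  have key := hYsub.le_isSuper hn hs hCχ hχ hχt hYc hvc hψ hYW hvi hv hvψ
    (fun x => by
      have := h0 x
      simp only [hY, eulerStep, mul_zero, Real.exp_zero, zero_mul, sub_zero, mul_one, add_zero]
      linarith)
    (fun α hα => ⟨b, fun t ht x => by
      have h1 := (hprof t ht).le x
      have h2 := mul_nonneg (mul_nonneg hc (Real.exp_pos (C * t)).le) (hP.nonneg x)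
      have h3 := mul_nonneg hα.le (hχ.nonneg x)
      have h4 := mul_nonneg ht.1 herr0
      simp only [hY]; linarith⟩) hvb (right_mem_Icc.2 hτ) x
  simp only [hY] at key
  linarith

end Mass

section MassPropagation

variable {n : ℕ} {s T : ℝ}

/-- Truncated fractional Laplacians are symmetric. -/
lemma integral_mul_truncFracLap_comm (hs : 0 < s) {f k : Euc n → ℝ} (hf : Continuous f) {b : ℝ}
    (hb : ∀ x, |f x| ≤ b) (hk : Continuous k) (hki : Integrable k) {c : ℝ} (hkb : ∀ x, |k x| ≤ c)
    {η : ℝ} (hη : 0 < η) :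
    ∫ x, k x * truncFracLap s f x η = ∫ x, f x * truncFracLap s k x η := by
  have hfW := weightedIntegrable_of_bound hs hf.aestronglyMeasurable hb
  have hkW := weightedIntegrable_of_bound hs hk.aestronglyMeasurable hkb
  have ht := integrable_tk (n := n) hs hη
  have hb0 : 0 ≤ b := (abs_nonneg _).trans (hb 0)
  have i1 : Integrable (fun p : Euc n × Euc n => k p.1 * f (p.1 + p.2) * tk s η p.2)
      (volume.prod volume) := by
    refine ((hki.mul_prod ht).const_mul b).mono ?_ (Eventually.of_forall fun p => ?_)
    · exact ((by fun_prop : Continuous fun p : Euc n × Euc n =>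
        k p.1 * f (p.1 + p.2)).measurable.mul
        ((measurable_tk η).comp measurable_snd)).aestronglyMeasurable
    · rw [norm_mul, norm_mul, norm_mul, norm_mul, Real.norm_of_nonneg hb0]
      have h1 := mul_le_mul_of_nonneg_right (hb (p.1 + p.2))
        (mul_nonneg (norm_nonneg (k p.1)) (norm_nonneg (tk s η p.2)))
      rw [Real.norm_eq_abs (f _)]
      linarith
  have i2 : Integrable (fun p : Euc n × Euc n => f p.1 * k (p.1 + p.2) * tk s η p.2)
      (volume.prod volume) := by
    have h2 : Integrable (fun p : Euc n × Euc n => tk s η p.2 * k (p.1 + p.2))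
        (volume.prod volume) := by
      have := ht.comp_neg.convolution_integrand (ContinuousLinearMap.mul ℝ ℝ) hki
      have h3 : MeasurePreserving (fun p : Euc n × Euc n => (p.1, -p.2))
          (volume.prod volume) (volume.prod volume) :=
        (MeasurePreserving.id volume).prod (Measure.measurePreserving_neg volume)
      have h4 := h3.integrable_comp_of_integrable this
      refine h4.congr (Eventually.of_forall fun p => ?_)
      simp
    refine (h2.const_mul b).mono ?_ (Eventually.of_forall fun p => ?_)
    · exact ((by fun_prop : Continuous fun p : Euc n × Euc n =>
        f p.1 * k (p.1 + p.2)).measurable.mul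
        ((measurable_tk η).comp measurable_snd)).aestronglyMeasurable
    · rw [norm_mul, norm_mul, norm_mul, norm_mul, Real.norm_of_nonneg hb0]
      have h1 := mul_le_mul_of_nonneg_right (hb p.1)
        (mul_nonneg (norm_nonneg (k (p.1 + p.2))) (norm_nonneg (tk s η p.2)))
      rw [Real.norm_eq_abs (f _)]
      linarith
  have i3 : Integrable (fun x => k x * f x * ∫ z : Euc n, tk s η z) := by
    refine Integrable.mul_const ?_ _
    exact hki.mul_bdd (c := b) hf.aestronglyMeasurable
      (Eventually.of_forall fun x => by rw [Real.norm_eq_abs]; exact hb x)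
  have e1 : ∀ x, k x * truncFracLap s f x η = k x * f x * (∫ z : Euc n, tk s η z)
      - ∫ z, k x * f (x + z) * tk s η z := by
    intro x
    have : ∫ z, k x * f (x + z) * tk s η z = k x * ∫ z, f (x + z) * tk s η z := by
      rw [← integral_const_mul]; congr 1; ext z; ring
    rw [hfW.truncFracLap_eq_sub hs x hη, this]; ring
  have e2 : ∀ x, f x * truncFracLap s k x η = k x * f x * (∫ z : Euc n, tk s η z)
      - ∫ z, f x * k (x + z) * tk s η z := by
    intro x
    have : ∫ z, f x * k (x + z) * tk s η z = f x * ∫ z, k (x + z) * tk s η z := by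
      rw [← integral_const_mul]; congr 1; ext z; ring
    rw [hkW.truncFracLap_eq_sub hs x hη, this]; ring
  have e3 : ∫ x, ∫ z, k x * f (x + z) * tk s η z = ∫ x, ∫ z, f x * k (x + z) * tk s η z := by
    rw [integral_integral_swap i1]
    have h1 : ∀ z : Euc n, ∫ x, k x * f (x + z) * tk s η z
        = ∫ x, f x * k (x + -z) * tk s η (-z) := by
      intro z
      rw [← integral_add_right_eq_self (fun x => f x * k (x + -z) * tk s η (-z)) z]
      congr 1; ext x
      rw [tk_neg, add_neg_cancel_right]; ring
    simp only [h1]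
    rw [integral_neg_eq_self (fun z => ∫ x, f x * k (x + z) * tk s η z) volume]
    exact (integral_integral_swap i2).symm
  simp only [e1, e2]
  rw [integral_sub i3 i1.integral_prod_left, integral_sub i3 i2.integral_prod_left, e3]

/-- Profiles approximate nonnegative continuous functions from below on bounded sets. -/
lemma exists_profile_le {F : Euc n → ℝ} (hF : Continuous F) (hF0 : ∀ x, 0 ≤ F x) (R : ℝ)
    {δ : ℝ} (hδ : 0 < δ) : ∃ (D b : ℝ) (g : Euc n → ℝ), 0 ≤ D ∧ IsProfile D b g ∧
      (∀ x, g x ≤ F x) ∧ ∀ x, ‖x‖ ≤ R → F x - δ ≤ g x := by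
  set c : Euc n → ℝ := fun x => max 0 (min 1 (R + 1 - ‖x‖)) with hc
  have hc0 : ∀ x, 0 ≤ c x := fun x => le_max_left _ _
  have hc1 : ∀ x, c x ≤ 1 := fun x => max_le zero_le_one (min_le_left _ _)
  have hcR : ∀ x, ‖x‖ ≤ R → c x = 1 := fun x hx => by
    simp only [hc]; rw [min_eq_left (by linarith), max_eq_right zero_le_one]
  have hcc : Continuous c := by simp only [hc]; fun_prop
  have hcs : ∀ x, R + 1 < ‖x‖ → c x = 0 := fun x hx => by
    simp only [hc]; rw [max_eq_left]; exact (min_le_right _ _).trans (by linarith)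
  set G : Euc n → ℝ := fun x => F x * c x with hG
  have hGc : Continuous G := hF.mul hcc
  have hG0 : ∀ x, 0 ≤ G x := fun x => mul_nonneg (hF0 x) (hc0 x)
  have hGF : ∀ x, G x ≤ F x := fun x => mul_le_of_le_one_right (hF0 x) (hc1 x)
  have hGs : HasCompactSupport G :=
    HasCompactSupport.intro (isCompact_closedBall (0 : Euc n) (R + 1)) fun x hx => by
      simp only [hG]
      rw [hcs x (by simpa using hx), mul_zero]
  have hGu : UniformContinuous G := hGs.uniformContinuous_of_continuous hGc
  obtain ⟨r, hr0, hr⟩ := Metric.uniformContinuous_iff.1 hGu (δ / 2) (half_pos hδ)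
  set f : Euc n → ℝ := fun x => max (G x - δ / 2) 0 with hf
  have hfc : Continuous f := by simp only [hf]; fun_prop
  have hfs : HasCompactSupport f :=
    HasCompactSupport.intro (isCompact_closedBall (0 : Euc n) (R + 1)) fun x hx => by
      simp only [hf, hG]
      rw [hcs x (by simpa using hx), mul_zero]
      exact max_eq_right (by linarith)
  have hf0 : ∀ x, 0 ≤ f x := fun x => le_max_right _ _
  have hl := hfc.locallyIntegrable (μ := volume)
  set φ : ContDiffBump (0 : Euc n) := ⟨r / 4, r / 2, by linarith, by linarith⟩ with hφ
  have hφr : φ.rOut = r / 2 := rfl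
  have hclose : ∀ x y, ‖x - y‖ ≤ φ.rOut → |G x - G y| < δ / 2 := fun x y h => by
    rw [← Real.dist_eq]
    exact hr (by rw [dist_eq_norm]; linarith)
  obtain ⟨b, hb⟩ := hfc.bounded_above_of_compact_support hfs
  have hmc : HasCompactSupport (moll φ f) := by
    rw [moll_eq_convolution]
    exact (φ.hasCompactSupport_normed (μ := volume)).convolution _ hfs
  obtain ⟨K, hK0, hK⟩ := exists_secondDiff_le (contDiff_moll φ hl (k := 2)) hmc
  refine ⟨K, b, moll φ f, hK0, ⟨(contDiff_moll φ hl (k := 2)).continuous, fun x => ?_, fun x => ?_,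
    fun x z => (abs_le.1 (hK x z)).1⟩, fun x => ?_, fun x hx => ?_⟩
  · exact le_moll φ hl fun y _ => hf0 y
  · exact moll_le φ hl fun y _ => (le_abs_self _).trans (hb y)
  · refine moll_le φ hl fun y hy => ?_
    have := abs_lt.1 (hclose x y hy)
    exact max_le (by linarith [hGF x]) (hF0 x)
  · refine le_moll φ hl fun y hy => ?_
    have := abs_lt.1 (hclose x y hy)
    refine le_trans ?_ (le_max_left _ _)
    have h1 : G x = F x := by simp only [hG]; rw [hcR x hx, mul_one]
    linarith

end MassPropagation

section MassPropagation

variable {n : ℕ} {s T : ℝ}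

lemma IsSuper.shift_time {v : ℝ → Euc n → ℝ} (hv : IsSuper s T v) {δ τ : ℝ} (hδ : 0 ≤ δ)
    (hτ : δ + τ ≤ T) : IsSuper s τ (fun t x => v (t + δ) x) := by
  have := (hv.shift hδ 0 0).mono_time (T' := τ) (by linarith)
  simpa using this

lemma continuousOn_shift {v : ℝ → Euc n → ℝ}
    (hv : ContinuousOn (fun p : ℝ × Euc n => v p.1 p.2) (Icc 0 T ×ˢ univ)) {δ τ : ℝ} (hδ : 0 ≤ δ)
    (hτ : δ + τ ≤ T) (h : Euc n) :
    ContinuousOn (fun p : ℝ × Euc n => v (p.1 + δ) (p.2 + h)) (Icc 0 τ ×ˢ univ) :=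
  hv.comp (f := fun p : ℝ × Euc n => (p.1 + δ, p.2 + h)) (by fun_prop)
    fun p hp => ⟨⟨by linarith [hp.1.1], by linarith [hp.1.2]⟩, mem_univ _⟩

/-- Supersolutions dominate the iterated Euler scheme. -/
lemma IsSuper.iterate_eulerStep_le (hn : 0 < n) (hs : s ∈ Ioo (0 : ℝ) 1) {C Cχ : ℝ}
    {P χ ψ : Euc n → ℝ} {v : ℝ → Euc n → ℝ} {τ η D b : ℝ}
    (hP : IsWeight s C P) (hCχ : 0 ≤ Cχ) (hχ : IsWeight s Cχ χ)
    (hχt : Tendsto χ (cocompact (Euc n)) atTop)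
    (hvc : ContinuousOn (fun p : ℝ × Euc n => v p.1 p.2) (Icc 0 T ×ˢ univ))
    (hψ : Continuous ψ) (hvi : ∀ t ∈ Icc 0 T, WeightedIntegrable s (v t))
    (hv : IsSuper s T v) (hvψ : ∀ t ∈ Icc 0 T, ∀ x, ψ x ≤ v t x)
    (hvb : ∀ α > 0, ∃ B, ∀ t ∈ Icc 0 T, ∀ x, -(α * χ x + B) ≤ v t x)
    {f : Euc n → ℝ} (hf : IsProfile D b f) (hτ : 0 ≤ τ) (hη : 0 < η) (hD : 0 ≤ D)
    (hτη : τ * (∫ z : Euc n, tk s η z) ≤ 1)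
    (h0 : ∀ x, f x - P x ≤ v 0 x) (j : ℕ) (hj : j * τ ≤ T) :
    IsProfile D b ((eulerStep s η τ)^[j] f) ∧ ∀ x, (eulerStep s η τ)^[j] f x
      - Real.exp (C * (j * τ)) * P x
      - (j * τ) * (D / 2 * sqMass n s η + 2 * τ * (∫ z : Euc n, tk s η z) ^ 2 * b)
        ≤ v (j * τ) x := by
  set err : ℝ := D / 2 * sqMass n s η + 2 * τ * (∫ z : Euc n, tk s η z) ^ 2 * b with herr
  have hb0 : 0 ≤ b := (hf.nonneg 0).trans (hf.le 0)
  have herr0 : 0 ≤ err := by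
    have := sqMass_nonneg (n := n) (s := s) η
    positivity
  induction j with
  | zero => exact ⟨hf, fun x => by simpa using h0 x⟩
  | succ j ih =>
    push_cast at hj ⊢
    have hjτ : 0 ≤ j * τ := by positivity
    obtain ⟨ih1, ih2⟩ := ih (by linarith)
    rw [Function.iterate_succ_apply']
    refine ⟨ih1.eulerStep hs.1 hη hτ hτη, fun x => ?_⟩
    have hmem : ∀ t ∈ Icc 0 τ, t + j * τ ∈ Icc 0 T := fun t ht =>
      ⟨by linarith [ht.1], by linarith [ht.2]⟩
    have key := IsSuper.eulerStep_le hn hs (v := fun t x => v (t + j * τ) x) hP hCχ hχ hχt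
      (by simpa using continuousOn_shift hvc hjτ (by linarith : j * τ + τ ≤ T) 0) hψ
      (fun t ht => hvi _ (hmem t (Ioo_subset_Icc_self ht)))
      (hv.shift_time hjτ (by linarith)) (fun t ht => hvψ _ (hmem t ht))
      (fun α hα => by
        obtain ⟨B, hB⟩ := hvb α hα
        exact ⟨B, fun t ht => hB _ (hmem t ht)⟩) ih1 hτ hη hD
      (Real.exp_pos (C * (j * τ))).le (mul_nonneg hjτ herr0) hτη
      (fun x => by rw [zero_add]; exact ih2 x) x
    rw [← Real.exp_add, ← herr] at key
    rw [show τ + j * τ = (j + 1) * τ by ring,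
      show C * (j * τ) + C * τ = C * ((j + 1) * τ) by ring] at key
    linarith

/-- Supersolutions bounded below by `-P` cannot lose mass faster than exponentially:
their weighted integral at time zero is controlled by the one at the final time. The mass at time
zero is transported by an Euler scheme whose adjoint acts on the smoothed weight. -/
lemma exists_mass_initial_le (hn : 0 < n) (hs : s ∈ Ioo (0 : ℝ) 1) :
    ∃ C' : ℝ, 0 ≤ C' ∧ ∀ (T C Cχ : ℝ) (P χ ψ : Euc n → ℝ) (v : ℝ → Euc n → ℝ), 0 ≤ T →
      IsWeight s C P → 0 ≤ Cχ → IsWeight s Cχ χ → Tendsto χ (cocompact (Euc n)) atTop →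
      ContinuousOn (fun p : ℝ × Euc n => v p.1 p.2) (Icc 0 T ×ˢ univ) → Continuous ψ →
      (∀ t ∈ Icc 0 T, WeightedIntegrable s (v t)) → IsSuper s T v →
      (∀ t ∈ Icc 0 T, ∀ x, ψ x ≤ v t x) →
      (∀ α > 0, ∃ B, ∀ t ∈ Icc 0 T, ∀ x, -(α * χ x + B) ≤ v t x) →
      (∀ x, 0 ≤ v 0 x + P x) → ∀ xb,
        ∫ x, moll (stdBump n) (fun y => wt s (xb - y)) x * (v 0 x + P x)
        ≤ Real.exp (C' * T) * ∫ x, moll (stdBump n) (fun y => wt s (xb - y)) x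
          * (v T x + Real.exp (C * T) * P x) := by
  obtain ⟨C', hC'0, hC'⟩ := exists_truncFracLap_moll_wt_le hn hs
  refine ⟨C', hC'0, ?_⟩
  intro T C Cχ P χ ψ v hT hP hCχ hχ hχt hvc hψ hvi hv hvψ hvb hv0 xb
  have h0T : (0 : ℝ) ∈ Icc 0 T := ⟨le_rfl, hT⟩
  have hTT : T ∈ Icc 0 T := ⟨hT, le_rfl⟩
  set F : Euc n → ℝ := fun y => wt s (xb - y) with hF
  have cF : Continuous F := by
    have := continuous_wt (n := n) (s := s)
    fun_prop
  have hl := cF.locallyIntegrable (μ := volume)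
  set k := moll (stdBump n) F with hk
  have hkc : Continuous k := (contDiff_moll (stdBump n) hl (k := 2)).continuous
  have hk0 : ∀ x, 0 ≤ k x := fun x => le_moll _ hl fun y _ => (wt_pos _).le
  have hH : ∀ x y, ‖x - y‖ ≤ 2 → F x ≤ 3 ^ ((n : ℝ) + 2 * s) * F y := by
    intro x y h
    have := wt_le_of_norm_sub_le hs.1 (x := xb - x) (y := xb - y) zero_le_two
      (by rw [show xb - x - (xb - y) = -(x - y) by abel, norm_neg]; exact h)
    norm_num at this
    exact this
  have hk1 : ∀ x, |k x| ≤ 1 := fun x => by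
    rw [abs_of_nonneg (hk0 x)]
    exact moll_le _ hl fun y _ => wt_le_one hs.1 _
  -- integrability against `k`
  have hkint : ∀ g : Euc n → ℝ, WeightedIntegrable s g → Integrable fun x => k x * g x := by
    intro g hg
    refine ((hg.abs.integrable_mul_wt_sub hs.1 xb).const_mul (3 ^ ((n : ℝ) + 2 * s))).mono'
      (hkc.aestronglyMeasurable.mul hg.aestronglyMeasurable) (Eventually.of_forall fun x => ?_)
    rw [norm_mul, Real.norm_of_nonneg (hk0 x), Real.norm_eq_abs]
    have := mul_le_mul_of_nonneg_right (moll_comparable cF hH x).1 (abs_nonneg (g x))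
    linarith
  have hki : Integrable k := by simpa using hkint _ (weightedIntegrable_const hs.1 1)
  set R : ℝ := ∫ x, k x * (v T x + Real.exp (C * T) * P x) with hR
  set κ : ℝ := ∫ x, k x with hκ
  have hκ0 : 0 ≤ κ := integral_nonneg hk0
  have hRW : WeightedIntegrable s fun x => v T x + Real.exp (C * T) * P x :=
    (hvi T hTT).add (hP.weightedIntegrable.const_mul _)
  -- the bound for profiles below `v 0 + P`
  have hprofile : ∀ (D b : ℝ) (g : Euc n → ℝ), 0 ≤ D → IsProfile D b g →
      (∀ x, g x ≤ v 0 x + P x) → ∫ x, k x * g x ≤ Real.exp (C' * T) * R := by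
    intro D b g hD hg hgle
    have hstep : ∀ η ∈ Ioc (0 : ℝ) 1, ∀ τ ≥ 0, τ * (∫ z : Euc n, tk s η z) ≤ 1 → C' * τ ≤ 1 →
        ∀ j : ℕ, (1 - C' * τ) ^ j * ∫ x, k x * g x
          ≤ ∫ x, k x * (eulerStep s η τ)^[j] g x := by
      intro η hη τ hτ hτη hCτ j
      have hpr : ∀ j : ℕ, IsProfile D b ((eulerStep s η τ)^[j] g) := by
        intro j
        induction j with
        | zero => exact hg
        | succ j ih =>
          rw [Function.iterate_succ_apply']
          exact ih.eulerStep hs.1 hη.1 hτ hτη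
      induction j with
      | zero => simp
      | succ j ih =>
        rw [Function.iterate_succ_apply']
        set f := (eulerStep s η τ)^[j] g with hf
        have hfp : IsProfile D b f := hpr j
        have hfb : ∀ x, |f x| ≤ b := fun x => by
          rw [abs_of_nonneg (hfp.nonneg x)]; exact hfp.le x
        have e1 : ∫ x, k x * eulerStep s η τ f x
            = (∫ x, k x * f x) - τ * ∫ x, f x * truncFracLap s k x η := by
          rw [← integral_mul_truncFracLap_comm hs.1 hfp.continuous hfb hkc hki hk1 hη.1,
            ← integral_const_mul, ← integral_sub (hkint f (hfp.weightedIntegrable hs.1))]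
          · congr 1; ext x; simp only [eulerStep]; ring
          · refine Integrable.const_mul (hkint _ ?_) τ
            exact weightedIntegrable_of_bound hs.1
              (continuous_truncFracLap hs.1 hfp.continuous hfb hη.1).aestronglyMeasurable
              (abs_truncFracLap_le hs.1 (b := 2 * b) (fun x y => by
                have h1 := abs_le.1 (hfb x)
                have h2 := abs_le.1 (hfb y)
                rw [abs_le]; exact ⟨by linarith, by linarith⟩) hη.1)
        have e2 : ∫ x, f x * truncFracLap s k x η ≤ C' * ∫ x, k x * f x := by
          rw [← integral_const_mul]
          refine integral_mono ?_ ((hkint f (hfp.weightedIntegrable hs.1)).const_mul _) fun x => ?_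
          · have hkW := weightedIntegrable_of_bound hs.1 hkc.aestronglyMeasurable hk1
            have h1 : Integrable fun x => truncFracLap s k x η := by
              have hkt := integrable_tk (n := n) hs.1 hη.1
              simp only [fun x => hkW.truncFracLap_eq_sub hs.1 x hη.1]
              refine (hki.mul_const _).sub ?_
              have h6 : Integrable (fun p : Euc n × Euc n => tk s η p.2 * k (p.1 + p.2))
                  (volume.prod volume) := by
                have := hkt.comp_neg.convolution_integrand (ContinuousLinearMap.mul ℝ ℝ) hki
                have h3 : MeasurePreserving (fun p : Euc n × Euc n => (p.1, -p.2))
                    (volume.prod volume) (volume.prod volume) :=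
                  (MeasurePreserving.id volume).prod (Measure.measurePreserving_neg volume)
                have h4 := h3.integrable_comp_of_integrable this
                refine h4.congr (Eventually.of_forall fun p => ?_)
                simp
              refine h6.integral_prod_left.congr (Eventually.of_forall fun x => ?_)
              simp only [mul_comm]
            exact h1.bdd_mul (c := b) hfp.continuous.aestronglyMeasurable
              (Eventually.of_forall fun x => by rw [Real.norm_eq_abs]; exact hfb x)
          · have := mul_le_mul_of_nonneg_left (hC' xb x η hη) (hfp.nonneg x)
            linarith
        have h1 : 0 ≤ 1 - C' * τ := by linarith
        have e3 := mul_le_mul_of_nonneg_left e2 hτ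
        have e4 := mul_le_mul_of_nonneg_left ih h1
        rw [e1, pow_succ]
        linarith
    have hbound : ∀ η ∈ Ioc (0 : ℝ) 1,
        Real.exp (-(C' * T)) * ∫ x, k x * g x ≤ R + T * (D / 2 * sqMass n s η) * κ := by
      intro η hη
      set Λ : ℝ := ∫ z : Euc n, tk s η z with hΛ
      have hlim1 : Tendsto (fun N : ℕ => (1 - C' * (T / N)) ^ N * ∫ x, k x * g x) atTop
          (𝓝 (Real.exp (-(C' * T)) * ∫ x, k x * g x)) := by
        refine Tendsto.mul_const _ ?_
        have := Real.tendsto_one_add_div_pow_exp (-(C' * T))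
        refine this.congr fun N => ?_
        congr 1; ring
      have hTN : Tendsto (fun N : ℕ => T / (N : ℝ)) atTop (𝓝 0) :=
        tendsto_const_div_atTop_nhds_zero_nat T
      have hlim2 : Tendsto (fun N : ℕ => R + T * (D / 2 * sqMass n s η + 2 * (T / N) * Λ ^ 2 * b)
          * κ) atTop (𝓝 (R + T * (D / 2 * sqMass n s η) * κ)) := by
        have := (((((hTN.const_mul 2).mul_const (Λ ^ 2)).mul_const b).const_add
          (D / 2 * sqMass n s η)).const_mul T).mul_const κ |>.const_add R
        simpa using this
      refine le_of_tendsto_of_tendsto hlim1 hlim2 ?_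
      have ev1 : ∀ᶠ N : ℕ in atTop, T / (N : ℝ) * Λ ≤ 1 := by
        have := hTN.mul_const Λ
        rw [zero_mul] at this
        exact (this.eventually_lt_const one_pos).mono fun _ h => h.le
      have ev2 : ∀ᶠ N : ℕ in atTop, C' * (T / (N : ℝ)) ≤ 1 := by
        have := hTN.const_mul C'
        rw [mul_zero] at this
        exact (this.eventually_lt_const one_pos).mono fun _ h => h.le
      filter_upwards [ev1, ev2, eventually_gt_atTop 0] with N hN1 hN2 hN0
      have hN : (N : ℝ) ≠ 0 := by positivity
      have hNT : (N : ℝ) * (T / N) = T := by field_simp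
      have hτ0 : 0 ≤ T / (N : ℝ) := by positivity
      refine (hstep η hη _ hτ0 hN1 hN2 N).trans ?_
      obtain ⟨hp, hle⟩ := hv.iterate_eulerStep_le hn hs hP hCχ hχ hχt hvc hψ hvi hvψ hvb hg hτ0 hη.1
        hD hN1 (fun x => by linarith [hgle x]) N hNT.le
      rw [hNT] at hle
      have i1 := hkint _ hRW
      have i2 := hkint _ (hp.weightedIntegrable hs.1)
      calc _ ≤ ∫ x, (k x * (v T x + Real.exp (C * T) * P x)
            + (T * (D / 2 * sqMass n s η + 2 * (T / N) * Λ ^ 2 * b)) * k x) := by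
            refine integral_mono i2 (i1.add (hki.const_mul _)) fun x => ?_
            have := mul_le_mul_of_nonneg_left (hle x) (hk0 x)
            simp only
            linarith
        _ = _ := by
            rw [integral_add i1 (hki.const_mul _), integral_const_mul]
    have hlim : Tendsto (fun η => R + T * (D / 2 * sqMass n s η) * κ) (𝓝[>] 0)
        (𝓝 (R + T * (D / 2 * 0) * κ)) :=
      ((((tendsto_sqMass hs).const_mul _).const_mul _).mul_const _).const_add _
    have hfin := ge_of_tendsto hlim
      (by filter_upwards [Ioc_mem_nhdsGT one_pos] with η hη using hbound η hη)
    simp only [mul_zero, zero_mul, add_zero] at hfin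
    have := mul_le_mul_of_nonneg_left hfin (Real.exp_pos (C' * T)).le
    rwa [← mul_assoc, ← Real.exp_add, add_neg_cancel, Real.exp_zero, one_mul] at this
  -- passage from profiles to `v 0 + P`
  have hGW : WeightedIntegrable s fun x => v 0 x + P x := (hvi 0 h0T).add hP.weightedIntegrable
  have hGc : Continuous fun x => v 0 x + P x := by
    have h1 : Continuous (v 0) := by
      rw [← continuousOn_univ]
      exact hvc.comp (f := fun x : Euc n => ((0 : ℝ), x)) (by fun_prop)
        fun x _ => ⟨h0T, mem_univ _⟩
    exact h1.add hP.contDiff.continuous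
  have iG := hkint _ hGW
  have hball : ∀ m : ℕ, ∫ x in Metric.closedBall (0 : Euc n) m, k x * (v 0 x + P x)
      ≤ Real.exp (C' * T) * R := by
    intro m
    refine le_of_forall_pos_le_add fun δ hδ => ?_
    obtain ⟨D, b, g, hD, hg, hgle, hgm⟩ := exists_profile_le hGc hv0 m
      (show 0 < δ / (κ + 1) by positivity)
    have ig := hkint _ (hg.weightedIntegrable hs.1)
    have h1 : ∫ x in Metric.closedBall (0 : Euc n) m, k x * (v 0 x + P x)
        ≤ ∫ x, (k x * g x + δ / (κ + 1) * k x) := by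
      rw [← integral_indicator Metric.isClosed_closedBall.measurableSet]
      refine integral_mono ((integrable_indicator_iff
        Metric.isClosed_closedBall.measurableSet).2 iG.integrableOn)
        (ig.add (hki.const_mul _)) fun x => ?_
      by_cases hx : x ∈ Metric.closedBall (0 : Euc n) m
      · rw [indicator_of_mem hx]
        have := mul_le_mul_of_nonneg_left (hgm x (by simpa using hx)) (hk0 x)
        linarith
      · rw [indicator_of_notMem hx]
        have h2 := mul_nonneg (hk0 x) (hg.nonneg x)
        have h3 : 0 ≤ δ / (κ + 1) * k x := mul_nonneg (by positivity) (hk0 x)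
        linarith
    rw [integral_add ig (hki.const_mul _), integral_const_mul] at h1
    have h2 := hprofile D b g hD hg hgle
    have h3 : δ / (κ + 1) * κ ≤ δ := by
      rw [div_mul_eq_mul_div, div_le_iff₀ (by positivity)]
      nlinarith
    linarith
  have hunion : (⋃ m : ℕ, Metric.closedBall (0 : Euc n) m) = univ :=
    Metric.iUnion_closedBall_nat 0
  have hlim := tendsto_setIntegral_of_monotone (μ := volume)
    (f := fun x => k x * (v 0 x + P x))
    (s := fun m : ℕ => Metric.closedBall (0 : Euc n) m)
    (fun m => Metric.isClosed_closedBall.measurableSet)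
    (fun i j hij => Metric.closedBall_subset_closedBall (by exact_mod_cast hij))
    iG.integrableOn
  rw [hunion, setIntegral_univ] at hlim
  exact le_of_tendsto' hlim hball

end MassPropagation

/-! ### A weight that controls the growth of the solution -/

section Growth

variable {n : ℕ} {s : ℝ}

/-- Every nonnegative weighted integrable function is dominated at infinity, with arbitrarily small
constants, by another one. -/
lemma exists_dominating_at_infinity {G : Euc n → ℝ} (hGc : Continuous G)
    (hG : WeightedIntegrable s G) (hG0 : ∀ x, 0 ≤ G x) :
    ∃ g : Euc n → ℝ, WeightedIntegrable s g ∧ (∀ x, 0 ≤ g x) ∧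
      ∀ K : ℕ, ∃ R : ℝ, ∀ x, R ≤ ‖x‖ → K * G x ≤ g x := by
  set F : Euc n → ENNReal := fun x => ENNReal.ofReal (G x * wt s x) with hF
  have hFm : Measurable F := (hGc.measurable.mul continuous_wt.measurable).ennreal_ofReal
  set ν : Measure (Euc n) := volume.withDensity F with hν
  have hGi := (weightedIntegrable_iff G).1 hG
  have : IsFiniteMeasure ν := isFiniteMeasure_withDensity_ofReal hGi.2
  have hA : ∀ r : ℝ, MeasurableSet {x : Euc n | r ≤ ‖x‖} := fun r =>
    measurableSet_le measurable_const measurable_norm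
  have htail : Tendsto (fun j : ℕ => ν {x : Euc n | (j : ℝ) ≤ ‖x‖}) atTop (𝓝 0) := by
    have := tendsto_measure_iInter_atTop (μ := ν) (s := fun j : ℕ => {x : Euc n | (j : ℝ) ≤ ‖x‖})
      (fun j => (hA _).nullMeasurableSet)
      (fun i j hij x hx => le_trans (b := (j : ℝ)) (Nat.cast_le.2 hij) hx) ⟨0, measure_ne_top _ _⟩
    rwa [show ⋂ j : ℕ, {x : Euc n | (j : ℝ) ≤ ‖x‖} = ∅ from ?_, measure_empty] at this
    refine eq_empty_of_forall_notMem fun x hx => ?_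
    obtain ⟨j, hj⟩ := exists_nat_gt ‖x‖
    exact absurd (mem_iInter.1 hx j) (not_le.2 hj)
  have hR : ∀ k : ℕ, ∃ j : ℕ, k ≤ j ∧ ν {x : Euc n | (j : ℝ) ≤ ‖x‖} ≤ 2⁻¹ ^ k := fun k => by
    have h1 : (0 : ENNReal) < 2⁻¹ ^ k := ENNReal.pow_pos (by simp) k
    exact ((eventually_ge_atTop k).and (htail.eventually (ge_mem_nhds h1))).exists
  choose R hkR hνR using hR
  -- `N` counts the tails that contain a point; the tails have mass at most `2⁻ᵏ`
  set N : Euc n → ENNReal := fun x => ∑' k, {x : Euc n | (R k : ℝ) ≤ ‖x‖}.indicator 1 x with hN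
  have hNm : Measurable N := Measurable.tsum fun k => measurable_one.indicator (hA _)
  have hNi : ∫⁻ x, N x ∂ν ≠ ⊤ := by
    have h1 : ∫⁻ x, N x ∂ν = ∑' k, ν {x : Euc n | (R k : ℝ) ≤ ‖x‖} := by
      rw [hN, lintegral_tsum fun k => (measurable_one.indicator (hA _)).aemeasurable]
      exact tsum_congr fun k => lintegral_indicator_one (hA _)
    rw [h1]
    refine ne_top_of_le_ne_top ?_ (ENNReal.tsum_le_tsum hνR)
    rw [ENNReal.tsum_geometric]
    simp
  have hNtop : ∀ x, N x ≠ ⊤ := fun x => by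
    obtain ⟨j, hj⟩ := exists_nat_gt ‖x‖
    have : N x = ∑ k ∈ Finset.range j, {x : Euc n | (R k : ℝ) ≤ ‖x‖}.indicator 1 x := by
      refine tsum_eq_sum fun k hk => indicator_of_notMem (fun hx => ?_) _
      have h1 : (j : ℝ) ≤ R k := Nat.cast_le.2 (by have := hkR k; simp at hk; omega)
      exact absurd hx (not_le.2 (hj.trans_le h1))
    rw [this]
    refine (ENNReal.sum_lt_top.2 fun k _ => ?_).ne
    exact (indicator_le_self' (fun _ _ => zero_le) x).trans_lt (by simp)
  refine ⟨fun x => (N x).toReal * G x, ?_, fun x => mul_nonneg ENNReal.toReal_nonneg (hG0 x),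
    fun K => ?_⟩
  · rw [weightedIntegrable_iff]
    have h1 : Integrable (fun x => (N x).toReal) ν :=
      integrable_toReal_of_lintegral_ne_top hNm.aemeasurable hNi
    rw [hν, integrable_withDensity_iff hFm (Eventually.of_forall fun x => ENNReal.ofReal_lt_top)]
      at h1
    refine h1.congr (Eventually.of_forall fun x => ?_)
    simp only [hF]
    rw [ENNReal.toReal_ofReal (mul_nonneg (hG0 x) (wt_pos _).le), mul_assoc]
  · refine ⟨∑ k ∈ Finset.range K, (R k : ℝ), fun x hx => mul_le_mul_of_nonneg_right ?_ (hG0 x)⟩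
    have h1 : (K : ENNReal) ≤ N x := by
      refine le_trans (le_of_eq ?_) (ENNReal.sum_le_tsum (Finset.range K))
      rw [Finset.sum_congr rfl fun k hk => indicator_of_mem (?_ : x ∈ _) _]
      · simp
      · exact le_trans (Finset.single_le_sum (f := fun k => (R k : ℝ))
          (fun _ _ => Nat.cast_nonneg _) hk) hx
    have h2 := ENNReal.toReal_mono (hNtop x) h1
    simpa using h2

/-- A weight tending to infinity that dominates the given convolution `wtConv s G`, with
arbitrarily small constants, up to additive constants. -/
lemma exists_coercive_weight (hn : 0 < n) (hs : s ∈ Ioo (0 : ℝ) 1) {G : Euc n → ℝ}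
    (hGc : Continuous G) (hG : WeightedIntegrable s G) (hG1 : ∀ x, 1 ≤ G x) :
    ∃ C χ, 0 ≤ C ∧ IsWeight s C χ ∧ Tendsto χ (cocompact (Euc n)) atTop ∧
      ∀ α > 0, ∃ B, ∀ x, wtConv s G x ≤ α * χ x + B := by
  have hG0 : ∀ x, 0 ≤ G x := fun x => zero_le_one.trans (hG1 x)
  obtain ⟨C, hC, hw⟩ := exists_isWeight_moll_wtConv hn hs
  obtain ⟨c, hc, hlow⟩ := exists_le_wtConv n hs.1
  obtain ⟨g, hg, hg0, hgK⟩ := exists_dominating_at_infinity hGc hG hG0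
  set H : ℝ := 3 ^ ((n : ℝ) + 2 * s) with hH
  have hH0 : 0 < H := by positivity
  have hcomp := moll_comparable (continuous_wtConv hs.1 hg) (wtHarnack_wtConv hs.1 hg hg0)
  set χ := moll (stdBump n) (wtConv s g) with hχ
  refine ⟨C, χ, hC, hw g hg hg0, ?_, fun α hα => ?_⟩
  · refine tendsto_atTop.2 fun b => ?_
    obtain ⟨K, hK⟩ := exists_nat_ge (H * |b| / c)
    obtain ⟨R, hR⟩ := hgK K
    have : ∀ᶠ x : Euc n in cocompact (Euc n), R + 1 ≤ ‖x‖ :=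
      tendsto_norm_cocompact_atTop.eventually_ge_atTop _
    filter_upwards [this] with x hx
    have h1 := hlow g x K hg hg0 (Nat.cast_nonneg _) fun y hy => by
      have h2 : ‖x‖ ≤ ‖x - y‖ + ‖y‖ := by simpa using norm_add_le (x - y) y
      have h3 := hR y (by linarith)
      have h4 := mul_le_mul_of_nonneg_left (hG1 y) (Nat.cast_nonneg (α := ℝ) K)
      linarith
    rw [div_le_iff₀ hc] at hK
    have h2 := (hcomp x).2
    have h3 : H * |b| ≤ H * χ x := by linarith
    exact (le_abs_self b).trans (le_of_mul_le_mul_left h3 hH0)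
  · obtain ⟨K, hK⟩ := exists_nat_ge (H / α)
    obtain ⟨R, hR⟩ := hgK (K + 1)
    have hK1 : (0 : ℝ) < K + 1 := by positivity
    have hBm : MeasurableSet (Metric.closedBall (0 : Euc n) R) := measurableSet_closedBall
    have hi : Integrable ((Metric.closedBall (0 : Euc n) R).indicator G) :=
      (hGc.continuousOn.integrableOn_compact (isCompact_closedBall _ _)).integrable_indicator hBm
    refine ⟨∫ y, (Metric.closedBall (0 : Euc n) R).indicator G y, fun x => ?_⟩
    have h1 : wtConv s G x ≤ (∫ y, (Metric.closedBall (0 : Euc n) R).indicator G y) +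
        ((K : ℝ) + 1)⁻¹ * wtConv s g x := by
      unfold wtConv
      have hgi := (hg.integrable_mul_wt_sub hs.1 x).const_mul ((K : ℝ) + 1)⁻¹
      rw [← integral_const_mul, ← integral_add hi hgi]
      refine integral_mono (hG.integrable_mul_wt_sub hs.1 x) (hi.add hgi) fun y => ?_
      simp only
      have hw0 := (wt_pos (s := s) (x - y)).le
      have hw1 := wt_le_one hs.1 (x - y)
      by_cases hy : y ∈ Metric.closedBall (0 : Euc n) R
      · rw [indicator_of_mem hy]
        have h2 := mul_le_mul_of_nonneg_left hw1 (hG0 y)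
        have h3 : 0 ≤ ((K : ℝ) + 1)⁻¹ * (g y * wt s (x - y)) :=
          mul_nonneg (by positivity) (mul_nonneg (hg0 y) hw0)
        linarith
      · rw [indicator_of_notMem hy, zero_add, ← mul_assoc]
        refine mul_le_mul_of_nonneg_right ?_ hw0
        rw [mem_closedBall_zero_iff, not_le] at hy
        have h2 := hR y hy.le
        push_cast at h2
        rw [inv_mul_eq_div, le_div_iff₀ hK1]
        linarith
    have h2 : ((K : ℝ) + 1)⁻¹ * wtConv s g x ≤ α * χ x := by
      have h3 := (hcomp x).2
      have hχ0 : 0 ≤ χ x := (hw g hg hg0).nonneg x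
      rw [inv_mul_eq_div, div_le_iff₀ hK1]
      rw [div_le_iff₀ hα] at hK
      nlinarith only [h3, hχ0, hK, hα]
    linarith

end Growth

/-! ### The solution lies above the obstacle -/

section AboveObstacle

variable {n : ℕ} {s T : ℝ} {ψ : Euc n → ℝ} {u : ℝ → Euc n → ℝ}

/-- A supersolution of the obstacle problem lies above the obstacle, since points where it can be
touched from below by paraboloids are dense. -/
lemma IsViscositySupersolution.obstacle_le (hu : IsViscositySupersolution s T ψ u)
    (huc : ContinuousOn (fun p : ℝ × Euc n => u p.1 p.2) (Icc 0 T ×ˢ univ)) (hψ : Continuous ψ)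
    {t : ℝ} (ht : t ∈ Ioo 0 T) (x : Euc n) : ψ x ≤ u t x := by
  by_contra! hlt
  have hnhds : Icc 0 T ×ˢ (univ : Set (Euc n)) ∈ 𝓝 (t, x) :=
    prod_mem_nhds (Icc_mem_nhds ht.1 ht.2) univ_mem
  have hev : ∀ᶠ p : ℝ × Euc n in 𝓝 (t, x), p.1 ∈ Ioo 0 T ∧ u p.1 p.2 < ψ p.2 :=
    (continuous_fst.continuousAt.eventually (isOpen_Ioo.mem_nhds ht)).and
      ((huc.continuousAt hnhds).eventually_lt (hψ.comp continuous_snd).continuousAt hlt)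
  obtain ⟨ρ, hρ, hball⟩ := Metric.nhds_basis_closedBall.eventually_iff.1 hev
  have hKc : IsCompact (Metric.closedBall (t, x) ρ) := isCompact_closedBall _ _
  have huK : ContinuousOn (fun p : ℝ × Euc n => u p.1 p.2) (Metric.closedBall (t, x) ρ) :=
    huc.mono fun p hp => ⟨Ioo_subset_Icc_self (hball hp).1, mem_univ _⟩
  obtain ⟨m, hm⟩ := hKc.bddBelow_image huK
  have hm' : ∀ p ∈ Metric.closedBall (t, x) ρ, m ≤ u p.1 p.2 := fun p hp =>
    hm (mem_image_of_mem _ hp)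
  have hmem : (t, x) ∈ Metric.closedBall (t, x) ρ := Metric.mem_closedBall_self hρ.le
  -- a paraboloid so steep that it touches the graph within distance `ρ / 2`
  set A : ℝ := (u t x - m + 1) * 4 / ρ ^ 2 with hA
  have hA0 : 0 < A := by
    have := hm' _ hmem
    simp only at this
    have : 0 < u t x - m + 1 := by linarith
    positivity
  set q : ℝ × Euc n → ℝ := fun p => A * ((p.1 - t) ^ 2 + ‖p.2 - x‖ ^ 2) with hq
  have hqc : ContDiff ℝ 2 q :=
    contDiff_const.mul (((contDiff_fst.sub contDiff_const).pow 2).add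
      ((contDiff_snd.sub contDiff_const).norm_sq ℝ))
  obtain ⟨p₀, hp₀, hmin⟩ := hKc.exists_isMinOn ⟨_, hmem⟩ (huK.add hqc.continuous.continuousOn)
  have h1 : u p₀.1 p₀.2 + q p₀ ≤ u t x := by
    have h2 := hmin hmem
    have h3 : q (t, x) = 0 := by simp [hq]
    have h4 : u p₀.1 p₀.2 + q p₀ ≤ u t x + q (t, x) := h2
    linarith
  have h2 : (p₀.1 - t) ^ 2 + ‖p₀.2 - x‖ ^ 2 < (ρ / 2) ^ 2 := by
    have h3 := hm' _ hp₀
    have h4 : q p₀ < A * (ρ / 2) ^ 2 := by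
      have : A * (ρ / 2) ^ 2 = u t x - m + 1 := by rw [hA]; field_simp; ring
      linarith
    exact lt_of_mul_lt_mul_left h4 hA0.le
  have h3 : |p₀.1 - t| < ρ / 2 := abs_lt_of_sq_lt_sq (by
    have := sq_nonneg ‖p₀.2 - x‖; linarith) (by positivity)
  have h4 : ‖p₀.2 - x‖ < ρ / 2 := by
    have := abs_lt_of_sq_lt_sq (a := ‖p₀.2 - x‖) (b := ρ / 2)
      (by have := sq_nonneg (p₀.1 - t); linarith) (by positivity)
    exact (le_abs_self _).trans_lt this
  have h5 := hu (fun p => u p₀.1 p₀.2 + q p₀ - q p) (contDiff_const.sub hqc) p₀.1 (hball hp₀).1 p₀.2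
    (ρ / 2) (by positivity) (by simp) (fun t' _ ht' x' hx' => by
      have h6 : (t', x') ∈ Metric.closedBall (t, x) ρ := by
        rw [mem_closedBall_iff_norm, Prod.norm_def]
        rw [mem_ball_iff_norm] at hx'
        refine max_le ?_ ?_
        · rw [Real.norm_eq_abs]
          have := abs_sub_le t' p₀.1 t
          simp only [Prod.fst_sub]; linarith
        · have := norm_sub_le_norm_sub_add_norm_sub x' p₀.2 x
          simp only [Prod.snd_sub]; linarith
      have h7 : u p₀.1 p₀.2 + q p₀ ≤ u t' x' + q (t', x') := hmin h6
      linarith)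
  have h6 : (0 : EReal) ≤ ((u p₀.1 p₀.2 - ψ p₀.2 : ℝ) : EReal) := h5.trans (min_le_right _ _)
  have h7 : 0 ≤ u p₀.1 p₀.2 - ψ p₀.2 := EReal.coe_nonneg.1 h6
  linarith [(hball hp₀).2]

lemma IsObstacleSolution.obstacle_le {u₀ : Euc n → ℝ} (hu : IsObstacleSolution s T ψ u₀ u)
    (hψ : Continuous ψ) (h_above : ∀ x, ψ x ≤ u₀ x) {t : ℝ} (ht : t ∈ Icc 0 T) (x : Euc n) :
    ψ x ≤ u t x :=
  le_of_forall_Ioo_le (u := fun _ => ψ) (hψ.comp continuous_snd).continuousOn hu.continuousOn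
    (fun x => by rw [hu.initial]; exact h_above x)
    (fun _ ht => hu.supersolution.obstacle_le hu.continuousOn hψ ht) ht x

end AboveObstacle

/-! ### Growth of the solution -/

section GrowthSolution

variable {n : ℕ} {s T : ℝ}

/-- The mollified weight centered at `xb` is comparable to the weight itself. -/
lemma moll_wt_comparable (hs : 0 < s) (xb x : Euc n) :
    moll (stdBump n) (fun y => wt s (xb - y)) x ≤ 3 ^ ((n : ℝ) + 2 * s) * wt s (xb - x) ∧
      wt s (xb - x) ≤ 3 ^ ((n : ℝ) + 2 * s) * moll (stdBump n) (fun y => wt s (xb - y)) x := by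
  refine moll_comparable (F := fun y => wt s (xb - y))
    (continuous_wt.comp (continuous_const.sub continuous_id)) (fun x y h => ?_) x
  have := wt_le_of_norm_sub_le hs (x := xb - x) (y := xb - y) zero_le_two
    (by rw [sub_sub_sub_cancel_left, norm_sub_rev]; exact h)
  norm_num at this
  exact this

/-- A Lipschitz function is dominated by the convolution of the weight with any function that
exceeds it by twice the Lipschitz constant. -/
lemma le_wtConv_of_lipschitzWith {c : ℝ} (hc : ∀ (g : Euc n → ℝ) (x : Euc n) (b : ℝ),
    WeightedIntegrable s g → (∀ x, 0 ≤ g x) → 0 ≤ b → (∀ y, ‖x - y‖ ≤ 1 → b ≤ g y) →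
      c * b ≤ wtConv s g x) {f g : Euc n → ℝ} {L : NNReal} (hf : LipschitzWith L f)
    (hg : WeightedIntegrable s g) (hg0 : ∀ x, 0 ≤ g x) (h : ∀ x, |f x| + 2 * L ≤ g x)
    {x y : Euc n} (hxy : ‖x - y‖ ≤ 1) : c * |f y| ≤ wtConv s g x := by
  refine hc g x _ hg hg0 (abs_nonneg _) fun z hz => le_trans ?_ (h z)
  have h1 := hf.dist_le_mul y z
  rw [Real.dist_eq, dist_eq_norm] at h1
  have h2 := norm_sub_le_norm_sub_add_norm_sub y x z
  rw [norm_sub_rev y x] at h2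
  have h3 := abs_sub_abs_le_abs_sub (f y) (f z)
  have h4 := mul_le_mul_of_nonneg_left (by linarith : ‖y - z‖ ≤ 2) L.2
  simp only [NNReal.val_eq_coe] at h4
  linarith

/-- The obstacle is bounded below, and the solution bounded above uniformly in time, by arbitrarily
small multiples of a weight that tends to infinity. -/
lemma IsObstacleSolution.exists_weight (hn : 0 < n) (hs : s ∈ Ioo (0 : ℝ) 1) (hT : 0 < T)
    {ψ u₀ : Euc n → ℝ} {u : ℝ → Euc n → ℝ} {Lψ L₀ : NNReal} (hψL : LipschitzWith Lψ ψ)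
    (hψi : WeightedIntegrable s ψ) (hu₀L : LipschitzWith L₀ u₀) (h_above : ∀ x, ψ x ≤ u₀ x)
    (hu : IsObstacleSolution s T ψ u₀ u) :
    ∃ C χ, 0 ≤ C ∧ IsWeight s C χ ∧ Tendsto χ (cocompact (Euc n)) atTop ∧
      ∀ α > 0, ∃ B, ∀ x, -(α * χ x + B) ≤ ψ x ∧ ∀ t ∈ Icc 0 T, u t x ≤ α * χ x + B := by
  obtain ⟨c, hc, hlow⟩ := exists_le_wtConv n hs.1
  obtain ⟨C, hC, hw⟩ := exists_isWeight_moll_wtConv hn hs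
  obtain ⟨C', hC', hmass⟩ := exists_mass_initial_le hn hs
  obtain ⟨A, hA, hloc⟩ := IsSub.exists_local_bound hn hs
  have hψc := hψL.continuous
  have hu₀i : WeightedIntegrable s u₀ := hu.initial ▸ hu.weightedIntegrable 0 ⟨le_rfl, hT.le⟩
  have hTmem : T ∈ Icc 0 T := ⟨hT.le, le_rfl⟩
  have hge : ∀ t ∈ Icc 0 T, ∀ x, ψ x ≤ u t x := fun t ht x => hu.obstacle_le hψc h_above ht x
  set H : ℝ := 3 ^ ((n : ℝ) + 2 * s) with hH
  have hH1 : 1 ≤ H := Real.one_le_rpow (by norm_num) (expo_pos hs.1).le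
  have hH0 : 0 < H := by linarith
  -- a weight above the negative part of the solution
  obtain ⟨P, hP, hPψ⟩ : ∃ P : Euc n → ℝ, IsWeight s C P ∧ ∀ x, |ψ x| ≤ P x := by
    set g : Euc n → ℝ := fun x => |ψ x| + 2 * Lψ with hg
    have hgi : WeightedIntegrable s g := hψi.abs.add (weightedIntegrable_const hs.1 _)
    have hg0 : ∀ x, 0 ≤ g x := fun x => by positivity
    have hgi' := hgi.const_mul (H / c)
    have hg0' : ∀ x, 0 ≤ H / c * g x := fun x => mul_nonneg (by positivity) (hg0 x)
    refine ⟨_, hw _ hgi' hg0', fun x => ?_⟩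
    have h1 := (moll_comparable (continuous_wtConv hs.1 hgi') (wtHarnack_wtConv hs.1 hgi' hg0') x).2
    have h2 := le_wtConv_of_lipschitzWith hlow hψL hgi hg0 (fun x => le_rfl) (x := x) (y := x)
      (by simp)
    rw [wtConv_const_mul] at h1
    have h3 := mul_le_mul_of_nonneg_left h2 (by positivity : 0 ≤ H / c)
    have h4 : H / c * (c * |ψ x|) = H * |ψ x| := by field_simp
    exact le_of_mul_le_mul_left (by linarith) hH0
  have hP0 := hP.nonneg
  have hPi := hP.weightedIntegrable
  have hUi := hu.weightedIntegrable T hTmem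
  have hUc : Continuous (u T) := continuousOn_univ.1
    (hu.continuousOn.comp (f := fun x : Euc n => (T, x)) (by fun_prop)
      fun x _ => ⟨hTmem, mem_univ _⟩)
  -- the final mass, the weight and the data together control the solution
  set G : Euc n → ℝ := fun x =>
    (|u T x| + P x) + ((|ψ x| + |u₀ x|) + (2 * Lψ + 2 * L₀ + 1)) with hG
  have hGi : WeightedIntegrable s G := (hUi.abs.add hPi).add
    ((hψi.abs.add hu₀i.abs).add (weightedIntegrable_const hs.1 _))
  have hGc : Continuous G := by
    have h1 := hP.contDiff.continuous
    have h2 := hu₀L.continuous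
    fun_prop
  have hG1 : ∀ x, 1 ≤ G x := fun x => by
    have h1 := hP0 x
    have h2 : 0 ≤ |u T x| + (|ψ x| + |u₀ x|) + (2 * Lψ + 2 * L₀) := by positivity
    simp only [hG]; linarith
  have hG0 : ∀ x, 0 ≤ G x := fun x => zero_le_one.trans (hG1 x)
  have hFc := continuous_wtConv hs.1 hGi
  have hFψ : ∀ x y, ‖x - y‖ ≤ 1 → c * |ψ y| ≤ wtConv s G x := fun x y hxy =>
    le_wtConv_of_lipschitzWith hlow hψL hGi hG0 (fun x => by
      have h1 := hP0 x
      have h2 : 0 ≤ |u T x| + |u₀ x| + 2 * L₀ := by positivity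
      simp only [hG]; linarith) hxy
  have hFu : ∀ x y, ‖x - y‖ ≤ 1 → c * |u₀ y| ≤ wtConv s G x := fun x y hxy =>
    le_wtConv_of_lipschitzWith hlow hu₀L hGi hG0 (fun x => by
      have h1 := hP0 x
      have h2 : 0 ≤ |u T x| + |ψ x| + 2 * Lψ := by positivity
      simp only [hG]; linarith) hxy
  have hFpos : ∀ x, 0 < wtConv s G x := fun x => by
    have := hlow G x 1 hGi hG0 zero_le_one fun y _ => hG1 y
    linarith
  obtain ⟨Cχ, χ, hCχ, hχ, hχt, hFχ⟩ := exists_coercive_weight hn hs hGc hGi hG1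
  have hlowb : ∀ α > 0, ∃ B, ∀ x, -(α * χ x + B) ≤ ψ x := fun α hα => by
    obtain ⟨B, hB⟩ := hFχ (c * α) (by positivity)
    refine ⟨B / c, fun x => ?_⟩
    have h2 := neg_abs_le (ψ x)
    have h3 := (hFψ x x (by simp)).trans (hB x)
    have h4 : c * (α * χ x + B / c) = c * α * χ x + B := by field_simp
    have h5 : |ψ x| ≤ α * χ x + B / c := le_of_mul_le_mul_left (by linarith) hc
    linarith
  -- the masses at all times are controlled by the final one, after a shift of time
  set M₁ : ℝ := H * (Real.exp (C' * T) * (H * Real.exp (C * T))) with hM₁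
  have hM₁0 : 0 ≤ M₁ := by positivity
  have hmass' : ∀ t ∈ Icc 0 T, ∀ xb, ∫ y, |u t y| * wt s (xb - y) ≤ (M₁ + 1) * wtConv s G xb := by
    intro t ht xb
    have key := hmass (T - t) C Cχ P χ ψ (fun τ x => u (τ + t) x) (by linarith [ht.2]) hP hCχ hχ hχt
      (by simpa using continuousOn_shift hu.continuousOn ht.1 (τ := T - t) (by linarith) 0) hψc
      (fun τ hτ => hu.weightedIntegrable _ ⟨by linarith [hτ.1, ht.1], by linarith [hτ.2]⟩)
      (hu.supersolution.isSuper.shift_time ht.1 (by linarith))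
      (fun τ hτ => hge _ ⟨by linarith [hτ.1, ht.1], by linarith [hτ.2]⟩)
      (fun α hα => (hlowb α hα).imp fun B hB τ hτ x =>
        (hB x).trans (hge _ ⟨by linarith [hτ.1, ht.1], by linarith [hτ.2]⟩ x))
      (fun x => by
        have h1 := hge t ht x
        have h2 := neg_abs_le (ψ x)
        have h3 := hPψ x
        simp only [zero_add]; linarith) xb
    simp only [zero_add, sub_add_cancel] at key
    have hcomp := moll_wt_comparable (n := n) hs.1 xb
    set m := moll (stdBump n) (fun y => wt s (xb - y)) with hm
    have hwc : Continuous fun y : Euc n => wt s (xb - y) :=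
      continuous_wt.comp (continuous_const.sub continuous_id)
    have hmc : Continuous m :=
      (contDiff_moll (stdBump n) hwc.locallyIntegrable (k := 2)).continuous
    have hm0 : ∀ x, 0 ≤ m x := fun x =>
      nonneg_of_mul_nonneg_right ((wt_pos _).le.trans (hcomp x).2) hH0
    have hmi : ∀ {f : Euc n → ℝ}, WeightedIntegrable s f → Integrable fun x => m x * f x := by
      intro f hf
      refine ((hf.integrable_mul_wt_sub hs.1 xb).norm.const_mul H).mono'
        (hmc.aestronglyMeasurable.mul hf.aestronglyMeasurable) (Eventually.of_forall fun x => ?_)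
      rw [norm_mul, norm_mul, Real.norm_of_nonneg (hm0 x), Real.norm_of_nonneg (wt_pos _).le]
      have := mul_le_mul_of_nonneg_left (hcomp x).1 (norm_nonneg (f x))
      linarith
    have hti := hu.weightedIntegrable t ht
    have h0 : ∀ x, 0 ≤ u t x + P x := fun x => by
      have h1 := hge t ht x
      have h2 := neg_abs_le (ψ x)
      have h3 := hPψ x
      linarith
    -- the left-hand side controls the mass of `u t + P`
    have h1 : wtConv s (fun y => u t y + P y) xb ≤ H * ∫ x, m x * (u t x + P x) := by
      rw [← integral_const_mul]
      refine integral_mono ((hti.add hPi).integrable_mul_wt_sub hs.1 xb)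
        ((hmi (hti.add hPi)).const_mul H) fun x => ?_
      have := mul_le_mul_of_nonneg_left (hcomp x).2 (h0 x)
      simp only; linarith
    have hexp1 : Real.exp (C' * (T - t)) ≤ Real.exp (C' * T) :=
      Real.exp_le_exp.2 (mul_le_mul_of_nonneg_left (by linarith [ht.1]) hC')
    have hexp2 : Real.exp (C * (T - t)) ≤ Real.exp (C * T) :=
      Real.exp_le_exp.2 (mul_le_mul_of_nonneg_left (by linarith [ht.1]) hC)
    have hexp3 : 1 ≤ Real.exp (C * T) := Real.one_le_exp (by positivity)
    have h2 : ∫ x, m x * (u T x + Real.exp (C * (T - t)) * P x) ≤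
        H * Real.exp (C * T) * wtConv s G xb := by
      unfold wtConv
      rw [← integral_const_mul]
      refine integral_mono (hmi (hUi.add (hPi.const_mul _)))
        ((hGi.integrable_mul_wt_sub hs.1 xb).const_mul _) fun x => ?_
      have h3 : u T x + Real.exp (C * (T - t)) * P x ≤ Real.exp (C * T) * G x := by
        have h4 := mul_le_mul_of_nonneg_right hexp2 (hP0 x)
        have h5 : u T x ≤ Real.exp (C * T) * |u T x| :=
          (le_abs_self _).trans (le_mul_of_one_le_left (abs_nonneg _) hexp3)
        have h6 : 0 ≤ Real.exp (C * T) * ((|ψ x| + |u₀ x|) + (2 * Lψ + 2 * L₀ + 1)) := by positivity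
        simp only [hG]
        linarith
      have h4 := mul_le_mul_of_nonneg_left h3 (hm0 x)
      have h5 := mul_le_mul_of_nonneg_left (hcomp x).1
        (mul_nonneg (Real.exp_pos (C * T)).le (hG0 x))
      simp only; linarith
    have h3 : wtConv s (fun y => u t y + P y) xb ≤ M₁ * wtConv s G xb := by
      have h4 : 0 ≤ H * Real.exp (C * T) * wtConv s G xb :=
        mul_nonneg (by positivity) (hFpos xb).le
      have h5 := mul_le_mul_of_nonneg_left h2 (Real.exp_pos (C' * (T - t))).le
      have h6 := mul_le_mul_of_nonneg_right hexp1 h4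
      have h7 := mul_le_mul_of_nonneg_left (key.trans (h5.trans h6)) hH0.le
      have h8 : H * (Real.exp (C' * T) * (H * Real.exp (C * T) * wtConv s G xb))
        = M₁ * wtConv s G xb := by rw [hM₁]; ring
      linarith
    have h4 : ∫ y, |u t y| * wt s (xb - y) ≤
        wtConv s (fun y => (u t y + P y) + P y) xb :=
      wtConv_mono hs.1 hti.abs ((hti.add hPi).add hPi)
        (fun x => by
          have := h0 x
          have := hP0 x
          exact abs_le.2 ⟨by linarith, by linarith⟩) xb
    rw [wtConv_add hs.1 (hti.add hPi) hPi] at h4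
    have h5 : wtConv s P xb ≤ wtConv s G xb := wtConv_mono hs.1 hPi hGi (fun x => by
      have h2 : 0 ≤ |u T x| + (|ψ x| + |u₀ x|) + (2 * Lψ + 2 * L₀ + 1) := by positivity
      simp only [hG]; linarith) xb
    linarith
  set M₂ : ℝ := M₁ + 1 + c⁻¹ with hM₂
  have hM₂0 : 0 < M₂ := by positivity
  have hMb : ∀ x b, c * b ≤ wtConv s G x → b ≤ M₂ * wtConv s G x := fun x b h => by
    have h1 : b ≤ c⁻¹ * wtConv s G x := by rw [inv_mul_eq_div, le_div_iff₀ hc]; linarith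
    have h2 : 0 ≤ (M₁ + 1) * wtConv s G x := mul_nonneg (by positivity) (hFpos x).le
    rw [hM₂, add_mul]; linarith
  have hub : ∀ t ∈ Icc 0 T, ∀ x, u t x ≤ A * (M₂ * wtConv s G x) := by
    intro t ht x
    refine le_of_forall_Ioo_le (v := fun _ x => A * (M₂ * wtConv s G x)) hu.continuousOn
      (by fun_prop) (fun x => ?_) (fun t ht x => ?_) ht x
    · rw [hu.initial]
      have h1 := (le_abs_self _).trans (hMb x _ (hFu x x (by simp)))
      exact h1.trans (le_mul_of_one_le_left (mul_pos hM₂0 (hFpos x)).le hA)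
    · refine hloc T ψ u x (M₂ * wtConv s G x) (mul_pos hM₂0 (hFpos x)) hu.continuousOn
        (fun t ht => hu.weightedIntegrable t (Ioo_subset_Icc_self ht)) hu.subsolution.isSub
        (fun t ht => (hmass' t (Ioo_subset_Icc_self ht) x).trans ?_) (fun y hy => ?_)
        (fun y hy => ?_) t ht
      · refine mul_le_mul_of_nonneg_right ?_ (hFpos x).le
        have : 0 < c⁻¹ := by positivity
        linarith
      · rw [hu.initial]
        rw [mem_closedBall_iff_norm, norm_sub_rev] at hy
        exact (le_abs_self _).trans (hMb x _ (hFu x y hy))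
      · rw [mem_closedBall_iff_norm, norm_sub_rev] at hy
        exact (le_abs_self _).trans (hMb x _ (hFψ x y hy))
  refine ⟨Cχ, χ, hCχ, hχ, hχt, fun α hα => ?_⟩
  obtain ⟨B₁, hB₁⟩ := hlowb α hα
  have hAM : 0 < A * M₂ := by positivity
  obtain ⟨B₂, hB₂⟩ := hFχ (α / (A * M₂)) (by positivity)
  refine ⟨max B₁ (A * M₂ * B₂), fun x => ⟨?_, fun t ht => ?_⟩⟩
  · have h1 := hB₁ x
    have h2 := le_max_left B₁ (A * M₂ * B₂)
    linarith
  · have h1 := hub t ht x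
    have h2 := mul_le_mul_of_nonneg_left (hB₂ x) hAM.le
    have h3 : A * M₂ * (α / (A * M₂) * χ x + B₂) = α * χ x + A * M₂ * B₂ := by field_simp
    have h4 := le_max_right B₁ (A * M₂ * B₂)
    linarith

end GrowthSolution

/-! ### Lipschitz estimate in space -/

section SpaceLipschitz

variable {n : ℕ} {s T : ℝ} {ψ u₀ : Euc n → ℝ} {u : ℝ → Euc n → ℝ}

/-- Comparison of the solution with its translates: since the equation is invariant under
translations, a common Lipschitz constant of the data is one of the solution. -/
lemma IsObstacleSolution.lipschitzWith_space (hn : 0 < n) (hs : s ∈ Ioo (0 : ℝ) 1) (hT : 0 < T)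
    {L : NNReal} (hψL : LipschitzWith L ψ) (hψi : WeightedIntegrable s ψ)
    (hu₀L : LipschitzWith L u₀) (h_above : ∀ x, ψ x ≤ u₀ x) (hu : IsObstacleSolution s T ψ u₀ u)
    {t : ℝ} (ht : t ∈ Icc 0 T) : LipschitzWith L (u t) := by
  obtain ⟨C, χ, hC, hχ, hχt, hB⟩ := hu.exists_weight hn hs hT hψL hψi hu₀L h_above
  have hge : ∀ t ∈ Icc 0 T, ∀ x, ψ x ≤ u t x := fun t ht x =>
    hu.obstacle_le hψL.continuous h_above ht x
  have key : ∀ h x, u t x ≤ u t (x + h) + L * ‖h‖ := by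
    intro h x
    have hLip : ∀ {f : Euc n → ℝ}, LipschitzWith L f → ∀ x, f x ≤ f (x + h) + L * ‖h‖ := by
      intro f hf x
      have h1 := hf.dist_le_mul x (x + h)
      rw [Real.dist_eq, dist_eq_norm, sub_add_cancel_left, norm_neg] at h1
      linarith [le_abs_self (f x - f (x + h))]
    have hvge : ∀ t ∈ Icc 0 T, ∀ x, ψ x ≤ u t (x + h) + L * ‖h‖ := fun t ht x =>
      (hLip hψL x).trans (add_le_add_left (hge t ht (x + h)) _)
    have hcs : ContinuousOn (fun p : ℝ × Euc n => u p.1 (p.2 + h)) (Icc 0 T ×ˢ univ) := by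
      simpa using continuousOn_shift hu.continuousOn le_rfl (τ := T) (by simp) h
    have hvi : ∀ t ∈ Ioo 0 T, WeightedIntegrable s fun x => u t (x + h) + L * ‖h‖ := by
      intro t ht
      have h1 := (hu.weightedIntegrable t (Ioo_subset_Icc_self ht)).comp_add hs.1 h
      simp only [add_comm h] at h1
      exact h1.add (weightedIntegrable_const hs.1 _)
    have hvs : IsSuper s T fun t x => u t (x + h) + L * ‖h‖ := by
      simpa using hu.supersolution.isSuper.shift le_rfl h (L * ‖h‖)
    refine IsSub.le_isSuper (v := fun t x => u t (x + h) + L * ‖h‖) hn hs hC hχ hχt hu.continuousOn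
      (hcs.add continuousOn_const) hψL.continuous
      (fun t ht => hu.weightedIntegrable t (Ioo_subset_Icc_self ht))
      hvi hu.subsolution.isSub hvs hvge
      (fun x => by rw [hu.initial]; exact hLip hu₀L x)
      (fun α hα => (hB α hα).imp fun B hB t ht x => (hB x).2 t ht)
      (fun α hα => (hB α hα).imp fun B hB t ht x => (hB x).1.trans (hvge t ht x)) ht x
  refine LipschitzWith.of_le_add_mul L fun x y => ?_
  have := key (y - x) x
  rwa [add_sub_cancel, ← dist_eq_norm, dist_comm] at this

end SpaceLipschitz

/-! ### Mollification of the initial datum -/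

section InitialBarrier

variable {n : ℕ} {s : ℝ} {f : Euc n → ℝ}

/-- Semiconvexity as a lower bound for second differences. -/
lemma IsSemiconvex.exists_le_secondDiff (hf : IsSemiconvex f) :
    ∃ D : ℝ, 0 ≤ D ∧ ∀ x z, -(D * ‖z‖ ^ 2) ≤ f (x + z) + f (x - z) - 2 * f x := by
  obtain ⟨C, hC⟩ := hf
  refine ⟨max C 0, le_max_right _ _, fun x z => ?_⟩
  have hC2 := hC.2
  have h1 := hC2 (mem_univ (x + z)) (mem_univ (x - z)) (a := 1 / 2) (b := 1 / 2) (by norm_num)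
    (by norm_num) (by norm_num)
  have h2 : (1 / 2 : ℝ) • (x + z) + (1 / 2 : ℝ) • (x - z) = x := by module
  rw [h2] at h1
  simp only [smul_eq_mul] at h1
  have h3 := parallelogram_law_with_norm ℝ x z
  have h4 := mul_le_mul_of_nonneg_right (le_max_left C 0) (sq_nonneg ‖z‖)
  have h5 : C * (‖x + z‖ ^ 2 + ‖x - z‖ ^ 2) = C * (2 * ‖x‖ ^ 2 + 2 * ‖z‖ ^ 2) := by
    congr 1; linarith
  linarith

lemma LipschitzWith.lipschitzWith_truncFracLap (hs : 0 < s) {L : NNReal} (hL : LipschitzWith L f)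
    (hf : WeightedIntegrable s f) {ε : ℝ} (hε : 0 < ε) :
    LipschitzWith (2 * L * (∫ z : Euc n, tk s ε z).toNNReal) fun x => truncFracLap s f x ε := by
  refine LipschitzWith.of_le_add_mul _ fun x y => ?_
  have hI0 : 0 ≤ ∫ z : Euc n, tk s ε z := integral_nonneg fun z => tk_nonneg _ _
  have h1 : ∫ z, (f x - f (x + z)) * tk s ε z ≤
      ∫ z, ((f y - f (y + z)) * tk s ε z + 2 * L * dist x y * tk s ε z) := by
    refine integral_mono (hf.integrable_trunc hs x hε)
      ((hf.integrable_trunc hs y hε).add ((integrable_tk hs hε).const_mul _)) fun z => ?_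
    have h2 := hL.dist_le_mul x y
    have h3 := hL.dist_le_mul (x + z) (y + z)
    rw [dist_add_right, Real.dist_eq] at h3
    rw [Real.dist_eq] at h2
    have h4 := mul_le_mul_of_nonneg_right (by
      linarith [le_abs_self (f x - f y), neg_abs_le (f (x + z) - f (y + z))] :
      f x - f (x + z) ≤ (f y - f (y + z)) + 2 * L * dist x y) (tk_nonneg (s := s) ε z)
    simp only; linarith
  rw [integral_add (hf.integrable_trunc hs y hε) ((integrable_tk hs hε).const_mul _),
    integral_const_mul] at h1
  rw [truncFracLap_eq, truncFracLap_eq]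
  push_cast
  rw [Real.coe_toNNReal _ hI0]
  linarith

/-- The truncated operators commute with mollification. -/
lemma truncFracLap_moll (hs : 0 < s) {L : NNReal} (hL : LipschitzWith L f)
    (hf : WeightedIntegrable s f) (φ : ContDiffBump (0 : Euc n)) (x : Euc n) {ε : ℝ} (hε : 0 < ε) :
    truncFracLap s (moll φ f) x ε = ∫ y, φ.normed volume y * truncFracLap s f (x - y) ε := by
  have hfc := hL.continuous
  have hl := hfc.locallyIntegrable (μ := volume)
  set F : Euc n → Euc n → ℝ := fun z y =>
    φ.normed volume y * ((f (x - y) - f (x - y + z)) * tk s ε z) with hF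
  have hbd : Integrable (fun p : Euc n × Euc n => (|f x - f (x + p.1)| * tk s ε p.1 +
      2 * L * φ.rOut * tk s ε p.1) * φ.normed volume p.2) (volume.prod volume) := by
    have h1 : Integrable fun z => |f x - f (x + z)| * tk s ε z := by
      refine (hf.integrable_trunc hs x hε).norm.congr (Eventually.of_forall fun z => ?_)
      simp only [norm_mul, Real.norm_eq_abs, abs_of_nonneg (tk_nonneg (s := s) ε z)]
    exact (h1.add ((integrable_tk hs hε).const_mul _)).mul_prod φ.integrable_normed
  have hFi : Integrable (Function.uncurry F) (volume.prod volume) := by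
    refine hbd.mono' ?_ (Eventually.of_forall fun p => ?_)
    · have h1 : Measurable fun p : Euc n × Euc n => tk s ε p.1 :=
        (measurable_tk ε).comp measurable_fst
      have h2 : Measurable fun p : Euc n × Euc n =>
          φ.normed volume p.2 * (f (x - p.2) - f (x - p.2 + p.1)) := by
        have h3 := φ.continuous_normed (μ := volume)
        exact Continuous.measurable (by fun_prop)
      have h3 : Function.uncurry F = fun p : Euc n × Euc n =>
          φ.normed volume p.2 * (f (x - p.2) - f (x - p.2 + p.1)) * tk s ε p.1 := by
        ext p
        simp only [hF, Function.uncurry]; ring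
      rw [h3]
      exact (h2.mul h1).aestronglyMeasurable
    · obtain ⟨z, y⟩ := p
      simp only [Function.uncurry, hF]
      have hφ0 := φ.nonneg_normed (μ := volume) y
      have ht0 := tk_nonneg (s := s) ε z
      rw [norm_mul, norm_mul, Real.norm_of_nonneg hφ0, Real.norm_of_nonneg ht0, Real.norm_eq_abs]
      by_cases hy : ‖y‖ < φ.rOut
      · have h2 := hL.dist_le_mul (x - y) x
        have h3 := hL.dist_le_mul (x - y + z) (x + z)
        rw [dist_add_right, Real.dist_eq, dist_eq_norm, sub_sub_cancel_left, norm_neg] at h3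
        rw [Real.dist_eq, dist_eq_norm, sub_sub_cancel_left, norm_neg] at h2
        have h5 := mul_le_mul_of_nonneg_left hy.le L.2
        simp only [NNReal.val_eq_coe] at h5
        have h6 : |f (x - y) - f (x - y + z)| ≤ |f x - f (x + z)| + 2 * L * φ.rOut := by
          have h7 : f (x - y) - f (x - y + z) =
              (f (x - y) - f x) - (f (x - y + z) - f (x + z)) + (f x - f (x + z)) := by ring
          rw [h7]
          have h8 := abs_add_le ((f (x - y) - f x) - (f (x - y + z) - f (x + z)))
            (f x - f (x + z))
          have h9 := abs_sub (f (x - y) - f x) (f (x - y + z) - f (x + z))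
          linarith
        have h7 := mul_le_mul_of_nonneg_right (mul_le_mul_of_nonneg_right h6 ht0) hφ0
        linarith
      · rw [normed_eq_zero φ (not_lt.1 hy)]; simp
  have h1 : ∀ z, (moll φ f x - moll φ f (x + z)) * tk s ε z = ∫ y, F z y := by
    intro z
    unfold moll
    rw [← integral_sub (integrable_moll_integrand' φ hl x)
      (integrable_moll_integrand' φ hl (x + z)), ← integral_mul_const]
    congr 1; ext y
    simp only [hF]
    rw [show x + z - y = x - y + z by abel]
    ring
  have h2 : ∀ y, φ.normed volume y * truncFracLap s f (x - y) ε = ∫ z, F z y := by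
    intro y
    rw [truncFracLap_eq, ← integral_const_mul]
  rw [truncFracLap_eq]
  simp only [h1, h2]
  exact integral_integral_swap hFi

end InitialBarrier

/-! ### Lipschitz estimate in time -/

section InitialSpeed

variable {n : ℕ} {s T : ℝ}

/-- For semiconvex functions the truncated operators are monotone in the truncation up to a small
error, so that a finite upper limit is a limit, with a lower bound on the rate. -/
lemma tendsto_truncFracLap_of_fracLap_eq (hn : 0 < n) (hs : s ∈ Ioo (0 : ℝ) 1) {f : Euc n → ℝ}
    (hf : WeightedIntegrable s f) {D : ℝ} (hD : 0 ≤ D)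
    (hDf : ∀ x z, -(D * ‖z‖ ^ 2) ≤ f (x + z) + f (x - z) - 2 * f x) {x : Euc n} {c : ℝ}
    (hc : fracLap s f x = c) :
    (∀ ε > 0, c - D / 2 * sqMass n s ε ≤ truncFracLap s f x ε) ∧
      Tendsto (truncFracLap s f x) (𝓝[>] 0) (𝓝 c) := by
  have hlow : ∀ ε > 0, c - D / 2 * sqMass n s ε ≤ truncFracLap s f x ε := by
    intro η hη
    have h1 : fracLap s f x ≤ ((truncFracLap s f x η + D / 2 * sqMass n s η : ℝ) : EReal) := by
      refine limsup_le_of_le (h := ?_)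
      filter_upwards [Ioc_mem_nhdsGT hη] with ε hε
      exact EReal.coe_le_coe_iff.2
        (truncFracLap_le_of_le_secondDiff hn hs hf hε.1 hε.2 hD fun z _ => hDf x z)
    rw [hc, EReal.coe_le_coe_iff] at h1
    linarith
  refine ⟨hlow, tendsto_order.2 ⟨fun a ha => ?_, fun a ha => ?_⟩⟩
  · have h1 : Tendsto (fun ε => c - D / 2 * sqMass n s ε) (𝓝[>] 0) (𝓝 (c - D / 2 * 0)) :=
      tendsto_const_nhds.sub ((tendsto_sqMass hs).const_mul _)
    rw [mul_zero, sub_zero] at h1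
    filter_upwards [h1.eventually (lt_mem_nhds ha), self_mem_nhdsWithin] with ε h2 h3
    exact h2.trans_le (hlow ε h3)
  · have h1 : fracLap s f x < (a : EReal) := by rw [hc]; exact EReal.coe_lt_coe_iff.2 ha
    filter_upwards [eventually_lt_of_limsup_lt h1] with ε h2
    exact EReal.coe_lt_coe_iff.1 h2

/-- A bound for the fractional Laplacian in `L^∞` is inherited by the mollified function. -/
lemma eventually_abs_truncFracLap_moll_lt (hn : 0 < n) (hs : s ∈ Ioo (0 : ℝ) 1) {f : Euc n → ℝ}
    {L : NNReal} (hL : LipschitzWith L f) (hfsc : IsSemiconvex f) (hf : WeightedIntegrable s f)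
    {K : ℝ} (hK0 : 0 ≤ K) (hK : fracLapNorm s f ≤ ENNReal.ofReal K) (φ : ContDiffBump (0 : Euc n))
    (x : Euc n) {a : ℝ} (ha : 0 < a) :
    ∀ᶠ ε in 𝓝[>] 0, |truncFracLap s (moll φ f) x ε| < K + a := by
  obtain ⟨D, hD, hDf⟩ := hfsc.exists_le_secondDiff
  have hae : ∀ᵐ y : Euc n, ∃ c : ℝ, fracLap s f y = c ∧ |c| ≤ K := by
    filter_upwards [ENNReal.ae_le_essSup fun y => (fracLap s f y).abs] with y hy
    have h1 := hy.trans hK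
    induction h : fracLap s f y using EReal.rec with
    | bot => simp [h] at h1
    | top => simp [h] at h1
    | coe c =>
      rw [h, EReal.abs_def] at h1
      exact ⟨c, rfl, (ENNReal.ofReal_le_ofReal_iff hK0).1 h1⟩
  have hae' : ∀ᵐ y : Euc n, ∃ c : ℝ, fracLap s f (x - y) = c ∧ |c| ≤ K :=
    (Measure.measurePreserving_sub_left volume x).quasiMeasurePreserving.ae hae
  set g : Euc n → ℝ := fun y => (fracLap s f (x - y)).toReal with hg
  set S := sqMass n s 1 with hS
  have hS0 : 0 ≤ S := sqMass_nonneg 1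
  set I : ℝ := ∫ z : Euc n, tk s 1 z with hI
  have hI0 : 0 ≤ I := integral_nonneg fun z => tk_nonneg _ _
  set B : ℝ := K + D / 2 * S + |truncFracLap s f x 1| + 2 * L * I * φ.rOut with hB
  have hint := φ.integrable_normed (μ := volume)
  have hcont : ∀ ε > 0, Continuous fun y => φ.normed volume y * truncFracLap s f (x - y) ε :=
    fun ε hε => φ.continuous_normed.mul
      ((hL.lipschitzWith_truncFracLap hs.1 hf hε).continuous.comp
        (continuous_const.sub continuous_id))
  have hbound : ∀ ε ∈ Ioc (0 : ℝ) 1, ∀ᵐ y : Euc n,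
      ‖φ.normed volume y * truncFracLap s f (x - y) ε‖ ≤ φ.normed volume y * B := by
    intro ε hε
    filter_upwards [hae'] with y hy
    obtain ⟨c, hc, hcK⟩ := hy
    rw [norm_mul, Real.norm_of_nonneg (φ.nonneg_normed y)]
    by_cases hyr : ‖y‖ < φ.rOut
    · refine mul_le_mul_of_nonneg_left ?_ (φ.nonneg_normed y)
      have h1 := (tendsto_truncFracLap_of_fracLap_eq hn hs hf hD hDf hc).1 ε hε.1
      have h2 := truncFracLap_le_of_le_secondDiff hn hs hf hε.1 hε.2 hD
        fun z _ => hDf (x - y) z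
      have h3 := (hL.lipschitzWith_truncFracLap hs.1 hf one_pos).dist_le_mul (x - y) x
      rw [Real.dist_eq, dist_eq_norm, sub_sub_cancel_left, norm_neg] at h3
      push_cast at h3
      rw [Real.coe_toNNReal _ hI0] at h3
      have h4 : 2 * L * I * ‖y‖ ≤ 2 * L * I * φ.rOut :=
        mul_le_mul_of_nonneg_left hyr.le (by positivity)
      have h5 : sqMass n s ε ≤ S := setIntegral_mono_set (integrableOn_sqKer hn hs 1)
        (Eventually.of_forall fun z => by unfold sqKer; positivity)
        (Metric.closedBall_subset_closedBall hε.2).eventuallyLE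
      have h6 := mul_le_mul_of_nonneg_left h5 (by positivity : 0 ≤ D / 2)
      have h7 := neg_abs_le c
      have h8 := abs_le.1 h3
      have h9 := le_abs_self (truncFracLap s f x 1)
      have h10 : 0 ≤ |truncFracLap s f x 1| + 2 * L * I * φ.rOut :=
        add_nonneg (abs_nonneg _) (mul_nonneg (by positivity) φ.rOut_pos.le)
      rw [Real.norm_eq_abs, abs_le]
      constructor <;> linarith
    · rw [normed_eq_zero φ (not_lt.1 hyr)]; simp
  have hlim : Tendsto (fun ε => ∫ y, φ.normed volume y * truncFracLap s f (x - y) ε) (𝓝[>] 0)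
      (𝓝 (∫ y, φ.normed volume y * g y)) := by
    have hIoc : Ioc (0 : ℝ) 1 ∈ 𝓝[>] (0 : ℝ) := Ioc_mem_nhdsGT one_pos
    refine tendsto_integral_filter_of_dominated_convergence (fun y => φ.normed volume y * B) ?_ ?_
      (hint.mul_const B) ?_
    · filter_upwards [hIoc] with ε hε
      exact (hcont ε hε.1).aestronglyMeasurable
    · filter_upwards [hIoc] with ε hε
      exact hbound ε hε
    · filter_upwards [hae'] with y hy
      obtain ⟨c, hc, -⟩ := hy
      have h1 : g y = c := by simp [hg, hc]
      rw [h1]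
      exact (tendsto_truncFracLap_of_fracLap_eq hn hs hf hD hDf hc).2.const_mul _
  have hle : |∫ y, φ.normed volume y * g y| ≤ K := by
    rw [← Real.norm_eq_abs]
    refine (norm_integral_le_of_norm_le (hint.mul_const K) ?_).trans ?_
    · filter_upwards [hae'] with y hy
      obtain ⟨c, hc, hcK⟩ := hy
      have h1 : g y = c := by simp [hg, hc]
      rw [norm_mul, Real.norm_of_nonneg (φ.nonneg_normed y), h1]
      exact mul_le_mul_of_nonneg_left hcK (φ.nonneg_normed y)
    · rw [integral_mul_const, φ.integral_normed, one_mul]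
  filter_upwards [hlim.abs.eventually (gt_mem_nhds (by linarith :
    |∫ y, φ.normed volume y * g y| < K + a)), self_mem_nhdsWithin] with ε hε hε0
  rwa [truncFracLap_moll hs.1 hL hf φ x hε0]

variable {ψ u₀ : Euc n → ℝ} {u : ℝ → Euc n → ℝ}

/-- The initial speed of the solution is bounded by the fractional Laplacian of the initial datum:
the mollified datum, moved up or down at this speed, is a barrier. -/
lemma IsObstacleSolution.abs_sub_initial_le (hn : 0 < n) (hs : s ∈ Ioo (0 : ℝ) 1) (hT : 0 < T)
    {L : NNReal} (hψL : LipschitzWith L ψ) (hψi : WeightedIntegrable s ψ)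
    (hu₀L : LipschitzWith L u₀) (hu₀s : IsSemiconvex u₀) (h_above : ∀ x, ψ x ≤ u₀ x)
    (hu : IsObstacleSolution s T ψ u₀ u) {K : ℝ} (hK0 : 0 ≤ K)
    (hK : fracLapNorm s u₀ ≤ ENNReal.ofReal K) {t : ℝ} (ht : t ∈ Icc 0 T) (x : Euc n) :
    |u t x - u₀ x| ≤ K * t := by
  obtain ⟨C, χ, hC, hχ, hχt, hB⟩ := hu.exists_weight hn hs hT hψL hψi hu₀L h_above
  have hge : ∀ t ∈ Icc 0 T, ∀ x, ψ x ≤ u t x := fun t ht x =>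
    hu.obstacle_le hψL.continuous h_above ht x
  have hu₀i : WeightedIntegrable s u₀ := hu.initial ▸ hu.weightedIntegrable 0 ⟨le_rfl, hT.le⟩
  have key : ∀ r > 0, |u t x - u₀ x| ≤ 2 * L * r + K * t := by
    intro r hr
    set φ : ContDiffBump (0 : Euc n) := ⟨r / 2, r, by positivity, by linarith⟩ with hφ
    set W := moll φ u₀ with hW
    have hl := hu₀L.continuous.locallyIntegrable (μ := volume)
    have hWc : Continuous W := (contDiff_moll φ hl (k := 2)).continuous
    have hball : ∀ x y, ‖x - y‖ ≤ φ.rOut → |u₀ y - u₀ x| ≤ L * r := by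
      intro x y hy
      have h1 := hu₀L.dist_le_mul y x
      rw [Real.dist_eq, dist_eq_norm, norm_sub_rev] at h1
      exact h1.trans (mul_le_mul_of_nonneg_left hy L.2)
    have hWu : ∀ x, W x ≤ u₀ x + L * r := fun x =>
      moll_le φ hl fun y hy => by have := abs_le.1 (hball x y hy); linarith
    have huW : ∀ x, u₀ x - L * r ≤ W x := fun x =>
      le_moll φ hl fun y hy => by have := abs_le.1 (hball x y hy); linarith
    have hWi : WeightedIntegrable s W := by
      refine (hu₀i.abs.add (weightedIntegrable_const hs.1 (L * r))).mono hWc.aestronglyMeasurable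
        fun x => ?_
      have h0 : 0 ≤ L * r := mul_nonneg L.2 hr.le
      rw [abs_of_nonneg (by positivity : 0 ≤ |u₀ x| + L * r)]
      exact abs_le.2 ⟨by linarith [huW x, neg_abs_le (u₀ x)],
        by linarith [hWu x, le_abs_self (u₀ x)]⟩
    have hev := fun x a ha => eventually_abs_truncFracLap_moll_lt hn hs hu₀L hu₀s hu₀i hK0 hK φ x
      (a := a) ha
    have hder : ∀ c k t : ℝ, HasDerivAt (fun t : ℝ => c + k * t) k t := fun c k t => by
      simpa using ((hasDerivAt_id t).const_mul k).const_add c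
    -- the two barriers
    have hb : ∀ k c : ℝ, ∀ t : ℝ, WeightedIntegrable s fun x => W x + c + k * t := fun k c t =>
      (hWi.add (weightedIntegrable_const hs.1 c)).add (weightedIntegrable_const hs.1 _)
    have htr : ∀ k c t x ε, truncFracLap s (fun x => W x + c + k * t) x ε = truncFracLap s W x ε :=
      fun k c t x ε => by
        rw [← truncFracLap_add_const W (c + k * t) x ε]
        simp only [add_assoc]
    have hsup : IsSuper s T fun t x => W x + L * r + K * t := by
      refine isSuper_of_forall hs.1 (fun t _ => hb _ _ t)
        (fun t _ x => (hder _ K t).differentiableAt) fun t _ x a ha => ?_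
      filter_upwards [hev x a ha] with ε hε
      rw [(hder _ K t).deriv, htr]
      linarith [(abs_lt.1 hε).1]
    have hsub : IsSub s T ψ fun t x => W x + -(L * r) + -K * t := by
      refine isSub_of_forall hs.1 (fun t _ => hb _ _ t)
        (fun t _ x => (hder _ (-K) t).differentiableAt) fun t _ x a ha => ?_
      filter_upwards [hev x a ha] with ε hε
      rw [(hder _ (-K) t).deriv, htr]
      linarith [(abs_lt.1 hε).2]
    have hKt : ∀ t ∈ Icc 0 T, 0 ≤ K * t := fun t ht => mul_nonneg hK0 ht.1
    have hupge : ∀ t ∈ Icc 0 T, ∀ x, ψ x ≤ W x + L * r + K * t := fun t ht x => by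
      linarith [hKt t ht, huW x, h_above x]
    have hup : u t x ≤ W x + L * r + K * t :=
      IsSub.le_isSuper (v := fun t x => W x + L * r + K * t) hn hs hC hχ hχt hu.continuousOn
        (by fun_prop) hψL.continuous
        (fun t ht => hu.weightedIntegrable t (Ioo_subset_Icc_self ht)) (fun t _ => hb _ _ t)
        hu.subsolution.isSub hsup hupge
        (fun x => by rw [hu.initial]; linarith [huW x])
        (fun α hα => (hB α hα).imp fun B hB t ht x => (hB x).2 t ht)
        (fun α hα => (hB α hα).imp fun B hB t ht x => (hB x).1.trans (hupge t ht x)) ht x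
    have hlo : W x + -(L * r) + -K * t ≤ u t x :=
      IsSub.le_isSuper (u := fun t x => W x + -(L * r) + -K * t) hn hs hC hχ hχt
        (by fun_prop) hu.continuousOn hψL.continuous (fun t _ => hb _ _ t)
        (fun t ht => hu.weightedIntegrable t (Ioo_subset_Icc_self ht))
        hsub hu.supersolution.isSuper hge
        (fun x => by rw [hu.initial]; linarith [hWu x])
        (fun α hα => (hB α hα).imp fun B hB t ht x => by
          have h1 := (hB x).2 0 ⟨le_rfl, hT.le⟩
          rw [hu.initial] at h1
          linarith [hKt t ht, hWu x])
        (fun α hα => (hB α hα).imp fun B hB t ht x => (hB x).1.trans (hge t ht x)) ht x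
    exact abs_le.2 ⟨by linarith [huW x], by linarith [hWu x]⟩
  refine le_of_forall_pos_le_add fun a ha => ?_
  have h1 := key (a / (2 * L + 1)) (by positivity)
  have h2 : 2 * L * (a / (2 * L + 1)) ≤ a := by
    rw [mul_div_assoc', div_le_iff₀ (by positivity)]
    nlinarith [L.2]
  linarith

/-- The solution is Lipschitz in time, by comparison with its time translates. -/
lemma IsObstacleSolution.abs_sub_le_time (hn : 0 < n) (hs : s ∈ Ioo (0 : ℝ) 1) (hT : 0 < T)
    {L : NNReal} (hψL : LipschitzWith L ψ) (hψi : WeightedIntegrable s ψ)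
    (hu₀L : LipschitzWith L u₀) (hu₀s : IsSemiconvex u₀) (h_above : ∀ x, ψ x ≤ u₀ x)
    (hu : IsObstacleSolution s T ψ u₀ u) {K : ℝ} (hK0 : 0 ≤ K)
    (hK : fracLapNorm s u₀ ≤ ENNReal.ofReal K) {t t' : ℝ} (ht : t ∈ Icc 0 T) (ht' : t' ∈ Icc 0 T)
    (x : Euc n) : |u t' x - u t x| ≤ K * |t' - t| := by
  wlog htt : t ≤ t' generalizing t t'
  · rw [abs_sub_comm, abs_sub_comm t']
    exact this ht' ht (le_of_not_ge htt)
  obtain ⟨C, χ, hC, hχ, hχt, hB⟩ := hu.exists_weight hn hs hT hψL hψi hu₀L h_above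
  have hge : ∀ t ∈ Icc 0 T, ∀ x, ψ x ≤ u t x := fun t ht x =>
    hu.obstacle_le hψL.continuous h_above ht x
  obtain ⟨δ, hδ, rfl⟩ : ∃ δ, 0 ≤ δ ∧ t' = t + δ := ⟨t' - t, by linarith, by ring⟩
  have hδT : δ ∈ Icc 0 T := ⟨hδ, by linarith [ht.1, ht'.2]⟩
  have ht1 : t ∈ Icc 0 (T - δ) := ⟨ht.1, by linarith [ht'.2]⟩
  have hin : ∀ t ∈ Icc 0 (T - δ), t ∈ Icc 0 T ∧ t + δ ∈ Icc 0 T := fun t ht =>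
    ⟨⟨ht.1, by linarith [ht.2]⟩, ⟨by linarith [ht.1], by linarith [ht.2]⟩⟩
  have hKδ : 0 ≤ K * δ := mul_nonneg hK0 hδ
  have h0 := fun x => abs_le.1
    (hu.abs_sub_initial_le hn hs hT hψL hψi hu₀L hu₀s h_above hK0 hK hδT x)
  have hc : ContinuousOn (fun p : ℝ × Euc n => u p.1 p.2) (Icc 0 (T - δ) ×ˢ univ) :=
    hu.continuousOn.mono fun p hp => ⟨(hin _ hp.1).1, hp.2⟩
  have hcs : ContinuousOn (fun p : ℝ × Euc n => u (p.1 + δ) p.2) (Icc 0 (T - δ) ×ˢ univ) := by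
    simpa using continuousOn_shift hu.continuousOn hδ (τ := T - δ) (by simp) 0
  have hi : ∀ t ∈ Ioo 0 (T - δ), WeightedIntegrable s (u t) ∧ WeightedIntegrable s (u (t + δ)) :=
    fun t ht => ⟨hu.weightedIntegrable _ (hin t (Ioo_subset_Icc_self ht)).1,
      hu.weightedIntegrable _ (hin t (Ioo_subset_Icc_self ht)).2⟩
  have hsup1 : IsSuper s (T - δ) fun t x => u (t + δ) x + K * δ := by
    simpa using hu.supersolution.isSuper.shift hδ 0 (K * δ)
  have hsup2 : IsSuper s (T - δ) fun t x => u t x + K * δ := by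
    simpa using (hu.supersolution.isSuper.mono_time (T' := T - δ) (by linarith)).shift le_rfl 0
      (K * δ)
  have h1 : u t x ≤ u (t + δ) x + K * δ :=
    IsSub.le_isSuper (v := fun t x => u (t + δ) x + K * δ) hn hs hC hχ hχt hc
      (hcs.add continuousOn_const) hψL.continuous (fun t ht => (hi t ht).1)
      (fun t ht => (hi t ht).2.add (weightedIntegrable_const hs.1 _))
      (hu.subsolution.isSub.mono_time (by linarith)) hsup1
      (fun t ht x => by linarith [hge _ (hin t ht).2 x])
      (fun x => by rw [hu.initial, zero_add]; linarith [(h0 x).1])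
      (fun α hα => (hB α hα).imp fun B hB t ht x => (hB x).2 t (hin t ht).1)
      (fun α hα => (hB α hα).imp fun B hB t ht x => by
        linarith [(hB x).1, hge _ (hin t ht).2 x]) ht1 x
  have h2 : u (t + δ) x ≤ u t x + K * δ :=
    IsSub.le_isSuper (u := fun t x => u (t + δ) x) (v := fun t x => u t x + K * δ) hn hs hC hχ hχt
      hcs (hc.add continuousOn_const) hψL.continuous (fun t ht => (hi t ht).2)
      (fun t ht => (hi t ht).1.add (weightedIntegrable_const hs.1 _))
      (hu.subsolution.isSub.shift hδ) hsup2
      (fun t ht x => by linarith [hge _ (hin t ht).1 x])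
      (fun x => by rw [hu.initial, zero_add]; linarith [(h0 x).2])
      (fun α hα => (hB α hα).imp fun B hB t ht x => (hB x).2 _ (hin t ht).2)
      (fun α hα => (hB α hα).imp fun B hB t ht x => by
        linarith [(hB x).1, hge _ (hin t ht).1 x]) ht1 x
  rw [add_sub_cancel_left, abs_of_nonneg hδ]
  exact abs_le.2 ⟨by linarith, by linarith⟩

end InitialSpeed

/-! ### Lipschitz constants and gradients -/

section Gradient

variable {n : ℕ}

/-- A Lipschitz function whose gradient is bounded by `L` almost everywhere is `L`-Lipschitz: by
Fubini's theorem, almost every line in a given direction meets the exceptional set in a null set. -/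
lemma LipschitzWith.of_ae_norm_fderiv_le {f : Euc n → ℝ} {M L : NNReal} (hf : LipschitzWith M f)
    (h : ∀ᵐ x, ‖fderiv ℝ f x‖ ≤ L) : LipschitzWith L f := by
  have key : ∀ v x, |f (x + v) - f x| ≤ L * ‖v‖ := by
    intro v
    set p : Euc n → Prop := fun x => DifferentiableAt ℝ f x ∧ ‖fderiv ℝ f x‖ ≤ L with hp
    have hpm : MeasurableSet {x | p x} := (measurableSet_of_differentiableAt ℝ f).inter
      (measurableSet_le (measurable_fderiv ℝ f).norm measurable_const)
    have hpae : ∀ᵐ x, p x := (hf.ae_differentiableAt).and h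
    have h1 : ∀ᵐ x : Euc n, ∀ᵐ t : ℝ, p (x + t • v) := by
      refine (Measure.ae_ae_comm (μ := (volume : Measure ℝ)) (ν := (volume : Measure (Euc n)))
        (p := fun t x => p (x + t • v)) ?_).1 (Eventually.of_forall fun t => ?_)
      · exact hpm.preimage (by fun_prop : Measurable fun q : ℝ × Euc n => q.2 + q.1 • v)
      · exact (measurePreserving_add_right volume (t • v)).quasiMeasurePreserving.ae hpae
    have h2 : ∀ᵐ x : Euc n, |f (x + v) - f x| ≤ L * ‖v‖ := by
      filter_upwards [h1] with x hx
      set g : ℝ → ℝ := fun t => f (x + t • v) with hg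
      have hgl : LipschitzWith (M * ‖v‖₊) g := by
        refine LipschitzWith.of_dist_le_mul fun a b => (hf.dist_le_mul _ _).trans_eq ?_
        rw [dist_add_left, dist_eq_norm, ← sub_smul, norm_smul, dist_eq_norm]
        push_cast; ring
      have h3 : ‖∫ t in (0 : ℝ)..1, deriv g t‖ ≤ L * ‖v‖ * |1 - 0| := by
        refine intervalIntegral.norm_integral_le_of_norm_le_const_ae ?_
        filter_upwards [hx] with t ht _
        have h4 : HasDerivAt (fun t : ℝ => x + t • v) v t := by
          simpa using ((hasDerivAt_id t).smul_const v).const_add x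
        have h5 : HasDerivAt g (fderiv ℝ f (x + t • v) v) t :=
          ht.1.hasFDerivAt.comp_hasDerivAt t h4
        rw [h5.deriv]
        exact (ContinuousLinearMap.le_opNorm _ _).trans
          (mul_le_mul_of_nonneg_right ht.2 (norm_nonneg v))
      rw [(hgl.lipschitzOnWith.absolutelyContinuousOnInterval).integral_deriv_eq_sub] at h3
      simpa [hg] using h3
    refine (Measure.dense_of_ae h2).induction (fun x hx => hx) (isClosed_le ?_ continuous_const)
    have := hf.continuous
    fun_prop
  refine LipschitzWith.of_dist_le_mul fun x y => ?_
  have := key (x - y) y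
  rwa [add_sub_cancel, ← Real.dist_eq, ← dist_eq_norm] at this

lemma norm_gradient (f : Euc n → ℝ) (x : Euc n) : ‖gradient f x‖ = ‖fderiv ℝ f x‖ := by
  simp [gradient]

lemma eLpNorm_gradient_le {f : Euc n → ℝ} {L : NNReal} (hf : LipschitzWith L f) :
    eLpNorm (gradient f) ⊤ volume ≤ L := by
  rw [eLpNorm_exponent_top]
  refine eLpNormEssSup_le_of_ae_nnnorm_bound (Eventually.of_forall fun x => ?_)
  rw [← NNReal.coe_le_coe, coe_nnnorm, norm_gradient]
  exact norm_fderiv_le_of_lipschitz ℝ hf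

lemma LipschitzWith.of_eLpNorm_gradient_le {f : Euc n → ℝ} {M L : NNReal} (hf : LipschitzWith M f)
    (h : eLpNorm (gradient f) ⊤ volume ≤ L) : LipschitzWith L f := by
  rw [eLpNorm_exponent_top] at h
  refine hf.of_ae_norm_fderiv_le ?_
  filter_upwards [ae_le_eLpNormEssSup (f := gradient f) (μ := volume)] with x hx
  have h1 := hx.trans h
  rw [enorm_eq_nnnorm, ENNReal.coe_le_coe, ← NNReal.coe_le_coe, coe_nnnorm, norm_gradient] at h1
  exact h1

end Gradient

end

theorem corollary3p4 (n : ℕ) (hn : 0 < n) (s : ℝ) (hs : s ∈ Set.Ioo (0 : ℝ) 1)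
    (T : ℝ) (hT : 0 < T)
    (ψ u₀ : EuclideanSpace ℝ (Fin n) → ℝ)
    (hψ_lip : ∃ L, LipschitzWith L ψ) (hψ_semi : IsSemiconvex ψ)
    (hψ_int : WeightedIntegrable s ψ)
    (hu₀_lip : ∃ L, LipschitzWith L u₀) (hu₀_semi : IsSemiconvex u₀)
    (h_above : ∀ x, ψ x ≤ u₀ x)
    (u : ℝ → EuclideanSpace ℝ (Fin n) → ℝ) (hu : IsObstacleSolution s T ψ u₀ u) :
    (fracLapNorm s u₀ < ⊤ →
      ∃ L, LipschitzOnWith L (fun p : ℝ × EuclideanSpace ℝ (Fin n) => u p.1 p.2)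
        (Set.Icc 0 T ×ˢ Set.univ)) ∧
    MeasureTheory.eLpNorm
        (fun p : ℝ × EuclideanSpace ℝ (Fin n) => deriv (fun t => u t p.2) p.1) ⊤
        (MeasureTheory.volume.restrict (Set.Icc 0 T ×ˢ Set.univ)) +
      MeasureTheory.eLpNorm
        (fun p : ℝ × EuclideanSpace ℝ (Fin n) => gradient (u p.1) p.2) ⊤
        (MeasureTheory.volume.restrict (Set.Icc 0 T ×ˢ Set.univ)) ≤
    max (MeasureTheory.eLpNorm (gradient u₀) ⊤ MeasureTheory.volume)
        (MeasureTheory.eLpNorm (gradient ψ) ⊤ MeasureTheory.volume) +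
      fracLapNorm s u₀ := by
  obtain ⟨Lψ, hLψ⟩ := hψ_lip
  obtain ⟨L₀, hL₀⟩ := hu₀_lip
  -- the smallest common Lipschitz constant of the data
  obtain ⟨L, hL⟩ : ∃ L : NNReal, (L : ENNReal) = max (eLpNorm (gradient u₀) ⊤ volume)
      (eLpNorm (gradient ψ) ⊤ volume) := by
    refine ⟨_, ENNReal.coe_toNNReal (max_lt ?_ ?_).ne⟩
    · exact (eLpNorm_gradient_le hL₀).trans_lt ENNReal.coe_lt_top
    · exact (eLpNorm_gradient_le hLψ).trans_lt ENNReal.coe_lt_top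
  have hu₀L : LipschitzWith L u₀ := hL₀.of_eLpNorm_gradient_le (hL ▸ le_max_left _ _)
  have hψL : LipschitzWith L ψ := hLψ.of_eLpNorm_gradient_le (hL ▸ le_max_right _ _)
  rw [← hL]
  have hspace : ∀ t ∈ Icc 0 T, LipschitzWith L (u t) := fun t ht =>
    hu.lipschitzWith_space hn hs hT hψL hψ_int hu₀L h_above ht
  rcases eq_or_ne (fracLapNorm s u₀) ⊤ with htop | htop
  · simp [htop]
  obtain ⟨K, hK⟩ : ∃ K : NNReal, (K : ENNReal) = fracLapNorm s u₀ :=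
    ⟨_, ENNReal.coe_toNNReal htop⟩
  rw [← hK]
  have htime : ∀ t ∈ Icc 0 T, ∀ t' ∈ Icc 0 T, ∀ x, |u t' x - u t x| ≤ K * |t' - t| :=
    fun t ht t' ht' x => hu.abs_sub_le_time hn hs hT hψL hψ_int hu₀L hu₀_semi h_above K.2
      (by rw [← hK]; simp) ht ht' x
  have hm : MeasurableSet (Icc 0 T ×ˢ (univ : Set (Euc n))) := measurableSet_Icc.prod .univ
  refine ⟨fun _ => ⟨K + L, LipschitzOnWith.of_dist_le_mul fun p hp q hq => ?_⟩, ?_⟩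
  · have h1 := htime q.1 hq.1 p.1 hp.1 p.2
    have h2 := (hspace q.1 hq.1).dist_le_mul p.2 q.2
    have h3 := mul_le_mul_of_nonneg_left (le_max_left (dist p.1 q.1) (dist p.2 q.2)) K.2
    have h4 := mul_le_mul_of_nonneg_left (le_max_right (dist p.1 q.1) (dist p.2 q.2)) L.2
    have h5 := dist_triangle (u p.1 p.2) (u q.1 p.2) (u q.1 q.2)
    rw [← Real.dist_eq, ← Real.dist_eq] at h1
    rw [Prod.dist_eq]
    push_cast
    simp only [NNReal.val_eq_coe] at h3 h4
    linarith
  · rw [add_comm (L : ENNReal), eLpNorm_exponent_top, eLpNorm_exponent_top]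
    refine add_le_add (eLpNormEssSup_le_of_ae_nnnorm_bound ?_)
      (eLpNormEssSup_le_of_ae_nnnorm_bound ?_)
    · -- the endpoints of the time interval, where `deriv` sees values outside it, are negligible
      have hend : ∀ᵐ p : ℝ × Euc n, p.1 ∈ Icc 0 T → p.1 ∈ Ioo 0 T := by
        have h1 : ∀ᵐ t : ℝ, t ∈ Icc 0 T → t ∈ Ioo 0 T := by
          filter_upwards [Ioo_ae_eq_Icc (a := (0 : ℝ)) (b := T) (μ := volume)] with t ht hmem
          exact (iff_of_eq ht).2 hmem
        exact Measure.quasiMeasurePreserving_fst.ae h1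
      rw [ae_restrict_iff' hm]
      filter_upwards [hend] with p hp hmem
      have h1 : LipschitzOnWith K (fun t => u t p.2) (Icc 0 T) :=
        LipschitzOnWith.of_dist_le_mul fun t ht t' ht' => htime t' ht' t ht p.2
      exact norm_deriv_le_of_lipschitzOn
        (Icc_mem_nhds (hp hmem.1).1 (hp hmem.1).2) h1
    · rw [ae_restrict_iff' hm]
      refine Eventually.of_forall fun p hp => ?_
      rw [← NNReal.coe_le_coe, coe_nnnorm, norm_gradient]
      exact norm_fderiv_le_of_lipschitz ℝ (hspace p.1 hp.1)
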